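/- Let $p$ be an odd prime and let $L/K$ be a finite Galois extension of number fields with Galois group $G$. For a number field $F$ let $F_\infty = F\,\mathbb{Q}_\infty$ be its cyclotomic $\mathbb{Z}_p$-extension (all fields being taken inside a fixed algebraically closed field of characteristic $0$), and put $\mathcal{G} = \mathrm{Gal}(L_\infty/K)$ and $H = \mathrm{Gal}(L_\infty/K_\infty)$. Terminology. For a finite subgroup $N$ of a group write $e_N = |N|^{-1}\sum_{\sigma\in N}\sigma$. For a finite group $X$ and $N \trianglelefteq X$, the group ring $\mathbb{Z}_p[X]$ is called $N$-hybrid if $e_N \in \mathbb{Z}_p[X]$ and $\mathbb{Z}_p[X](1-e_N)$ is a maximal $\mathbb{Z}_p$-order in $\mathbb{Q}_p[X](1-e_N)$. Let $\Lambda(\mathcal{G}) = \mathbb{Z}_p[[\mathcal{G}]] = \varprojlim_{\mathcal U} \mathbb{Z}_p[\mathcal{G}/\mathcal{U}]$, where $\mathcal U$ runs over the open normal subgroups of $\mathcal G$, let $\mathcal{Q}(\mathcal{G})$ be its total ring of fractions, obtained by inverting all central regular elements, and let $\Gamma_0$ denote an open central subgroup of $\mathcal{G}$ that is topologically isomorphic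 to $\mathbb{Z}_p$ (such subgroups exist). For a finite normal subgroup $N$ of $\mathcal{G}$, the Iwasawa algebra $\Lambda(\mathcal{G})$ is called $N$-hybrid if $e_N \in \Lambda(\mathcal{G})$ and $\Lambda(\mathcal{G})(1-e_N)$ is a maximal $\mathbb{Z}_p[[\Gamma_0]]$-order in $\mathcal{Q}(\mathcal{G})(1-e_N)$; this does not depend on the choice of $\Gamma_0$. Statement. Let $N$ be a normal subgroup of $G$ such that $\mathbb{Z}_p[G]$ is $N$-hybrid, and let $F = L^N$. Then restriction of automorphisms to $L$ maps the subgroup $\mathrm{Gal}(L_\infty/F_\infty)$ of $\mathcal{G}$ isomorphically onto $N$. Identify $N$ with $\mathrm{Gal}(L_\infty/F_\infty)$ in this way. Then $N$ is a normal subgroup of $\mathcal{G}$, it is contained in $H$, and it is a normal subgroup of $H$. Moreover, both $\mathbb{Z}_p[H]$ and $\Lambda(\mathcal{G})$ are $N$-hybrid. -/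

import Mathlib

noncomputable section

/-! ### Orders in corner algebras -/

/-- Let `A` be an algebra over a commutative ring `R` on which the regular elements of `R` act
invertibly, and let `e` be a central idempotent of `A`.  Then `M` is an `R`-order in the algebra
`A e` (whose identity is `e`) if it is a subring of `A e` containing the identity `e`, it is finitely
generated as an `R`-module, and it spans `A e` over the total ring of fractions of `R`,
i.e. every element of `A e` is of the form `r⁻¹ m` with `m ∈ M` and `r` a regular element of `R`. -/
structure IsOrderIn (R : Type*) [CommRing R] {A : Type*} [Ring A] [Algebra R A] (e : A)
    (M : Submodule R A) : Prop where
  mul_idem : ∀ x ∈ M, x * e = x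
  idem_mem : e ∈ M
  mul_mem : ∀ x ∈ M, ∀ y ∈ M, x * y ∈ M
  fg : M.FG
  spans : ∀ a : A, ∃ r ∈ nonZeroDivisors R, r • (a * e) ∈ M

/-- An `R`-order in `A e` is maximal if it is not properly contained in another `R`-order. -/
def IsMaximalOrderIn (R : Type*) [CommRing R] {A : Type*} [Ring A] [Algebra R A] (e : A)
    (M : Submodule R A) : Prop :=
  IsOrderIn R e M ∧ ∀ M' : Submodule R A, IsOrderIn R e M' → M ≤ M' → M' = M

/-! ### Hybrid `p`-adic group rings -/

/-- The inclusion `ℤ_p[G] → ℚ_p[G]`. -/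
def groupRingIncl (p : ℕ) [Fact p.Prime] (G : Type*) [Group G] :
    MonoidAlgebra ℤ_[p] G →ₐ[ℤ_[p]] MonoidAlgebra ℚ_[p] G :=
  MonoidAlgebra.mapAlgHom G (Algebra.ofId ℤ_[p] ℚ_[p])

/-- The trace idempotent `e_N = |N|⁻¹ ∑_{σ ∈ N} σ` in `ℚ_p[G]`. -/
def groupRingIdem (p : ℕ) [Fact p.Prime] {G : Type*} [Group G] (N : Subgroup G) :
    MonoidAlgebra ℚ_[p] G :=
  (Nat.card N : ℚ_[p])⁻¹ • ∑ᶠ σ : N, MonoidAlgebra.of ℚ_[p] G (σ : G)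

/-- `ℤ_p[G] (1 - e_N)`, as a `ℤ_p`-submodule of `ℚ_p[G]`. -/
def groupRingCut (p : ℕ) [Fact p.Prime] {G : Type*} [Group G] (N : Subgroup G) :
    Submodule ℤ_[p] (MonoidAlgebra ℚ_[p] G) :=
  LinearMap.range
    (LinearMap.mulRight ℤ_[p] (1 - groupRingIdem p N) ∘ₗ (groupRingIncl p G).toLinearMap)

/-- `G` is a finite group with normal subgroup `N`, and `ℤ_p[G]` is `N`-hybrid:
`e_N ∈ ℤ_p[G]`, and `ℤ_p[G] (1 - e_N)` is a maximal `ℤ_p`-order in `ℚ_p[G] (1 - e_N)`. -/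
structure IsHybridGroupRing (p : ℕ) [Fact p.Prime] {G : Type*} [Group G] (N : Subgroup G) :
    Prop where
  finite : Finite G
  normal : N.Normal
  idem_mem : groupRingIdem p N ∈ (groupRingIncl p G).range
  maximal : IsMaximalOrderIn ℤ_[p] (1 - groupRingIdem p N) (groupRingCut p N)

/-! ### Total rings of fractions -/

/-- The multiplicative set of central regular elements of a ring `Λ`. -/
def centralRegular (Λ : Type*) [Ring Λ] : Submonoid (Subring.center Λ) :=
  (nonZeroDivisors Λ).comap (Subring.center Λ).subtype

/-- The total ring of fractions of `Λ`, obtained from `Λ` by adjoining inverses of all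
central regular elements. -/
def TotalFractions (Λ : Type*) [Ring Λ] : Type _ :=
  LocalizedModule (centralRegular Λ) Λ

instance (Λ : Type*) [Ring Λ] : Ring (TotalFractions Λ) :=
  inferInstanceAs (Ring (LocalizedModule (centralRegular Λ) Λ))

instance (Λ : Type*) [Ring Λ] : Algebra (Subring.center Λ) (TotalFractions Λ) :=
  inferInstanceAs (Algebra (Subring.center Λ) (LocalizedModule (centralRegular Λ) Λ))

/-- The canonical map from `Λ` to its total ring of fractions. -/
def toTotalFractions (Λ : Type*) [Ring Λ] : Λ →ₐ[Subring.center Λ] TotalFractions Λ where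
  toFun x := LocalizedModule.mk x 1
  map_one' := OreLocalization.one_def.symm
  map_mul' x y := by
    refine Eq.trans ?_ (LocalizedModule.mk_mul_mk (S := centralRegular Λ)).symm
    rw [mul_one]
  map_zero' := LocalizedModule.zero_mk 1
  map_add' x y := by
    refine Eq.trans ?_ (LocalizedModule.mk_add_mk (S := centralRegular Λ)).symm
    rw [one_smul, one_smul, mul_one]
  commutes' r := rfl

/-- `Λ e`, as an `R`-submodule of the total ring of fractions of `Λ`, for a central subring `R`
of `Λ`. -/
def totalFractionsCut {Λ : Type*} [Ring Λ] (R : Subring (Subring.center Λ))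
    (e : TotalFractions Λ) : Submodule R (TotalFractions Λ) :=
  LinearMap.range
    (LinearMap.mulRight R e ∘ₗ (toTotalFractions Λ).toLinearMap.restrictScalars R)

/-! ### Iwasawa algebras -/

section Iwasawa

variable (p : ℕ) [Fact p.Prime]

/-- The transition map `ℤ_p[G/U] → ℤ_p[G/V]` for open normal subgroups `U ≤ V`. -/
def iwasawaTransition {G : Type*} [Group G] [TopologicalSpace G] {U V : OpenNormalSubgroup G}
    (h : U ≤ V) :
    MonoidAlgebra ℤ_[p] (G ⧸ U.toSubgroup) →+* MonoidAlgebra ℤ_[p] (G ⧸ V.toSubgroup) :=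
  MonoidAlgebra.mapDomainRingHom ℤ_[p]
    (QuotientGroup.map U.toSubgroup V.toSubgroup (MonoidHom.id G) (fun _ hx => h hx))

/-- `lim_U ℤ_p[G/U]`, as a subring of the product of the `ℤ_p[G/U]`, where `U` runs
through the open normal subgroups of `G`. -/
def iwasawaSubring (G : Type*) [Group G] [TopologicalSpace G] :
    Subring (∀ U : OpenNormalSubgroup G, MonoidAlgebra ℤ_[p] (G ⧸ U.toSubgroup)) where
  carrier := {x | ∀ (U V : OpenNormalSubgroup G) (h : U ≤ V), iwasawaTransition p h (x U) = x V}
  mul_mem' hx hy U V h := by simp [hx U V h, hy U V h]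
  one_mem' U V h := by simp
  add_mem' hx hy U V h := by simp [hx U V h, hy U V h]
  zero_mem' U V h := by simp
  neg_mem' hx U V h := by simp [hx U V h]

/-- The Iwasawa algebra `Λ(G) = ℤ_p[[G]] = lim_U ℤ_p[G/U]`. -/
def IwasawaAlgebra (G : Type*) [Group G] [TopologicalSpace G] : Type _ :=
  iwasawaSubring p G

instance (G : Type*) [Group G] [TopologicalSpace G] : Ring (IwasawaAlgebra p G) :=
  inferInstanceAs (Ring (iwasawaSubring p G))

/-- The canonical map `G → Λ(G)`. -/
def iwasawaOf {G : Type*} [Group G] [TopologicalSpace G] (g : G) : IwasawaAlgebra p G :=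
  ⟨fun _ => MonoidAlgebra.of ℤ_[p] _ (QuotientGroup.mk g), fun U V h => by
    simp only [iwasawaTransition, MonoidAlgebra.of_apply, MonoidAlgebra.mapDomainRingHom_apply,
      MonoidAlgebra.mapDomain_single]
    rfl⟩

/-- The preimage of an open normal subgroup under a continuous homomorphism. -/
def openNormalComap {Γ G : Type*} [Group Γ] [TopologicalSpace Γ] [Group G] [TopologicalSpace G]
    (φ : Γ →* G) (hφ : Continuous φ) (U : OpenNormalSubgroup G) : OpenNormalSubgroup Γ where
  toOpenSubgroup := U.toOpenSubgroup.comap φ hφ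
  isNormal' := U.isNormal'.comap φ

/-- The ring homomorphism `ℤ_p[Γ/φ⁻¹(U)] → ℤ_p[G/U]` induced by `φ : Γ → G`. -/
def iwasawaMapComponent {Γ G : Type*} [Group Γ] [TopologicalSpace Γ] [Group G]
    [TopologicalSpace G] (φ : Γ →* G) (hφ : Continuous φ) (U : OpenNormalSubgroup G) :
    MonoidAlgebra ℤ_[p] (Γ ⧸ (openNormalComap φ hφ U).toSubgroup) →+*
      MonoidAlgebra ℤ_[p] (G ⧸ U.toSubgroup) :=
  MonoidAlgebra.mapDomainRingHom ℤ_[p]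
    (QuotientGroup.map (openNormalComap φ hφ U).toSubgroup U.toSubgroup φ (fun _ hx => hx))

theorem iwasawaMapComponent_compat {Γ G : Type*} [Group Γ] [TopologicalSpace Γ] [Group G]
    [TopologicalSpace G] (φ : Γ →* G) (hφ : Continuous φ) {U V : OpenNormalSubgroup G}
    (h : U ≤ V) (h' : openNormalComap φ hφ U ≤ openNormalComap φ hφ V)
    (x : MonoidAlgebra ℤ_[p] (Γ ⧸ (openNormalComap φ hφ U).toSubgroup)) :
    iwasawaTransition p h (iwasawaMapComponent p φ hφ U x) =
      iwasawaMapComponent p φ hφ V (iwasawaTransition p h' x) := by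
  unfold iwasawaTransition iwasawaMapComponent
  rw [← RingHom.comp_apply, ← RingHom.comp_apply, ← MonoidAlgebra.mapDomainRingHom_comp,
    ← MonoidAlgebra.mapDomainRingHom_comp]
  congr 2
  ext y
  rfl

/-- The ring homomorphism `Λ(Γ) → Λ(G)` induced by a continuous homomorphism `Γ → G`:
on the component at `U` it is induced by `Γ/φ⁻¹(U) → G/U`. -/
def iwasawaMap {Γ G : Type*} [Group Γ] [TopologicalSpace Γ] [Group G] [TopologicalSpace G]
    (φ : Γ →* G) (hφ : Continuous φ) : IwasawaAlgebra p Γ →+* IwasawaAlgebra p G where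
  toFun x := ⟨fun U => iwasawaMapComponent p φ hφ U (x.1 (openNormalComap φ hφ U)),
    fun U V h => by
      have h' : openNormalComap φ hφ U ≤ openNormalComap φ hφ V := fun _ hy => h hy
      rw [iwasawaMapComponent_compat p φ hφ h h', x.2 _ _ h']⟩
  map_one' := Subtype.ext (funext fun U => map_one (iwasawaMapComponent p φ hφ U))
  map_mul' _ _ := Subtype.ext (funext fun U => map_mul (iwasawaMapComponent p φ hφ U) _ _)
  map_zero' := Subtype.ext (funext fun U => map_zero (iwasawaMapComponent p φ hφ U))
  map_add' _ _ := Subtype.ext (funext fun U => map_add (iwasawaMapComponent p φ hφ U) _ _)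

variable {G : Type*} [Group G] [TopologicalSpace G]

/-- The trace idempotent `e_N = |N|⁻¹ ∑_{σ ∈ N} σ` in the total ring of fractions of `Λ(G)`, for a
finite subgroup `N`. -/
def iwasawaIdem (N : Subgroup G) : TotalFractions (IwasawaAlgebra p G) :=
  Ring.inverse (Nat.card N : TotalFractions (IwasawaAlgebra p G)) *
    ∑ᶠ σ : N, toTotalFractions (IwasawaAlgebra p G) (iwasawaOf p (σ : G))

/-- The image of `Λ(Γ₀) = ℤ_p[[Γ₀]]` in `Λ(G)` for a central subgroup `Γ₀` of `G`,
as a subring of the centre of `Λ(G)`. -/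
def iwasawaBase (Γ₀ : Subgroup G) : Subring (Subring.center (IwasawaAlgebra p G)) :=
  (iwasawaMap p Γ₀.subtype continuous_subtype_val).range.comap
    (Subring.center (IwasawaAlgebra p G)).subtype

/-- `Γ₀` is a central open subgroup of `G` which is isomorphic to `ℤ_p` as a topological group. -/
structure IsCentralZp (Γ₀ : Subgroup G) : Prop where
  isOpen : IsOpen (Γ₀ : Set G)
  le_center : Γ₀ ≤ Subgroup.center G
  equiv : Nonempty (Γ₀ ≃ₜ* Multiplicative ℤ_[p])

/-- `G` is a one-dimensional `p`-adic Lie group possessing a central open subgroup `Γ₀ ≃ ℤ_p`,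
`N` is a finite normal subgroup of `G`, and `Λ(G)` is `N`-hybrid: `e_N ∈ Λ(G)`, and, for every
choice of `Γ₀`, `Λ(G) (1 - e_N)` is a maximal `ℤ_p[[Γ₀]]`-order in `Q(G) (1 - e_N)`, where `Q(G)` is
the total ring of fractions of `Λ(G)`.  (`|N|` is a central regular element of `Λ(G)`, hence
invertible in `Q(G)`.  The last condition does not depend on the choice of `Γ₀`.) -/
structure IsHybridIwasawaAlgebra (N : Subgroup G) : Prop where
  finite : Finite N
  normal : N.Normal
  exists_base : ∃ Γ₀ : Subgroup G, IsCentralZp p Γ₀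
  idem_mem : iwasawaIdem p N ∈ Set.range (toTotalFractions (IwasawaAlgebra p G))
  maximal : ∀ Γ₀ : Subgroup G, IsCentralZp p Γ₀ →
    IsMaximalOrderIn (iwasawaBase p Γ₀) (1 - iwasawaIdem p N)
      (totalFractionsCut (iwasawaBase p Γ₀) (1 - iwasawaIdem p N))

end Iwasawa

/-! ### Cyclotomic `ℤ_p`-extensions

All fields are considered inside one algebraically closed field `Ω` of characteristic zero. -/

section Cyclotomic

variable (p : ℕ) (Ω : Type*) [Field Ω] [CharZero Ω]

/-- The field `ℚ(μ_{p^∞})`. -/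
def rationalMuInfty : IntermediateField ℚ Ω :=
  IntermediateField.adjoin ℚ {ζ : Ω | ∃ n : ℕ, ζ ^ p ^ n = 1}

/-- The cyclotomic `ℤ_p`-extension `ℚ_∞` of `ℚ`: the fixed field in `ℚ(μ_{p^∞})` of the torsion
subgroup of the (abelian) group `Gal(ℚ(μ_{p^∞})/ℚ)`. -/
def rationalZpExtension : IntermediateField ℚ Ω :=
  IntermediateField.lift (F := rationalMuInfty p Ω)
    (IntermediateField.fixedField
      (Subgroup.closure {σ : Gal(rationalMuInfty p Ω/ℚ) | IsOfFinOrder σ}))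

/-- The cyclotomic `ℤ_p`-extension `F_∞ = F ℚ_∞` of a number field `F`. -/
def cyclotomicZpExtension (F : Type*) [Field F] [Algebra F Ω] : IntermediateField F Ω :=
  IntermediateField.adjoin F (rationalZpExtension p Ω : Set Ω)

variable (K L : Type*) [Field K] [Field L] [Algebra K L] [Algebra K Ω] [Algebra L Ω]
  [IsScalarTower K L Ω]

/-- The group `𝒢 = Gal(L_∞/K)`. -/
abbrev iwasawaGaloisGroup : Type _ := Gal(cyclotomicZpExtension p Ω L/K)

/-- For a field `F` with `K ⊆ F ⊆ L`, the subgroup `Gal(L_∞/F_∞)` of `Gal(L_∞/K)`: the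
automorphisms which fix the elements of `F_∞`. -/
def iwasawaGaloisSubgroup (F : Type*) [Field F] [Algebra F Ω] :
    Subgroup (iwasawaGaloisGroup p Ω K L) :=
  fixingSubgroup (iwasawaGaloisGroup p Ω K L)
    {x : cyclotomicZpExtension p Ω L | (x : Ω) ∈ cyclotomicZpExtension p Ω F}

/-- Restriction of automorphisms `Gal(L_∞/K) → Gal(L/K)`. -/
def iwasawaRestrict [Normal K L] : iwasawaGaloisGroup p Ω K L →* Gal(L/K) :=
  AlgEquiv.restrictNormalHom L

end Cyclotomic

end

/-! ### Divisibility of traces of endomorphisms -/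

noncomputable section

/-! For a finite group `X` and a normal subgroup `N`, the ring `ℤ_p[X]` is `N`-hybrid exactly when
`p` does not divide `|N|` and no element of order `p` commutes with a nontrivial element of `N`
(`NoCommuting`). The same condition makes the Iwasawa algebra of a compact group with a central open
`ℤ_p` hybrid. So the condition is extracted from `ℤ_p[G]`, carried to `H` and `𝒢`, and turned back
into hybridity there. A character `κ : 𝒢 → ℤ_p` has kernel `H`, and restriction to `L` is injective
on `H`. As `ℤ_p` is torsion-free, elements of finite order in `𝒢` lie in `H` and embed into `G`, so
the condition is inherited. The elements of `N` lift to `H` because their orders are prime to `p`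
(`exists_mem_ker_map_eq`).

Sufficiency (`dvd_t_of_mem_order`). Let `Λ` be the ring over `R = ℤ_p` or `R = Λ(Γ₀)`, with its
trace form `t`, and let `z = y / s` lie in an order containing `Λ(1 - e)`. Since `y e = 0`, `t(y)`
is minus the sum of `t(n y)` over `n ≠ 1` in `N`. The map `w ↦ n w y` is `s` times an integral
endomorphism, so its trace over an integrally closed commutative subring `D` attached to a subgroup
`P` of the centralizer of `n` is divisible by `s`. Applying `t` to this trace gives the index of `P`
in the centralizer times the part of the sum over the conjugacy class of `n`. `NoCommuting` provides
a `P` of index prime to `p`: the trivial group when the group is finite, a copy of `ℤ_p` (so `D ≅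
ℤ_p⟦X⟧`) for Iwasawa algebras.

Necessity (`IsHybridGroupRing.noCommuting`). As in the proof that maximal orders are hereditary,
left ideals of `S = ℤ_p[X]` containing `p` and `e` are projective. For `g` of order `p` with norm
element `c = 1 + g + ⋯ + g^(p-1)`, the module `S c (1 - e)` is then projective, which yields `v`
with `g v = v` and `v c (1 - e) = c (1 - e)`. If `g` commutes with some `n ≠ 1` in `N`, the
coefficients at `n` show that `p` divides the unit `1/|N|`. -/

open Polynomial in
/-- An endomorphism `φ` of a finite free module over an integrally closed domain such that `φ / s` is
integral has trace divisible by `s`. -/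
theorem dvd_trace_of_aeval_scaleRoots {D M : Type*} [CommRing D] [IsDomain D]
    [IsIntegrallyClosed D] [AddCommGroup M] [Module D M] [Module.Free D M] [Module.Finite D M]
    (φ : Module.End D M) {s : D} (hs : s ≠ 0) {f : D[X]} (hf : f.Monic)
    (h : aeval φ (f.scaleRoots s) = 0) : s ∣ LinearMap.trace D M φ := by
  classical
  let K := FractionRing D
  let E := AlgebraicClosure K
  let b := Module.Free.chooseBasis D M
  let A := LinearMap.toMatrix b b φ
  have hinj : Function.Injective (algebraMap D E) := by
    rw [IsScalarTower.algebraMap_eq D K E]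
    exact (algebraMap K E).injective.comp (IsFractionRing.injective D K)
  have hsE : algebraMap D E s ≠ 0 := by
    rwa [Ne, map_eq_zero_iff _ hinj]
  let A' : Matrix _ _ E := A.map (algebraMap D E)
  rcases isEmpty_or_nonempty (Module.Free.ChooseBasisIndex D M) with hemp | hne
  · rw [LinearMap.trace_eq_matrix_trace D b φ]
    simp [Matrix.trace]
  have hA : aeval A (f.scaleRoots s) = 0 := by
    have := congrArg (LinearMap.toMatrixAlgEquiv b).toAlgHom h
    rw [map_zero] at this
    exact (Polynomial.aeval_algHom_apply (LinearMap.toMatrixAlgEquiv b).toAlgHom φ _).trans this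
  have hA' : aeval A' ((f.scaleRoots s).map (algebraMap D E)) = 0 := by
    have := congrArg ((Algebra.ofId D E).mapMatrix) hA
    rw [map_zero, ← Polynomial.aeval_algHom_apply] at this
    rw [Polynomial.aeval_map_algebraMap]
    exact this
  -- Each eigenvalue `μ` is a root of `f.scaleRoots s`, so `μ / s` is a root of the monic `f`. The
  -- trace divided by `s` is a sum of such integral elements and lies in the fraction field of `D`.
  have hroot : ∀ μ ∈ A'.charpoly.roots, IsIntegral D (μ / algebraMap D E s) := by
    intro μ hμ
    have h1 : μ ∈ spectrum E A' :=
      Matrix.mem_spectrum_iff_isRoot_charpoly.mpr (Polynomial.isRoot_of_mem_roots hμ)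
    have h2 := spectrum.subset_polynomial_aeval A' ((f.scaleRoots s).map (algebraMap D E))
      ⟨μ, h1, rfl⟩
    rw [hA', spectrum.zero_eq, Set.mem_singleton_iff] at h2
    dsimp only at h2
    rw [eval_map, ← mul_div_cancel₀ μ hsE,
      Polynomial.scaleRoots_eval₂_mul] at h2
    refine ⟨f, hf, ?_⟩
    exact (mul_eq_zero.mp h2).resolve_left (pow_ne_zero _ hsE)
  have htr : IsIntegral D (A'.trace / algebraMap D E s) := by
    rw [Matrix.trace_eq_sum_roots_charpoly, div_eq_mul_inv, ← Multiset.map_id A'.charpoly.roots,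
      ← Multiset.sum_map_mul_right]
    refine IsIntegral.multiset_sum ?_
    intro x hx
    obtain ⟨μ, hμ, rfl⟩ := Multiset.mem_map.mp hx
    simpa [div_eq_mul_inv] using hroot μ hμ
  have htr2 : A'.trace / algebraMap D E s =
      algebraMap K E (algebraMap D K A.trace / algebraMap D K s) := by
    rw [map_div₀, ← IsScalarTower.algebraMap_apply, ← IsScalarTower.algebraMap_apply]
    congr 1
    simp [A', Matrix.trace, map_sum]
  rw [htr2, isIntegral_algebraMap_iff (algebraMap K E).injective] at htr
  obtain ⟨d, hd⟩ := IsIntegrallyClosed.isIntegral_iff.mp htr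
  refine ⟨d, ?_⟩
  rw [LinearMap.trace_eq_matrix_trace D b φ]
  apply IsFractionRing.injective D K
  have hsK : algebraMap D K s ≠ 0 := by
    rwa [Ne, map_eq_zero_iff _ (IsFractionRing.injective D K)]
  rw [map_mul, hd, mul_div_cancel₀ _ hsK]

/-! ### Group-like spanning sets -/

/-- An `R`-algebra `Λ` which is a twisted group ring over `R`: it is spanned by the image of a group `G`,
a central subgroup `Z` of finite index maps into `R`, and there is an `R`-linear projection `t`
killing the elements of `G` outside `Z`. -/
structure TwistedGroupRing (R Λ G : Type*) [CommRing R] [Ring Λ] [Algebra R Λ] [Group G] where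
  of : G →* Λ
  Z : Subgroup G
  le_center : Z ≤ Subgroup.center G
  finiteIndex : Z.FiniteIndex
  t : Λ →ₗ[R] R
  t_one : t 1 = 1
  t_of : ∀ g, g ∉ Z → t (of g) = 0
  of_mem : ∀ g ∈ Z, ∃ r : R, of g = algebraMap R Λ r
  span : Submodule.span R (Set.range of) = ⊤

namespace TwistedGroupRing

variable {R Λ G : Type*} [CommRing R] [Ring Λ] [Algebra R Λ] [Group G] (S : TwistedGroupRing R Λ G)

theorem t_algebraMap (r : R) : S.t (algebraMap R Λ r) = r := by
  rw [Algebra.algebraMap_eq_smul_one, map_smul, S.t_one, smul_eq_mul, mul_one]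

theorem induction_on {p : Λ → Prop} (x : Λ) (of : ∀ g, p (S.of g))
    (add : ∀ x y, p x → p y → p (x + y)) (smul : ∀ (r : R) x, p x → p (r • x)) : p x := by
  have hx : x ∈ Submodule.span R (Set.range S.of) := by rw [S.span]; trivial
  induction hx using Submodule.span_induction with
  | mem x h => obtain ⟨g, rfl⟩ := h; exact of g
  | zero => simpa using smul 0 _ (of 1)
  | add x y _ _ hx hy => exact add x y hx hy
  | smul r x _ hx => exact smul r x hx

/-- If one of `g * h`, `h * g` lies in the central subgroup `Z`, the two products coincide;
otherwise `t` kills both. -/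
theorem t_mul_comm (x y : Λ) : S.t (x * y) = S.t (y * x) := by
  induction x using S.induction_on with
  | add a b ha hb => rw [add_mul, mul_add, map_add, map_add, ha, hb]
  | smul r a ha => rw [smul_mul_assoc, mul_smul_comm, map_smul, map_smul, ha]
  | of g =>
    induction y using S.induction_on with
    | add a b ha hb => rw [add_mul, mul_add, map_add, map_add, ha, hb]
    | smul r a ha => rw [smul_mul_assoc, mul_smul_comm, map_smul, map_smul, ha]
    | of h =>
      rw [← map_mul, ← map_mul]
      by_cases hgh : g * h ∈ S.Z
      · have := Subgroup.mem_center_iff.mp (S.le_center hgh) h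
        have h2 : g * h = h * g := by
          apply mul_right_cancel (b := h)
          rw [← this, mul_assoc]
        rw [h2]
      · rw [S.t_of _ hgh, S.t_of]
        intro hhg
        apply hgh
        have := Subgroup.mem_center_iff.mp (S.le_center hhg) g
        have h2 : g * h = h * g := by
          apply mul_right_cancel (b := g)
          rw [mul_assoc, this]
        rwa [h2]

/-- The coset representatives and their inverses are dual with respect to `t`. For `x = g` only the
coset of `g` contributes, and there `g * q.out⁻¹` lies in `Z` and acts as a scalar. -/
theorem sum_t_mul_of (x : Λ) [Fintype (G ⧸ S.Z)] :
    x = ∑ q : G ⧸ S.Z, S.t (x * S.of (q.out)⁻¹) • S.of q.out := by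
  classical
  induction x using S.induction_on with
  | add a b ha hb =>
    simp only [add_mul, map_add, add_smul, Finset.sum_add_distrib]
    rw [← ha, ← hb]
  | smul r a ha =>
    simp only [smul_mul_assoc, map_smul, smul_assoc, ← Finset.smul_sum]
    rw [← ha]
  | of g =>
    rw [Finset.sum_eq_single (QuotientGroup.mk g)]
    · set q : G ⧸ S.Z := QuotientGroup.mk g
      have h1 : (q.out)⁻¹ * g ∈ S.Z := QuotientGroup.eq.mp q.out_eq
      have h2 : g * (q.out)⁻¹ = (q.out)⁻¹ * g := by
        have := Subgroup.mem_center_iff.mp (S.le_center h1) q.out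
        rw [mul_inv_cancel_left] at this
        rw [mul_inv_eq_iff_eq_mul]; exact this
      rw [← map_mul, h2]
      obtain ⟨r, hr⟩ := S.of_mem _ h1
      rw [hr, S.t_algebraMap]
      rw [Algebra.smul_def, ← hr, ← map_mul, ← h2, inv_mul_cancel_right]
    · intro q _ hq
      rw [← map_mul, S.t_of, zero_smul]
      intro hmem
      apply hq
      rw [← q.out_eq]
      refine QuotientGroup.eq.mpr ?_
      have := Subgroup.mem_center_iff.mp (S.le_center hmem) q.out⁻¹
      rw [show q.out⁻¹ * g = g * q.out⁻¹ by
        rw [← mul_assoc] at this; exact mul_right_cancel this]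
      exact hmem
    · simp

theorem finite (S : TwistedGroupRing R Λ G) : Module.Finite R Λ := by
  have := S.finiteIndex
  have : Fintype (G ⧸ S.Z) := Fintype.ofFinite _
  classical
  refine ⟨⟨Finset.univ.image fun q : G ⧸ S.Z => S.of q.out, ?_⟩⟩
  rw [eq_top_iff]
  intro x _
  rw [S.sum_t_mul_of x]
  refine Submodule.sum_mem _ fun q _ => Submodule.smul_mem _ _ (Submodule.subset_span ?_)
  simp

/-- The form `t` is perfect, so divisibility in `Λ` can be tested on its values. This reduces
maximality of an order to divisibility of values of `t`. -/
theorem exists_eq_smul {s : R} {y : Λ} (h : ∀ g, s ∣ S.t (y * S.of g)) : ∃ x, y = s • x := by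
  have := S.finiteIndex
  have : Fintype (G ⧸ S.Z) := Fintype.ofFinite _
  choose d hd using h
  refine ⟨∑ q : G ⧸ S.Z, d (q.out⁻¹) • S.of q.out, ?_⟩
  rw [S.sum_t_mul_of y, Finset.smul_sum]
  simp only [hd, smul_smul]

theorem eq_zero {y : Λ} (h : ∀ g, S.t (y * S.of g) = 0) : y = 0 := by
  obtain ⟨x, hx⟩ := S.exists_eq_smul (s := 0) (y := y) (fun g => by rw [h g])
  rw [hx, zero_smul]

theorem smul_eq_zero (S : TwistedGroupRing R Λ G) [IsDomain R] {r : R} (hr : r ≠ 0) {y : Λ} (h : r • y = 0) : y = 0 := by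
  refine S.eq_zero fun g => ?_
  have := congrArg (fun z => S.t (z * S.of g)) h
  simp only [smul_mul_assoc, map_smul, zero_mul, map_zero, smul_eq_mul] at this
  exact (mul_eq_zero.mp this).resolve_left hr

end TwistedGroupRing

namespace TwistedGroupRing

variable {R Λ G : Type*} [CommRing R] [Ring Λ] [Algebra R Λ] [Group G] (S : TwistedGroupRing R Λ G)

theorem t_mul_of_eq_zero {P : Subgroup G} (hZP : S.Z ≤ P) {x : Λ}
    (hx : x ∈ Submodule.span R (S.of '' P)) {g : G} (hg : g ∉ P) : S.t (x * S.of g) = 0 := by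
  induction hx using Submodule.span_induction with
  | mem x h =>
    obtain ⟨a, ha, rfl⟩ := h
    rw [← map_mul]
    exact S.t_of _ fun h => hg ((Subgroup.mul_mem_cancel_left P ha).mp (hZP h))
  | zero => simp
  | add x y _ _ hx hy => rw [add_mul, map_add, hx, hy, add_zero]
  | smul r x _ hx => rw [smul_mul_assoc, map_smul, hx, smul_zero]

/-- The sub-twisted-group-ring on a subgroup `P ⊇ Z`, presented as an injective algebra homomorphism from a
commutative ring. -/
structure CommSubring (D : Type*) [CommRing D] [Algebra R D] (P : Subgroup G) where
  ι : D →ₐ[R] Λ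
  inj : Function.Injective ι
  le : S.Z ≤ P
  mem_span : ∀ d, ι d ∈ Submodule.span R (S.of '' P)
  of_mem : ∀ g ∈ P, ∃ d, ι d = S.of g

variable {S} {D : Type*} [CommRing D] [Algebra R D] {P : Subgroup G}

namespace CommSubring

variable (C : S.CommSubring D P)

theorem finite_quotient (C : S.CommSubring D P) : Finite (G ⧸ P) := by
  have := S.finiteIndex
  have := Subgroup.finiteIndex_of_le C.le
  infer_instance

/-- `Λ` as a left module over the commutative subring. -/
abbrev module : Module D Λ := Module.compHom Λ C.ι.toRingHom

/-- Different cosets of `P` are orthogonal for `t`. This gives the linear independence behind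
`basis` and reads off the matrix entries in `dvd_sum_t`. -/
theorem t_sum [Fintype (G ⧸ P)] (d : G ⧸ P → D) (q : G ⧸ P) {g : G} (hg : g ∈ P) :
    S.t ((∑ q', C.ι (d q') * S.of q'.out⁻¹) * S.of (q.out * g)) = S.t (C.ι (d q) * S.of g) := by
  rw [Finset.sum_mul, map_sum, Finset.sum_eq_single q]
  · rw [mul_assoc, ← map_mul, inv_mul_cancel_left]
  · intro q' _ hq'
    rw [mul_assoc, ← map_mul]
    apply S.t_mul_of_eq_zero C.le (C.mem_span _)
    intro hmem
    apply hq'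
    rw [← mul_assoc, Subgroup.mul_mem_cancel_right P hg] at hmem
    rw [← q'.out_eq, ← q.out_eq]
    exact QuotientGroup.eq.mpr hmem
  · simp

theorem eq_zero_of_sum [Fintype (G ⧸ P)] (d : G ⧸ P → D)
    (h : ∑ q', C.ι (d q') * S.of q'.out⁻¹ = 0) (q : G ⧸ P) : d q = 0 := by
  apply C.inj
  rw [map_zero]
  refine S.eq_zero fun g => ?_
  by_cases hg : g ∈ P
  · rw [← C.t_sum d q hg, h, zero_mul, map_zero]
  · exact S.t_mul_of_eq_zero C.le (C.mem_span _) hg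

/-- Representatives of the cosets `P \ G` form a basis of `Λ`. -/
def basis [Fintype (G ⧸ P)] :
    letI := C.module
    Module.Basis (G ⧸ P) D Λ :=
  letI := C.module
  Module.Basis.mk (v := fun q : G ⧸ P => S.of q.out⁻¹)
    (Fintype.linearIndependent_iff.mpr fun d h q => C.eq_zero_of_sum d h q) <| by
    intro x _
    induction x using S.induction_on with
    | add a b ha hb => exact Submodule.add_mem _ (ha trivial) (hb trivial)
    | smul r a ha =>
      have : r • a = (algebraMap R D r) • a := by
        change r • a = C.ι (algebraMap R D r) * a
        rw [AlgHom.commutes, Algebra.smul_def]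
      rw [this]
      exact Submodule.smul_mem _ _ (ha trivial)
    | of g =>
      have h := QuotientGroup.eq.mp (QuotientGroup.out_eq' (QuotientGroup.mk (s := P) g⁻¹))
      obtain ⟨d, hd⟩ := C.of_mem _ (inv_mem h)
      have : S.of g = d • S.of (Quotient.out (QuotientGroup.mk (s := P) g⁻¹))⁻¹ := by
        change _ = C.ι d * _
        rw [hd, ← map_mul]
        congr 1
        simp
      rw [this]
      exact Submodule.smul_mem _ _ (Submodule.subset_span ⟨_, rfl⟩)

open Polynomial in
-- Since `n` commutes with `P`, the map `w ↦ n w y` is `D`-linear on the free `D`-module `Λ`. The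
-- diagonal entry at the coset `q` is sent by `t` to the summand at `q`, so the sum is `t` of the
-- trace.
theorem dvd_sum_t (C : S.CommSubring D P) [Fintype (G ⧸ P)] [IsDomain D] [IsIntegrallyClosed D] {n : G}
    (hn : ∀ g ∈ P, g * n = n * g) {y : Λ} {s : R} (hs : algebraMap R D s ≠ 0) {f : R[X]}
    (hf : f.Monic)
    (h : aeval (LinearMap.mulLeft R (S.of n) ∘ₗ LinearMap.mulRight R y : Module.End R Λ)
      (f.scaleRoots s) = 0) :
    s ∣ ∑ q : G ⧸ P, S.t (S.of (q.out * n * q.out⁻¹) * y) := by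
  classical
  let := C.module
  have smul_def (d : D) (x : Λ) : d • x = C.ι d * x := rfl
  have : IsScalarTower R D Λ := ⟨fun r d x => by
    rw [smul_def, smul_def, map_smul, smul_mul_assoc]⟩
  have : Module.Free D Λ := Module.Free.of_basis C.basis
  have : Module.Finite D Λ := Module.Finite.of_basis C.basis
  have hcomm (d : D) : S.of n * C.ι d = C.ι d * S.of n := by
    have := C.mem_span d
    generalize C.ι d = x at this
    induction this using Submodule.span_induction with
    | mem x hx =>
      obtain ⟨g, hg, rfl⟩ := hx
      rw [← map_mul, ← map_mul, hn g hg]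
    | zero => simp
    | add x y _ _ hx hy => rw [mul_add, add_mul, hx, hy]
    | smul r x _ hx => rw [mul_smul_comm, smul_mul_assoc, hx]
  let φ : Module.End D Λ :=
    { toFun := fun w => S.of n * (w * y)
      map_add' := fun a b => by rw [add_mul, mul_add]
      map_smul' := fun d w => by
        simp only [smul_def, RingHom.id_apply]
        rw [mul_assoc, ← mul_assoc, hcomm, mul_assoc] }
  have hpow (k : ℕ) (w : Λ) : (φ ^ k) w = ((LinearMap.mulLeft R (S.of n) ∘ₗ
      LinearMap.mulRight R y : Module.End R Λ) ^ k) w := by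
    induction k with
    | zero => rfl
    | succ k ih =>
      rw [pow_succ', pow_succ', Module.End.mul_apply, Module.End.mul_apply, ← ih]
      rfl
  have hφ : aeval φ ((f.map (algebraMap R D)).scaleRoots (algebraMap R D s)) = 0 := by
    have hf' : (f.map (algebraMap R D)).scaleRoots (algebraMap R D s) =
        (f.scaleRoots s).map (algebraMap R D) := by
      by_cases hR : Nontrivial D
      · rw [Polynomial.map_scaleRoots]
        rw [hf.leadingCoeff, map_one]
        exact one_ne_zero
      · have := not_nontrivial_iff_subsingleton.mp hR
        exact Subsingleton.elim _ _
    rw [hf', aeval_map_algebraMap]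
    ext w
    have := LinearMap.congr_fun h w
    rw [aeval_eq_sum_range, LinearMap.sum_apply] at this ⊢
    refine Eq.trans (Finset.sum_congr rfl fun i _ => ?_) this
    rw [LinearMap.smul_apply, LinearMap.smul_apply, hpow]
  obtain ⟨d, hd⟩ := dvd_trace_of_aeval_scaleRoots φ hs (hf.map (algebraMap R D)) hφ
  refine ⟨S.t (C.ι d), ?_⟩
  have h1 : S.t (C.ι (LinearMap.trace D Λ φ)) = s * S.t (C.ι d) := by
    rw [hd, map_mul, AlgHom.commutes, ← Algebra.smul_def, map_smul, smul_eq_mul]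
  rw [← h1, LinearMap.trace_eq_matrix_trace D C.basis φ, Matrix.trace, map_sum, map_sum]
  refine Finset.sum_congr rfl fun q _ => ?_
  have h2 : ∀ x, S.t (C.ι (C.basis.repr x q)) = S.t (x * S.of q.out) := by
    intro x
    have := C.t_sum (fun q => C.basis.repr x q) q P.one_mem
    rw [map_one, mul_one, mul_one] at this
    rw [← this]
    congr 2
    conv_rhs => rw [← C.basis.sum_repr x]
    refine Finset.sum_congr rfl fun q' _ => ?_
    rw [smul_def, basis, Module.Basis.mk_apply]
  rw [Matrix.diag_apply, LinearMap.toMatrix_apply, h2]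
  have h3 : φ (C.basis q) = S.of n * (S.of q.out⁻¹ * y) := by
    rw [basis, Module.Basis.mk_apply]; rfl
  rw [h3, S.t_mul_comm _ (S.of q.out)]
  simp only [map_mul, mul_assoc]

end CommSubring
end TwistedGroupRing

/-! ### Class sums and the maximality criterion -/

open MulAction in
-- Split the sum into orbits. A sum over `G ⧸ P` runs through the orbit of `x` as often as the index
-- of `P` in the stabilizer, and that index is a unit.
theorem dvd_sum_of_forall_orbit {G X R : Type*} [Group G] [Fintype X] [MulAction G X] [CommRing R]
    (F : X → R) (s : R)
    (h : ∀ x, (∀ g : G, F (g • x) = 0) ∨ ∃ P : Subgroup G, P ≤ stabilizer G x ∧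
      IsUnit ((P.relIndex (stabilizer G x) : ℕ) : R) ∧ ∃ _ : Fintype (G ⧸ P),
      s ∣ ∑ q : G ⧸ P, F (q.out • x)) : s ∣ ∑ x, F x := by
  classical
  have : Fintype (Quotient (orbitRel G X)) := Fintype.ofFinite _
  have hfin : ∀ x : X, Finite (G ⧸ stabilizer G x) := fun x =>
    Finite.of_injective _ (injective_ofQuotientStabilizer G x)
  have : ∀ x : X, Fintype (G ⧸ stabilizer G x) := fun x => Fintype.ofFinite _
  rw [← (selfEquivSigmaOrbitsQuotientStabilizer G X).symm.sum_comp F, Fintype.sum_sigma]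
  refine Finset.dvd_sum fun ω _ => ?_
  have key : ∀ x : X, s ∣ ∑ q : G ⧸ stabilizer G x, F (ofQuotientStabilizer G x q) := by
    intro x
    rcases h x with h0 | ⟨P, hP, hu, hfP, hs⟩
    · rw [Finset.sum_eq_zero]
      · exact dvd_zero s
      · intro q _
        induction q using QuotientGroup.induction_on with
        | H g => exact h0 g
    · have : Finite (stabilizer G x ⧸ P.subgroupOf (stabilizer G x)) :=
        Finite.of_injective _ ((Subgroup.quotientEquivProdOfLE hP).symm.injective.comp
          (Prod.mk_right_injective (QuotientGroup.mk 1)))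
      have : Fintype (stabilizer G x ⧸ P.subgroupOf (stabilizer G x)) := Fintype.ofFinite _
      have e : ∑ q : G ⧸ P, F (q.out • x) = ((P.relIndex (stabilizer G x) : ℕ) : R) *
          ∑ q : G ⧸ stabilizer G x, F (ofQuotientStabilizer G x q) := by
        have h1 : ∀ q : G ⧸ P, F (q.out • x) =
            F (ofQuotientStabilizer G x (Subgroup.quotientEquivProdOfLE hP q).1) := by
          intro q
          conv_rhs => rw [← q.out_eq]
          rfl
        rw [Finset.sum_congr rfl fun q _ => h1 q,
          (Subgroup.quotientEquivProdOfLE hP).sum_comp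
            (fun q => F (ofQuotientStabilizer G x q.1)), Fintype.sum_prod_type]
        simp only [Finset.sum_const, Finset.card_univ, Finset.mul_sum, nsmul_eq_mul]
        rw [Subgroup.relIndex, Subgroup.index, Nat.card_eq_fintype_card]
      rw [e] at hs
      exact (hu.dvd_mul_left).mp hs
  exact key ω.out

namespace TwistedGroupRing

variable {R Λ G : Type*} [CommRing R] [Ring Λ] [Algebra R Λ] [Group G] (S : TwistedGroupRing R Λ G)

/-- The condition on a normal subgroup `N` which makes `Λ (1 - e_N)` a maximal order. -/
structure IsCommutingCoprime (N : Subgroup G) : Prop where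
  isUnit : IsUnit ((Nat.card N : ℕ) : R)
  exists_commSubring : ∀ n ∈ N, n ≠ 1 → ∃ (P : Subgroup G) (D : Type) (_ : CommRing D)
    (_ : IsDomain D) (_ : IsIntegrallyClosed D) (_ : Algebra R D) (_ : S.CommSubring D P),
    Function.Injective (algebraMap R D) ∧ (∀ g ∈ P, g * n = n * g) ∧
    IsUnit ((P.relIndex (Subgroup.centralizer {n}) : ℕ) : R)

variable {S} {N : Subgroup G}

section idem

variable [Finite N] (hN : N.Normal) {e : Λ} (hu : IsUnit ((Nat.card N : ℕ) : R))
  (he : (Nat.card N : R) • e = ∑ᶠ n : N, S.of n)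

theorem smul_cancel {M : Type*} [AddCommGroup M] [Module R M] {r : R} (hr : IsUnit r) {a b : M}
    (h : r • a = r • b) : a = b := by
  obtain ⟨u, rfl⟩ := hr
  have := congrArg (fun x => (↑u⁻¹ : R) • x) h
  simpa only [smul_smul, Units.inv_mul, one_smul] using this

include hu he in
theorem of_mul_idem {n : G} (hn : n ∈ N) : S.of n * e = e := by
  have := Fintype.ofFinite N
  apply smul_cancel hu
  rw [← mul_smul_comm, he, finsum_eq_sum_of_fintype, Finset.mul_sum]
  exact Fintype.sum_equiv (Equiv.mulLeft ⟨n, hn⟩) _ _ fun x => by simp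

include hu he in
theorem idem_mul_idem : e * e = e := by
  have := Fintype.ofFinite N
  apply smul_cancel hu
  rw [← smul_mul_assoc, he, finsum_eq_sum_of_fintype, Finset.sum_mul,
    Finset.sum_congr rfl fun (n : N) _ => of_mul_idem hu he n.2]
  rw [Finset.sum_const, Finset.card_univ, ← Nat.cast_smul_eq_nsmul R, ← Nat.card_eq_fintype_card, he,
    finsum_eq_sum_of_fintype]

include hN hu he in
theorem idem_comm (x : Λ) : x * e = e * x := by
  have := Fintype.ofFinite N
  induction x using S.induction_on with
  | add a b ha hb => rw [add_mul, mul_add, ha, hb]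
  | smul r a ha => rw [smul_mul_assoc, mul_smul_comm, ha]
  | of g =>
    apply smul_cancel hu
    rw [← mul_smul_comm, ← smul_mul_assoc, he, finsum_eq_sum_of_fintype, Finset.mul_sum,
      Finset.sum_mul]
    refine Fintype.sum_equiv (MulAut.conjNormal g : MulAut N).toEquiv _ _ fun x => ?_
    rw [← map_mul, ← map_mul]
    congr 1
    simp [MulAut.conjNormal_apply]

end idem

end TwistedGroupRing

open Polynomial in
-- The coefficient of `X ^ i` in `f.scaleRoots s` carries the power of `s` missing from `φ ^ i`.
-- This turns an integral equation for `ψ` on an order into a scaled equation for `φ` on `Λ`.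
theorem aeval_scaleRoots_apply {R Λ A : Type*} [CommRing R] [AddCommGroup Λ] [Module R Λ]
    [AddCommGroup A] [Module R A] (j : Λ →ₗ[R] A) (φ : Module.End R Λ) (ψ : Module.End R A) (s : R)
    (h : ∀ x, j (φ x) = s • ψ (j x)) (f : R[X]) (x : Λ) :
    j (aeval φ (f.scaleRoots s) x) = s ^ f.natDegree • aeval ψ f (j x) := by
  have hpow (k : ℕ) : j ((φ ^ k) x) = s ^ k • (ψ ^ k) (j x) := by
    induction k with
    | zero => simp
    | succ k ih =>
      rw [pow_succ' φ, Module.End.mul_apply, h, ih, map_smul, pow_succ' ψ, Module.End.mul_apply,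
        smul_smul, pow_succ']
  rw [aeval_eq_sum_range, aeval_eq_sum_range, natDegree_scaleRoots, LinearMap.sum_apply, map_sum,
    LinearMap.sum_apply, Finset.smul_sum]
  refine Finset.sum_congr rfl fun i hi => ?_
  rw [LinearMap.smul_apply, LinearMap.smul_apply, map_smul, hpow, coeff_scaleRoots, smul_smul,
    smul_smul, mul_assoc, ← pow_add, mul_comm,
    Nat.sub_add_cancel (Nat.lt_succ_iff.mp (Finset.mem_range.mp hi))]

namespace TwistedGroupRing

variable {R Λ G : Type*} [CommRing R] [Ring Λ] [Algebra R Λ] [Group G]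
  {S : TwistedGroupRing R Λ G} {N : Subgroup G} [Finite N] {e : Λ}
  {A : Type*} [Ring A] [Algebra R A] (j : Λ →ₐ[R] A)

/-- `Λ (1 - e)` inside an overring of `Λ`. -/
def cut (j : Λ →ₐ[R] A) (e : A) : Submodule R A :=
  LinearMap.range (LinearMap.mulRight R e ∘ₗ j.toLinearMap)

theorem idem_comm_of_fractions (htf : ∀ r : R, r ≠ 0 → ∀ a : A, r • a = 0 → a = 0)
    (hA : ∀ a : A, ∃ r : R, r ≠ 0 ∧ ∃ x, r • a = j x) (hc : ∀ x, x * e = e * x) (a : A) :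
    a * j e = j e * a := by
  obtain ⟨r, hr, x, hx⟩ := hA a
  rw [← sub_eq_zero]
  apply htf r hr
  rw [smul_sub, ← smul_mul_assoc, ← mul_smul_comm, hx, ← map_mul, ← map_mul, hc, sub_self]

theorem isOrderIn_cut [IsDomain R] (S : TwistedGroupRing R Λ G)
    (htf : ∀ r : R, r ≠ 0 → ∀ a : A, r • a = 0 → a = 0)
    (hA : ∀ a : A, ∃ r : R, r ≠ 0 ∧ ∃ x, r • a = j x) (hc : ∀ x, x * e = e * x)
    (hee : e * e = e) : IsOrderIn R (1 - j e) (cut j (1 - j e)) := by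
  have hcA := idem_comm_of_fractions j htf hA hc
  have hidem : (1 - j e) * (1 - j e) = 1 - j e := by
    rw [mul_sub, sub_mul, sub_mul, one_mul, mul_one, one_mul, ← map_mul, hee, sub_self, sub_zero]
  have hcA' (a : A) : a * (1 - j e) = (1 - j e) * a := by
    rw [mul_sub, sub_mul, hcA, mul_one, one_mul]
  have := S.finite
  refine ⟨?_, ⟨1, ?_⟩, ?_, ?_, ?_⟩
  · rintro _ ⟨x, rfl⟩
    change j x * (1 - j e) * (1 - j e) = j x * (1 - j e)
    rw [mul_assoc, hidem]
  · change j 1 * (1 - j e) = 1 - j e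
    rw [map_one, one_mul]
  · rintro _ ⟨x, rfl⟩ _ ⟨y, rfl⟩
    refine ⟨x * y, ?_⟩
    change j (x * y) * (1 - j e) = j x * (1 - j e) * (j y * (1 - j e))
    rw [map_mul, mul_assoc, mul_assoc, ← mul_assoc (1 - j e), ← hcA', mul_assoc, hidem]
  · rw [cut, LinearMap.range_eq_map]
    exact (Module.Finite.fg_top (R := R) (M := Λ)).map _
  · intro a
    obtain ⟨r, hr, x, hx⟩ := hA a
    refine ⟨r, mem_nonZeroDivisors_of_ne_zero hr, x, ?_⟩
    change j x * (1 - j e) = _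
    rw [← hx, smul_mul_assoc]

open Polynomial in
-- From `z = z (1 - e)` follows `y e = 0`, so the sum of `t(n y)` over all `n ∈ N` vanishes and
-- `t(y)` is minus the part with `n ≠ 1`. That part is treated one conjugacy class at a time: `w ↦ n
-- w z` preserves the finitely generated module `M`, hence is integral there, and `dvd_sum_t`
-- applies.
theorem dvd_t_of_mem_order [IsDomain R] (hj : Function.Injective j)
    (hcop : S.IsCommutingCoprime N) (hN : N.Normal)
    (he : (Nat.card N : R) • e = ∑ᶠ n : N, S.of n)
    (htf : ∀ r : R, r ≠ 0 → ∀ a : A, r • a = 0 → a = 0)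
    (hA : ∀ a : A, ∃ r : R, r ≠ 0 ∧ ∃ x, r • a = j x)
    {M : Submodule R A} (hM : IsOrderIn R (1 - j e) M) (hcut : cut j (1 - j e) ≤ M)
    {z : A} (hz : z ∈ M) {y : Λ} {s : R} (hs : s ≠ 0) (hy : s • z = j y) : s ∣ S.t y := by
  classical
  have hfin := Fintype.ofFinite N
  have hc : ∀ x, x * e = e * x := idem_comm (S := S) hN hcop.isUnit he
  have hee : e * e = e := idem_mul_idem (S := S) hcop.isUnit he
  have hcE (a : A) : (1 - j e) * a = a * (1 - j e) := by
    rw [mul_sub, sub_mul, idem_comm_of_fractions j htf hA hc, mul_one, one_mul]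
  have hye : y * e = 0 := by
    apply hj
    rw [map_mul, ← hy, map_zero, ← hM.mul_idem z hz, smul_mul_assoc, mul_assoc, sub_mul, one_mul,
      ← map_mul, hee, sub_self, mul_zero, smul_zero]
  have hsum : s ∣ ∑ n : N, (if n = 1 then 0 else S.t (S.of n * y)) := by
    let _ : MulAction G N := MulAction.compHom N (MulAut.conjNormal : G →* MulAut N)
    have hact (g : G) (n : N) : ((g • n : N) : G) = g * n * g⁻¹ := MulAut.conjNormal_apply g n
    refine dvd_sum_of_forall_orbit (G := G) _ s fun n => ?_
    by_cases hn : n = 1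
    · left
      intro g
      rw [if_pos]
      rw [hn]
      ext
      rw [hact]
      simp
    right
    obtain ⟨P, D, _, _, _, _, CP, hinj, hPn, hunit⟩ :=
      hcop.exists_commSubring n n.2 (fun h => hn (Subtype.ext h))
    have hstab : MulAction.stabilizer G n = Subgroup.centralizer {(n : G)} := by
      ext g
      rw [MulAction.mem_stabilizer_iff, Subgroup.mem_centralizer_singleton_iff, Subtype.ext_iff,
        hact, mul_inv_eq_iff_eq_mul]
    have := CP.finite_quotient
    have instP := Fintype.ofFinite (G ⧸ P)
    refine ⟨P, ?_, ?_, instP, ?_⟩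
    · rw [hstab]
      intro g hg
      exact Subgroup.mem_centralizer_singleton_iff.mpr (hPn g hg)
    · rw [hstab]; exact hunit
    have hsumeq : ∀ q : G ⧸ P, (if q.out • n = 1 then 0 else S.t (S.of (q.out • n : N) * y)) =
        S.t (S.of (q.out * n * q.out⁻¹) * y) := by
      intro q
      rw [if_neg, hact]
      rw [Subtype.ext_iff, hact]
      intro h
      apply hn
      rw [Subgroup.coe_one, mul_inv_eq_one, mul_eq_left] at h
      exact Subtype.ext h
    rw [Finset.sum_congr rfl fun q _ => hsumeq q]
    let ψ : Module.End R A := LinearMap.mulLeft R (j (S.of n)) ∘ₗ LinearMap.mulRight R z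
    have hψ : ∀ w ∈ M, ψ w ∈ M := by
      intro w hw
      have h1 : ψ w = j (S.of n) * (1 - j e) * (w * z) := by
        change j (S.of n) * (w * z) = _
        have h2 : (1 - j e) * (w * z) = w * z := by
          rw [hcE, mul_assoc, hM.mul_idem z hz]
        rw [mul_assoc, h2]
      rw [h1]
      exact hM.mul_mem _ (hcut ⟨_, rfl⟩) _ (hM.mul_mem _ hw _ hz)
    have : Module.Finite R M := Module.Finite.iff_fg.mpr hM.fg
    have hint : Algebra.IsIntegral R (Module.End R M) := inferInstance
    obtain ⟨f, hf, hf0⟩ := hint.isIntegral (ψ.restrict hψ)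
    -- The extra factor `X` is needed because `j x` need not lie in `M`, whereas `ψ (j x)` does: `z`
    -- absorbs the factor `1 - e`.
    refine CP.dvd_sum_t hPn (f := X * f)
      (by rwa [Ne, map_eq_zero_iff _ hinj]) (monic_X.mul hf) ?_
    ext x
    apply hj
    have h3 : j.toLinearMap (aeval (LinearMap.mulLeft R (S.of n) ∘ₗ LinearMap.mulRight R y :
        Module.End R Λ) ((X * f).scaleRoots s) x) = _ :=
      aeval_scaleRoots_apply j.toLinearMap _ ψ s (fun x => by
        change j (S.of n * (x * y)) = s • (j (S.of n) * (j x * z))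
        rw [map_mul, map_mul, ← hy, mul_smul_comm, mul_smul_comm]) (X * f) x
    have h4 : ψ (j x) ∈ M := by
      have : ψ (j x) = j (S.of n * x) * (1 - j e) * z := by
        change j (S.of n) * (j x * z) = _
        rw [mul_assoc _ (1 - j e), hcE, hM.mul_idem z hz, map_mul, mul_assoc]
      rw [this]
      exact hM.mul_mem _ (hcut ⟨_, rfl⟩) _ hz
    have h5 := aeval_scaleRoots_apply M.subtype (ψ.restrict hψ) ψ 1
      (fun x => by rw [one_smul]; rfl) f ⟨_, h4⟩
    have h6 : f.scaleRoots 1 = f := by ext; simp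
    have h7 : aeval (ψ.restrict hψ) f = 0 := hf0
    rw [h6, h7, one_pow, one_smul] at h5
    change j.toLinearMap _ = j 0
    rw [h3, mul_comm X f, map_mul, aeval_X, Module.End.mul_apply]
    change s ^ _ • aeval ψ f (ψ (j x)) = _
    rw [map_zero]
    have h8 : aeval ψ f (ψ (j x)) = 0 := h5.symm.trans (map_zero _)
    rw [h8, smul_zero]
  have h2 : ∑ n : N, (if n = 1 then 0 else S.t (S.of n * y)) = - S.t y := by
    have h3 : ∑ n : N, S.t (S.of n * y) = 0 := by
      rw [← map_sum, ← Finset.sum_mul, ← finsum_eq_sum_of_fintype, ← he, smul_mul_assoc, ← hc, hye,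
        smul_zero, map_zero]
    rw [Finset.sum_ite, Finset.sum_const_zero, zero_add]
    rw [← Finset.sum_filter_add_sum_filter_not _ (fun n => n = 1)] at h3
    rw [Finset.filter_eq'] at h3
    simp only [Finset.mem_univ, if_true, Finset.sum_singleton, Subgroup.coe_one, map_one,
      one_mul] at h3
    exact (neg_eq_of_add_eq_zero_right h3).symm
  rw [h2] at hsum
  exact (dvd_neg).mp hsum

/-- If `N` is a finite normal subgroup with the coprimality property `IsCommutingCoprime`, then
`Λ (1 - e_N)` is a maximal order. -/
theorem isMaximalOrderIn_cut [IsDomain R] (hj : Function.Injective j)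
    (hcop : S.IsCommutingCoprime N) (hN : N.Normal)
    (he : (Nat.card N : R) • e = ∑ᶠ n : N, S.of n)
    (htf : ∀ r : R, r ≠ 0 → ∀ a : A, r • a = 0 → a = 0)
    (hA : ∀ a : A, ∃ r : R, r ≠ 0 ∧ ∃ x, r • a = j x) :
    IsMaximalOrderIn R (1 - j e) (cut j (1 - j e)) := by
  have hc : ∀ x, x * e = e * x := idem_comm (S := S) hN hcop.isUnit he
  have hee : e * e = e := idem_mul_idem (S := S) hcop.isUnit he
  refine ⟨isOrderIn_cut j S htf hA hc hee, fun M hM hle => le_antisymm ?_ hle⟩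
  intro z hz
  obtain ⟨s, hs, y, hy⟩ := hA z
  -- The order `M` is stable under right multiplication by `j (S.of g)`, because `z` absorbs `1 -
  -- e`. Hence the divisibility of `t(y)` also holds for `y * S.of g`.
  obtain ⟨x, rfl⟩ := S.exists_eq_smul (s := s) (y := y) fun g => by
    have hzg : z * j (S.of g) ∈ M := by
      have : z * j (S.of g) = z * (j (S.of g) * (1 - j e)) := by
        have h1 := hM.mul_idem z hz
        have h2 := idem_comm_of_fractions j htf hA hc (j (S.of g))
        rw [mul_sub, mul_one, h2, mul_sub, ← mul_assoc z (j e)]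
        rw [mul_sub, mul_one, sub_eq_self] at h1
        rw [h1, zero_mul, sub_zero]
      rw [this]
      exact hM.mul_mem _ hz _ (hle ⟨_, rfl⟩)
    refine dvd_t_of_mem_order j hj hcop hN he htf hA hM hle hzg hs ?_
    rw [map_mul, ← hy, smul_mul_assoc]
  have h3 : z = j x := by
    rw [← sub_eq_zero]
    apply htf s hs
    rw [smul_sub, hy, map_smul, sub_self]
  refine ⟨x, ?_⟩
  change j x * (1 - j e) = z
  rw [← h3, hM.mul_idem z hz]

end TwistedGroupRing

/-! ### The criterion for group rings of finite groups: sufficiency -/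

/-- No element of order `p` commutes with a nontrivial element of `N`. -/
def NoCommuting (p : ℕ) {G : Type*} [Group G] (N : Subgroup G) : Prop :=
  ∀ g : G, orderOf g = p → ∀ n ∈ N, g * n = n * g → n = 1

section

variable (p : ℕ) [Fact p.Prime]

theorem isUnit_natCast_padicInt {n : ℕ} (h : ¬ p ∣ n) : IsUnit (n : ℤ_[p]) := by
  rw [PadicInt.isUnit_iff, PadicInt.norm_natCast_eq_one_iff]
  exact (Nat.Prime.coprime_iff_not_dvd Fact.out).mpr h

theorem not_dvd_of_isUnit_natCast_padicInt {n : ℕ} (h : IsUnit (n : ℤ_[p])) : ¬ p ∣ n := by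
  rw [PadicInt.isUnit_iff, PadicInt.norm_natCast_eq_one_iff] at h
  exact (Nat.Prime.coprime_iff_not_dvd Fact.out).mp h

/-- The coefficient functional at the identity. -/
def coeffOne (R G : Type*) [CommRing R] [Group G] : MonoidAlgebra R G →ₗ[R] R where
  toFun x := x.coeff 1
  map_add' _ _ := rfl
  map_smul' _ _ := rfl

/-- The group ring of a finite group as a twisted group ring. -/
def finiteTwistedGroupRing (R G : Type*) [CommRing R] [Group G] [Finite G] :
    TwistedGroupRing R (MonoidAlgebra R G) G where
  of := MonoidAlgebra.of R G
  Z := ⊥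
  le_center := bot_le
  finiteIndex := inferInstance
  t := coeffOne R G
  t_one := MonoidAlgebra.coeff_one_one
  t_of g hg := by
    change (MonoidAlgebra.single g (1 : R)).coeff 1 = 0
    rw [MonoidAlgebra.coeff_single, Finsupp.single_eq_of_ne]
    exact fun h => hg (Subgroup.mem_bot.mpr h.symm)
  of_mem g hg := ⟨1, by rw [Subgroup.mem_bot.mp hg, map_one, map_one]⟩
  span := by
    rw [eq_top_iff]
    rintro x -
    induction x using MonoidAlgebra.induction_linear with
    | zero => exact Submodule.zero_mem _
    | add x y hx hy => exact Submodule.add_mem _ hx hy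
    | single g r =>
      rw [← MonoidAlgebra.smul_of]
      exact Submodule.smul_mem _ _ (Submodule.subset_span ⟨g, rfl⟩)

/-- With `P` trivial the relevant index is the order of the centralizer of `n`. If `p` divided it,
Cauchy's theorem would give an element of order `p` commuting with `n`. -/
theorem finite_isCommutingCoprime {G : Type*} [Group G] [Finite G] {N : Subgroup G}
    (hp : ¬ p ∣ Nat.card N) (hN : NoCommuting p N) :
    (finiteTwistedGroupRing ℤ_[p] G).IsCommutingCoprime N := by
  refine ⟨isUnit_natCast_padicInt p hp, fun n hn hn1 => ⟨⊥, ℤ_[p], inferInstance, inferInstance,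
    inferInstance, inferInstance, ⟨Algebra.ofId _ _, ?_, le_rfl, ?_, ?_⟩, ?_, ?_, ?_⟩⟩
  · intro a b hab
    have := congrArg (coeffOne ℤ_[p] G) hab
    exact ((finiteTwistedGroupRing ℤ_[p] G).t_algebraMap a).symm.trans
      (this.trans ((finiteTwistedGroupRing ℤ_[p] G).t_algebraMap b))
  · intro d
    rw [Algebra.ofId_apply, Algebra.algebraMap_eq_smul_one]
    exact Submodule.smul_mem _ _ (Submodule.subset_span ⟨1, one_mem _, map_one _⟩)
  · intro g hg
    exact ⟨1, by rw [Subgroup.mem_bot.mp hg, map_one, map_one]⟩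
  · exact Function.injective_id
  · intro g hg
    rw [Subgroup.mem_bot.mp hg, one_mul, mul_one]
  · rw [Subgroup.relIndex_bot_left]
    apply isUnit_natCast_padicInt
    intro hdvd
    obtain ⟨g, hg⟩ := exists_prime_orderOf_dvd_card' p hdvd
    refine hn1 (hN g ?_ n hn ?_)
    · rw [Subgroup.orderOf_coe, hg]
    · exact Subgroup.mem_centralizer_singleton_iff.mp g.2

theorem groupRingIncl_apply {G : Type*} [Group G] (x : MonoidAlgebra ℤ_[p] G) (g : G) :
    (groupRingIncl p G x).coeff g = (x.coeff g : ℚ_[p]) := rfl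

theorem groupRingIncl_injective (G : Type*) [Group G] : Function.Injective (groupRingIncl p G) := by
  intro x y h
  ext g
  have := congrArg (fun z => z.coeff g) h
  exact Subtype.ext this

theorem groupRingIncl_single {G : Type*} [Group G] (g : G) (r : ℤ_[p]) :
    groupRingIncl p G (MonoidAlgebra.single g r) = MonoidAlgebra.single g (r : ℚ_[p]) := by
  exact MonoidAlgebra.map_single _ _ _

theorem groupRingIncl_of {G : Type*} [Group G] (g : G) :
    groupRingIncl p G (MonoidAlgebra.of _ _ g) = MonoidAlgebra.of _ _ g := by
  rw [MonoidAlgebra.of_apply, groupRingIncl_single]; simp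

theorem exists_smul_mem_groupRing {G : Type*} [Group G] (a : MonoidAlgebra ℚ_[p] G) :
    ∃ r : ℤ_[p], r ≠ 0 ∧ ∃ x, r • a = groupRingIncl p G x := by
  induction a using MonoidAlgebra.induction_linear with
  | zero => exact ⟨1, one_ne_zero, 0, by simp⟩
  | add a b ha hb =>
    obtain ⟨r, hr, x, hx⟩ := ha
    obtain ⟨s, hs, y, hy⟩ := hb
    refine ⟨r * s, mul_ne_zero hr hs, s • x + r • y, ?_⟩
    rw [smul_add, map_add, map_smul, map_smul, ← hx, ← hy, smul_smul, smul_smul, mul_comm s r]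
  | single g q =>
    obtain ⟨⟨a, b⟩, hab⟩ := IsLocalization.surj (nonZeroDivisors ℤ_[p]) q
    refine ⟨b, nonZeroDivisors.ne_zero b.2, MonoidAlgebra.single g a, ?_⟩
    rw [groupRingIncl_single, MonoidAlgebra.smul_single, Algebra.smul_def, mul_comm]
    exact congrArg _ hab

theorem groupRing_smul_eq_zero {G : Type*} [Group G] (r : ℤ_[p]) (hr : r ≠ 0)
    (a : MonoidAlgebra ℚ_[p] G) (h : r • a = 0) : a = 0 := by
  ext g
  have := congrArg (fun z => z.coeff g) h
  rw [MonoidAlgebra.coeff_smul, Finsupp.smul_apply, Algebra.smul_def] at this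
  refine (mul_eq_zero.mp this).resolve_left ?_
  exact fun h => hr (Subtype.ext h)

theorem isHybridGroupRing_of_noCommuting {G : Type*} [Group G] [Finite G] {N : Subgroup G}
    (hnormal : N.Normal) (hp : ¬ p ∣ Nat.card N) (hN : NoCommuting p N) : IsHybridGroupRing p N := by
  obtain ⟨u, hu⟩ := isUnit_natCast_padicInt p hp
  let e : MonoidAlgebra ℤ_[p] G := (↑u⁻¹ : ℤ_[p]) • ∑ᶠ n : N, MonoidAlgebra.of ℤ_[p] G n
  have he : (Nat.card N : ℤ_[p]) • e = ∑ᶠ n : N, MonoidAlgebra.of ℤ_[p] G n := by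
    rw [smul_smul, ← hu, Units.mul_inv, one_smul]
  have hje : groupRingIncl p G e = groupRingIdem p N := by
    have := Fintype.ofFinite N
    rw [groupRingIdem, map_smul, finsum_eq_sum_of_fintype, finsum_eq_sum_of_fintype, map_sum]
    simp only [groupRingIncl_of]
    rw [← algebraMap_smul ℚ_[p] (↑u⁻¹ : ℤ_[p])]
    congr 1
    have h1 : algebraMap ℤ_[p] ℚ_[p] u * algebraMap ℤ_[p] ℚ_[p] (↑u⁻¹ : ℤ_[p]) = 1 := by
      rw [← map_mul, Units.mul_inv, map_one]
    rw [hu, map_natCast] at h1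
    exact (inv_eq_of_mul_eq_one_right h1).symm
  refine ⟨inferInstance, hnormal, ⟨e, hje⟩, ?_⟩
  have := TwistedGroupRing.isMaximalOrderIn_cut (groupRingIncl p G) (groupRingIncl_injective p G)
    (finite_isCommutingCoprime p hp hN) hnormal he (groupRing_smul_eq_zero p)
    (exists_smul_mem_groupRing p)
  rw [hje] at this
  exact this

end

/-! ### Symmetric orders whose component at a central idempotent is maximal -/

/-- A `p`-torsion free ring `S` with a central idempotent `e` such that `S (1 - e)` is a maximal
order and such that proper two-sided ideals of `S / p` have nonzero left annihilators. -/
structure SymmetricMaximal (S : Type*) [Ring S] (p : ℕ) (e : S) : Prop where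
  cancel : ∀ x : S, (p : S) * x = 0 → x = 0
  idem : e * e = e
  central : ∀ x, x * e = e * x
  maximal : ∀ O : Ideal S, O.IsTwoSided → (p : S) ∈ O →
    (∀ x ∈ O, ∀ y ∈ O, ∃ z ∈ O, x * y = p * z) → ∀ x ∈ O, (p : S) ∣ x * (1 - e)
  annihilator : ∀ T : Ideal S, T.IsTwoSided → (p : S) ∈ T → (1 : S) ∉ T →
    ∃ b, ¬ (p : S) ∣ b ∧ ∀ t ∈ T, (p : S) ∣ b * t

namespace SymmetricMaximal

variable {S : Type*} [Ring S] {p : ℕ} {e : S} (h : SymmetricMaximal S p e)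

theorem dvd_mul_right_of_dvd {x : S} (hx : (p : S) ∣ x) (y : S) : (p : S) ∣ x * y := by
  obtain ⟨z, rfl⟩ := hx
  exact ⟨z * y, mul_assoc _ _ _⟩

theorem dvd_mul_left_of_dvd {x : S} (hx : (p : S) ∣ x) (y : S) : (p : S) ∣ y * x := by
  obtain ⟨z, rfl⟩ := hx
  exact ⟨y * z, by rw [← mul_assoc, ← (Nat.cast_commute p y).eq, mul_assoc]⟩

variable (p) in
/-- The right annihilator of `J` modulo `p`. -/
def rightAnn (J : Ideal S) [J.IsTwoSided] : Ideal S where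
  carrier := {x | ∀ y ∈ J, (p : S) ∣ y * x}
  add_mem' ha hb y hy := by rw [mul_add]; exact dvd_add (ha y hy) (hb y hy)
  zero_mem' y _ := by rw [mul_zero]; exact dvd_zero _
  smul_mem' c x hx y hy := by
    rw [smul_eq_mul, ← mul_assoc]; exact hx _ (J.mul_mem_right c hy)

variable (p) in
/-- The left annihilator of `J` modulo `p`. -/
def leftAnn (J : Ideal S) : Ideal S where
  carrier := {x | ∀ y ∈ J, (p : S) ∣ x * y}
  add_mem' ha hb y hy := by rw [add_mul]; exact dvd_add (ha y hy) (hb y hy)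
  zero_mem' y _ := by rw [zero_mul]; exact dvd_zero _
  smul_mem' c x hx y hy := by
    rw [smul_eq_mul, mul_assoc]; exact dvd_mul_left_of_dvd (hx _ hy) c

instance (J : Ideal S) : (leftAnn p J).IsTwoSided :=
  ⟨fun b ha y hy => by rw [mul_assoc]; exact ha _ (J.mul_mem_left b hy)⟩

include h in
/-- If `W` is a two-sided ideal with `W * W ⊆ p W` and `W e ⊆ p S`, then `W ⊆ p S`. -/
theorem dvd_of_mul_self (W : Ideal S) [W.IsTwoSided]
    (hW : ∀ x ∈ W, ∀ y ∈ W, ∃ z ∈ W, x * y = p * z) (hWe : ∀ x ∈ W, (p : S) ∣ x * e) {x : S}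
    (hx : x ∈ W) : (p : S) ∣ x := by
  -- `O = W + pS`. Dividing `O` by `p` gives a ring containing `S`, so maximality bounds its
  -- component at `1 - e`.
  let O : Ideal S :=
    { carrier := {y | ∃ w ∈ W, (p : S) ∣ y - w}
      add_mem' := by
        rintro a b ⟨w, hw, h1⟩ ⟨w', hw', h2⟩
        exact ⟨w + w', W.add_mem hw hw', by rw [add_sub_add_comm]; exact dvd_add h1 h2⟩
      zero_mem' := ⟨0, W.zero_mem, by simp⟩
      smul_mem' := by
        rintro c a ⟨w, hw, h1⟩
        exact ⟨c * w, W.mul_mem_left c hw, by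
          rw [smul_eq_mul, ← mul_sub]; exact dvd_mul_left_of_dvd h1 c⟩ }
  have hO : O.IsTwoSided := ⟨by
    rintro a b ⟨w, hw, h1⟩
    exact ⟨w * b, W.mul_mem_right b hw, by rw [← sub_mul]; exact dvd_mul_right_of_dvd h1 b⟩⟩
  have h1 : (p : S) ∣ x * (1 - e) := by
    refine h.maximal O hO ⟨0, W.zero_mem, by simp⟩ ?_ x ⟨x, hx, by simp⟩
    rintro a ⟨w, hw, c, hc⟩ b ⟨w', hw', d, hd⟩
    obtain ⟨z, hz, hwz⟩ := hW w hw w' hw'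
    rw [sub_eq_iff_eq_add] at hc hd
    refine ⟨z + w * d + c * w' + p * (c * d), ⟨z + w * d + c * w', ?_, by simp⟩, ?_⟩
    · exact W.add_mem (W.add_mem hz (W.mul_mem_right d hw)) (W.mul_mem_left c hw')
    · have hcomm : w * (p * d) = p * (w * d) := by
        rw [← mul_assoc, ← (Nat.cast_commute p w).eq, mul_assoc]
      have hcomm' : c * (p * d) = p * (c * d) := by
        rw [← mul_assoc, ← (Nat.cast_commute p c).eq, mul_assoc]
      rw [hc, hd, add_mul, mul_add, mul_add, hwz, hcomm, mul_assoc, mul_assoc, hcomm']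
      simp only [mul_add]
      abel
  have h2 := dvd_add h1 (hWe x hx)
  rwa [mul_sub, mul_one, sub_add_cancel] at h2

section

variable {J : Ideal S} [J.IsTwoSided] (heJ : e ∈ J)

include h heJ

/-- The ideal `J * leftAnn p J` squares into `p` times itself, because `leftAnn p J * J` is
divisible by `p`, and `e ∈ J` makes its `e`-component divisible by `p`. So `dvd_of_mul_self`
applies. With the mirror statement, the left and right annihilators of `J` modulo `p` agree. -/
theorem leftAnn_le_rightAnn : leftAnn p J ≤ rightAnn p J := by
  intro v hv y hy
  refine h.dvd_of_mul_self (J * leftAnn p J) ?_ ?_ (Ideal.mul_mem_mul hy hv)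
  · intro a ha b hb
    induction hb using Submodule.mul_induction_on' with
    | mem_mul_mem y' hy' v' hv' =>
      induction ha using Submodule.mul_induction_on' with
      | mem_mul_mem y hy v hv =>
        obtain ⟨c, hc⟩ := hv y' hy'
        refine ⟨y * (c * v'), Ideal.mul_mem_mul hy (Ideal.mul_mem_left _ c hv'), ?_⟩
        rw [mul_assoc, ← mul_assoc v, hc, mul_assoc, ← mul_assoc, ← (Nat.cast_commute p y).eq,
          mul_assoc]
      | add a _ a' _ h1 h2 =>
        obtain ⟨z, hz, e1⟩ := h1
        obtain ⟨z', hz', e2⟩ := h2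
        exact ⟨z + z', Ideal.add_mem _ hz hz', by rw [add_mul, e1, e2, mul_add]⟩
    | add b _ b' _ h1 h2 =>
      obtain ⟨z, hz, e1⟩ := h1
      obtain ⟨z', hz', e2⟩ := h2
      exact ⟨z + z', Ideal.add_mem _ hz hz', by rw [mul_add, e1, e2, mul_add]⟩
  · intro a ha
    induction ha using Submodule.mul_induction_on' with
    | mem_mul_mem y hy v hv =>
      rw [mul_assoc]
      exact dvd_mul_left_of_dvd (hv e heJ) y
    | add a _ b _ h1 h2 => rw [add_mul]; exact dvd_add h1 h2

theorem rightAnn_le_leftAnn : rightAnn p J ≤ leftAnn p J := by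
  intro v hv y hy
  refine h.dvd_of_mul_self (rightAnn p J * J) ?_ ?_ (Ideal.mul_mem_mul hv hy)
  · intro a ha b hb
    induction hb using Submodule.mul_induction_on' with
    | mem_mul_mem v' hv' y' hy' =>
      induction ha using Submodule.mul_induction_on' with
      | mem_mul_mem v hv y hy =>
        obtain ⟨c, hc⟩ := hv' y hy
        refine ⟨v * (c * y'), Ideal.mul_mem_mul hv (Ideal.mul_mem_left _ c hy'), ?_⟩
        rw [mul_assoc, ← mul_assoc y, hc, mul_assoc, ← mul_assoc, ← (Nat.cast_commute p v).eq,
          mul_assoc]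
      | add a _ a' _ h1 h2 =>
        obtain ⟨z, hz, e1⟩ := h1
        obtain ⟨z', hz', e2⟩ := h2
        exact ⟨z + z', Ideal.add_mem _ hz hz', by rw [add_mul, e1, e2, mul_add]⟩
    | add b _ b' _ h1 h2 =>
      obtain ⟨z, hz, e1⟩ := h1
      obtain ⟨z', hz', e2⟩ := h2
      exact ⟨z + z', Ideal.add_mem _ hz hz', by rw [mul_add, e1, e2, mul_add]⟩
  · intro a ha
    induction ha using Submodule.mul_induction_on' with
    | mem_mul_mem v hv y hy =>
      rw [h.central, ← mul_assoc]
      exact dvd_mul_right_of_dvd (hv e heJ) y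
    | add a _ b _ h1 h2 => rw [add_mul]; exact dvd_add h1 h2

/-- With `V = rightAnn p J`, the module `V / p` is the candidate inverse of `J`, and the claim is
that `(V / p) J` contains `1`. Otherwise `T`, the set of `x` with `p x ∈ V J`, is a proper ideal
containing `p` and `e`, so some `b` not divisible by `p` kills `T` modulo `p`. Then `b / p` maps `V`
into `V`, and maximality forces `p ∣ b (1 - e)`; also `p ∣ b e` since `e ∈ T`, a contradiction. -/
theorem natCast_mem_rightAnn_mul (hpJ : (p : S) ∈ J) : (p : S) ∈ rightAnn p J * J := by
  set V := rightAnn p J with hV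
  have hpV : (p : S) ∈ V := fun y _ => ⟨y, ((Nat.cast_commute p y).eq).symm⟩
  by_contra hcon
  let T : Ideal S :=
    { carrier := {x | (p : S) * x ∈ V * J}
      add_mem' := fun {a b} ha hb => by
        change (p : S) * (a + b) ∈ V * J
        rw [mul_add]; exact Ideal.add_mem _ ha hb
      zero_mem' := by change (p : S) * 0 ∈ V * J; rw [mul_zero]; exact Ideal.zero_mem _
      smul_mem' := fun c x hx => by
        change (p : S) * (c * x) ∈ V * J
        rw [← mul_assoc, (Nat.cast_commute p c).eq, mul_assoc]
        exact Ideal.mul_mem_left _ c hx }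
  have hT : T.IsTwoSided := ⟨fun {a} b ha => by
    change (p : S) * (a * b) ∈ V * J
    rw [← mul_assoc]; exact Ideal.mul_mem_right b _ ha⟩
  have hpT : (p : S) ∈ T := Ideal.mul_mem_mul hpV hpJ
  have heT : e ∈ T := Ideal.mul_mem_mul hpV heJ
  obtain ⟨b, hb, hbT⟩ := h.annihilator T hT hpT (fun h1 => hcon (by
    have h1 : (p : S) * 1 ∈ V * J := h1
    rwa [mul_one] at h1))
  have hcancel {x y : S} (hxy : (p : S) * x = p * y) : x = y := by
    rw [← sub_eq_zero]
    apply h.cancel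
    rw [mul_sub, hxy, sub_self]
  -- For `y ∈ J` one has `v y = p x` with `x ∈ T`, so `b v y` is divisible by `p ^ 2`. The choice `y
  -- = p` gives `b v = p d`, and the other `y` show that `d ∈ V`.
  have hbV : ∀ v ∈ V, ∃ c ∈ V, b * v = p * c := by
    intro v hv
    have key : ∀ y ∈ J, ∃ d, b * v * y = p * (p * d) := by
      intro y hy
      obtain ⟨x, hx⟩ := h.rightAnn_le_leftAnn heJ hv y hy
      have hxT : x ∈ T := by
        change (p : S) * x ∈ V * J
        rw [← hx]; exact Ideal.mul_mem_mul hv hy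
      obtain ⟨d, hd⟩ := hbT x hxT
      refine ⟨d, ?_⟩
      rw [mul_assoc, hx, ← mul_assoc, ← (Nat.cast_commute p b).eq, mul_assoc, hd]
    obtain ⟨d, hd⟩ := key p hpJ
    rw [← (Nat.cast_commute p (b * v)).eq] at hd
    have hbv := hcancel hd
    refine ⟨d, h.leftAnn_le_rightAnn heJ fun y hy => ?_, hbv⟩
    obtain ⟨d', hd'⟩ := key y hy
    refine ⟨d', hcancel ?_⟩
    rw [← hd', hbv, mul_assoc]
  -- `O / p` is the left order of `V`: closed under products, since `p ∈ V` forces `O ⊆ V`.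
  let O : Ideal S :=
    { carrier := {x | ∀ v ∈ V, ∃ c ∈ V, x * v = p * c}
      add_mem' := fun {x y} hx hy v hv => by
        obtain ⟨c, hc, e1⟩ := hx v hv
        obtain ⟨d, hd, e2⟩ := hy v hv
        exact ⟨c + d, V.add_mem hc hd, by rw [add_mul, e1, e2, mul_add]⟩
      zero_mem' := fun v _ => ⟨0, V.zero_mem, by simp⟩
      smul_mem' := fun s x hx v hv => by
        obtain ⟨c, hc, e1⟩ := hx v hv
        refine ⟨s * c, V.mul_mem_left s hc, ?_⟩
        rw [smul_eq_mul, mul_assoc, e1, ← mul_assoc, ← (Nat.cast_commute p s).eq, mul_assoc] }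
  have hO : O.IsTwoSided := ⟨fun {x} s hx v hv => by
    rw [mul_assoc]; exact hx _ (V.mul_mem_left s hv)⟩
  have h1 : (p : S) ∣ b * (1 - e) := by
    refine h.maximal O hO (fun v hv => ⟨v, hv, rfl⟩) ?_ b hbV
    intro x hx y hy
    obtain ⟨c, hc, e1⟩ := hy p hpV
    rw [← (Nat.cast_commute p y).eq] at e1
    obtain rfl := hcancel e1
    obtain ⟨z, hz, e2⟩ := hx y hc
    refine ⟨z, fun v hv => ?_, e2⟩
    obtain ⟨c, hc, e3⟩ := hy v hv
    obtain ⟨d, hd, e4⟩ := hx c hc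
    refine ⟨d, hd, hcancel ?_⟩
    rw [← e4, ← mul_assoc, ← e2, mul_assoc, e3, ← mul_assoc, ← (Nat.cast_commute p x).eq,
      mul_assoc]
  have h2 := dvd_add h1 (hbT e heT)
  rw [mul_sub, mul_one, sub_add_cancel] at h2
  exact hb h2

/-- A dual basis argument: `v ∈ rightAnn p J` defines the functional `y ↦ y v / p` on `J`, so for
`z` in `rightAnn p J * J` the map `y ↦ y z / p` factors through a finite free module. For `z = p`
this map is the identity. -/
theorem projective_of_natCast_mem (hpJ : (p : S) ∈ J) : Module.Projective S J := by
  have hcancel {x y : S} (hxy : (p : S) * x = p * y) : x = y := by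
    rw [← sub_eq_zero]
    apply h.cancel
    rw [mul_sub, hxy, sub_self]
  have key : ∀ z ∈ rightAnn p J * J, ∃ (ι : Type) (_ : Finite ι) (i : J →ₗ[S] (ι → S))
      (s : (ι → S) →ₗ[S] J), ∀ y : J, (p : S) * (s (i y) : S) = y * z := by
    intro z hz
    induction hz using Submodule.mul_induction_on' with
    | mem_mul_mem v hv x hx =>
      choose d hd using fun y : J => hv y y.2
      let i : J →ₗ[S] S :=
        { toFun := d
          map_add' := fun a b => hcancel (by
            rw [← hd, mul_add, ← hd, ← hd, Submodule.coe_add, add_mul])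
          map_smul' := fun c a => hcancel (by
            rw [← hd, RingHom.id_apply, smul_eq_mul, Submodule.coe_smul, smul_eq_mul, ← mul_assoc,
              (Nat.cast_commute p c).eq, mul_assoc c (p : S), ← hd, mul_assoc]) }
      refine ⟨Unit, inferInstance, LinearMap.pi fun _ => i,
        (LinearMap.toSpanSingleton S J ⟨x, hx⟩) ∘ₗ LinearMap.proj (), fun y => ?_⟩
      change (p : S) * (d y * x) = y * (v * x)
      rw [← mul_assoc, ← hd, mul_assoc]
    | add z _ z' _ h1 h2 =>
      obtain ⟨ι, _, i, s, e1⟩ := h1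
      obtain ⟨ι', _, i', s', e2⟩ := h2
      let E := LinearEquiv.sumArrowLequivProdArrow ι ι' S S
      refine ⟨ι ⊕ ι', inferInstance, E.symm.toLinearMap ∘ₗ i.prod i', s.coprod s' ∘ₗ E.toLinearMap,
        fun y => ?_⟩
      rw [mul_add, ← e1, ← e2]
      simp [mul_add]
  obtain ⟨ι, _, i, s, e1⟩ := key _ (h.natCast_mem_rightAnn_mul heJ hpJ)
  refine Module.Projective.of_split i s ?_
  ext y
  apply hcancel
  rw [LinearMap.comp_apply, e1, LinearMap.id_apply, (Nat.cast_commute p (y : S)).eq]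

end

end SymmetricMaximal

/-! ### Projectivity of left ideals by extensions and retracts -/

theorem projective_of_surjective_of_ker {S M Q : Type*} [Ring S] [AddCommGroup M] [Module S M]
    [AddCommGroup Q] [Module S Q] [Module.Projective S Q] (f : M →ₗ[S] Q)
    (hf : Function.Surjective f) [Module.Projective S (LinearMap.ker f)] :
    Module.Projective S M := by
  obtain ⟨σ, hσ⟩ := Module.projective_lifting_property f LinearMap.id hf
  have hσ' : ∀ y, f (σ y) = y := fun y => LinearMap.congr_fun hσ y
  refine Module.Projective.of_split (M := LinearMap.ker f × Q)
    (LinearMap.prod ((LinearMap.id - σ ∘ₗ f).codRestrict (LinearMap.ker f) fun x => by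
      simp [hσ']) f)
    ((LinearMap.ker f).subtype.coprod σ) ?_
  ext x
  simp

/-- If `J ≤ K` has a complement in the lattice of left ideals above `J` and `J` is projective, then
so is `K`. -/
theorem projective_of_complement {S : Type*} [Ring S] {J K L : Ideal S} [Module.Projective S J]
    (hsup : K ⊔ L = ⊤) (hinf : K ⊓ L = J) : Module.Projective S K := by
  -- Addition maps `K × L` onto the free module `S`, with kernel an antidiagonal copy of `J`. So `K
  -- × L` is projective, and `K` is a direct summand.
  let f : (K × L) →ₗ[S] S := K.subtype.coprod L.subtype
  have hf : Function.Surjective f := by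
    intro x
    have hx : x ∈ K ⊔ L := by rw [hsup]; trivial
    obtain ⟨a, ha, b, hb, rfl⟩ := Submodule.mem_sup.mp hx
    exact ⟨(⟨a, ha⟩, ⟨b, hb⟩), rfl⟩
  have hKJ : J ≤ K := hinf ▸ inf_le_left
  have hLJ : J ≤ L := hinf ▸ inf_le_right
  have hmem : ∀ x : LinearMap.ker f, (x.1.1 : S) ∈ J := by
    rintro ⟨⟨a, b⟩, hx⟩
    have hab : (a : S) + b = 0 := hx
    rw [← hinf]
    refine ⟨a.2, ?_⟩
    change (a : S) ∈ L
    rw [eq_neg_of_add_eq_zero_left hab]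
    exact L.neg_mem b.2
  have hker : Module.Projective S (LinearMap.ker f) := by
    refine Module.Projective.of_split (M := J)
      ((K.subtype ∘ₗ LinearMap.fst S K L ∘ₗ (LinearMap.ker f).subtype).codRestrict J hmem)
      (((Submodule.inclusion hKJ).prod (-Submodule.inclusion hLJ)).codRestrict (LinearMap.ker f)
        fun x => by simp [f]) ?_
    ext x
    · rfl
    · have hab : (x.1.1 : S) + x.1.2 = 0 := x.2
      exact (eq_neg_of_add_eq_zero_right hab).symm
  have := projective_of_surjective_of_ker f hf
  exact Module.Projective.of_split (LinearMap.inl S K L) (LinearMap.fst S K L) (by ext; rfl)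

/-- Left ideals containing a power of a two-sided ideal `J` are projective if all left ideals
containing `J` are. -/
theorem projective_of_pow_le {S : Type*} [Ring S] [IsNoetherianRing S] {J : Ideal S}
    [J.IsTwoSided] (hJ : ∀ K : Ideal S, J ≤ K → Module.Projective S K) (W : Ideal S)
    (hW : ∃ n, J ^ n ≤ W) : Module.Projective S W := by
  classical
  induction W using (wellFounded_gt (α := Ideal S)).induction with
  | _ W ih =>
  by_cases htop : W = ⊤
  · rw [htop]; exact hJ ⊤ le_top
  obtain ⟨x, hxW, hJx⟩ : ∃ x, x ∉ W ∧ ∀ y ∈ J, y * x ∈ W := by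
    have h0 : Nat.find hW ≠ 0 := by
      intro h0
      have := Nat.find_spec hW
      rw [h0, Submodule.pow_zero, Ideal.one_eq_top, top_le_iff] at this
      exact htop this
    obtain ⟨m, hm⟩ := Nat.exists_eq_succ_of_ne_zero h0
    have h1 := Nat.find_min hW (m := m) (by omega)
    obtain ⟨x, hx, hxW⟩ := SetLike.not_le_iff_exists.mp h1
    refine ⟨x, hxW, fun y hy => Nat.find_spec hW ?_⟩
    rw [hm, Nat.succ_eq_add_one, Ideal.IsTwoSided.pow_succ]
    exact Ideal.mul_mem_mul hy hx
  let W' : Ideal S := W ⊔ Ideal.span {x}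
  have hWW' : W ≤ W' := le_sup_left
  have hxW' : x ∈ W' := (le_sup_right : Ideal.span {x} ≤ W') (Ideal.mem_span_singleton_self x)
  have hlt : W < W' := lt_of_le_of_ne hWW' fun h => hxW (h ▸ hxW')
  have hproj : Module.Projective S W' := ih W' hlt (hW.imp fun n hn => hn.trans hWW')
  let K : Ideal S := Submodule.comap (LinearMap.toSpanSingleton S S x) W
  have hK : Module.Projective S K := hJ K fun y hy => hJx y hy
  -- `Q` is the pullback of `W' → W'/W` and `s ↦ s x`, as in Schanuel's lemma. Its projection to
  -- `W'` is onto with kernel `K`, so `Q` is projective, and `(w, s) ↦ w - s x` retracts `Q` onto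
  -- `W`.
  let Q : Submodule S (W' × S) := Submodule.comap
    (W'.subtype.coprod (-LinearMap.toSpanSingleton S S x)) W
  have hQ : ∀ q : W' × S, q ∈ Q ↔ (q.1 : S) - q.2 * x ∈ W := by
    intro q
    change (q.1 : S) + -(q.2 * x) ∈ W ↔ _
    rw [sub_eq_add_neg]
  let f : Q →ₗ[S] W' := LinearMap.fst S W' S ∘ₗ Q.subtype
  have hf : Function.Surjective f := by
    rintro ⟨w, hw⟩
    obtain ⟨a, ha, b, hb, rfl⟩ := Submodule.mem_sup.mp hw
    obtain ⟨s, rfl⟩ := Ideal.mem_span_singleton'.mp hb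
    refine ⟨⟨(⟨_, hw⟩, s), (hQ _).mpr ?_⟩, rfl⟩
    simpa using ha
  have hker : Module.Projective S (LinearMap.ker f) := by
    refine Module.Projective.of_split (M := K)
      ((LinearMap.snd S W' S ∘ₗ Q.subtype ∘ₗ (LinearMap.ker f).subtype).codRestrict K ?_)
      (((LinearMap.inr S W' S ∘ₗ K.subtype).codRestrict Q ?_).codRestrict (LinearMap.ker f) ?_) ?_
    · rintro ⟨⟨⟨w, s⟩, hq⟩, h0⟩
      have h0 : w = 0 := h0
      have := (hQ _).mp hq
      rw [h0] at this
      simpa [K] using this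
    · intro s
      refine (hQ _).mpr ?_
      change (0 : S) - s * x ∈ W
      rw [zero_sub]
      exact W.neg_mem s.2
    · intro s
      rfl
    · ext ⟨⟨⟨w, s⟩, hq⟩, h0⟩
      · have h0 : w = 0 := h0
        exact congrArg Subtype.val h0.symm
      · rfl
  have := projective_of_surjective_of_ker f hf
  refine Module.Projective.of_split (M := Q)
    ((LinearMap.inl S W' S ∘ₗ Submodule.inclusion hWW').codRestrict Q ?_)
    ((W'.subtype.coprod (-LinearMap.toSpanSingleton S S x) ∘ₗ Q.subtype).codRestrict W ?_) ?_
  · intro w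
    refine (hQ _).mpr ?_
    simp
  · intro q
    exact q.2
  · ext w
    change (w : S) + -((0 : S) * x) = w
    rw [zero_mul, neg_zero, add_zero]

/-- A ring `S` which is finite modulo a two-sided ideal `I` has a two-sided ideal `J ⊇ I`, nilpotent modulo
`I`, such that `S / J` is semisimple. -/
theorem exists_semisimple_quotient {S : Type*} [Ring S] (I : Ideal S) [I.IsTwoSided]
    [Finite (S ⧸ I)] : ∃ J : Ideal S, J.IsTwoSided ∧ I ≤ J ∧ (∃ n, J ^ n ≤ I) ∧
      ∀ K : Ideal S, J ≤ K → ∃ L : Ideal S, K ⊔ L = ⊤ ∧ K ⊓ L = J := by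
  let F := S ⧸ I
  let q : S →+* F := Ideal.Quotient.mk I
  let r : F →+* F ⧸ Ring.jacobson F := Ideal.Quotient.mk _
  let f : S →+* F ⧸ Ring.jacobson F := r.comp q
  have hq : Function.Surjective q := Ideal.Quotient.mk_surjective
  have hf : Function.Surjective f := Ideal.Quotient.mk_surjective.comp hq
  refine ⟨RingHom.ker f, inferInstance, ?_, ?_, ?_⟩
  · intro x hx
    have : q x = 0 := Ideal.Quotient.eq_zero_iff_mem.mpr hx
    rw [RingHom.mem_ker, RingHom.comp_apply, this, map_zero]
  · obtain ⟨n, hn⟩ := IsSemiprimaryRing.isNilpotent (R := F)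
    refine ⟨n, ?_⟩
    have key : ∀ m, ∀ x ∈ RingHom.ker f ^ m, q x ∈ Ring.jacobson F ^ m := by
      intro m
      induction m with
      | zero => intro x _; simp [Submodule.pow_zero]
      | succ m ih =>
        intro x hx
        rw [Ideal.IsTwoSided.pow_succ] at hx ⊢
        induction hx using Submodule.mul_induction_on' with
        | mem_mul_mem a ha b hb =>
          rw [map_mul]
          exact Ideal.mul_mem_mul (Ideal.Quotient.eq_zero_iff_mem.mp ha) (ih b hb)
        | add a _ b _ h1 h2 => rw [map_add]; exact Ideal.add_mem _ h1 h2
    intro x hx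
    have := key n x hx
    rw [hn] at this
    exact Ideal.Quotient.eq_zero_iff_mem.mp this
  · intro K hK
    obtain ⟨L', hL'⟩ := exists_isCompl (K.map f)
    have hKK : (K.map f).comap f = K := by
      rw [Ideal.comap_map_of_surjective f hf, sup_eq_left]
      exact hK
    refine ⟨L'.comap f, ?_, ?_⟩
    · rw [Ideal.eq_top_iff_one]
      have h1 : (1 : F ⧸ Ring.jacobson F) ∈ K.map f ⊔ L' := by rw [hL'.sup_eq_top]; trivial
      obtain ⟨a, ha, b, hb, hab⟩ := Submodule.mem_sup.mp h1
      obtain ⟨k, rfl⟩ := hf a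
      have hk : k ∈ K := by rw [← hKK]; exact ha
      rw [show (1 : S) = k + (1 - k) by abel]
      refine Submodule.add_mem_sup hk ?_
      change f (1 - k) ∈ L'
      rw [map_sub, map_one, ← hab, add_sub_cancel_left]
      exact hb
    · nth_rewrite 1 [← hKK]
      rw [← Ideal.comap_inf, hL'.inf_eq_bot]
      rfl

/-! ### Left ideals containing `p` and `e` -/

namespace SymmetricMaximal

variable {S : Type*} [Ring S] {p : ℕ} {e : S}

/-- The preimage `J` of the radical of `S ⧸ I` is projective by the dual basis argument.
Semisimplicity of `S / J` provides complements, which settles the ideals above `J`; nilpotency of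
`J` modulo `I` gives the rest. -/
theorem projective (h : SymmetricMaximal S p e) [IsNoetherianRing S] (I : Ideal S)
    [I.IsTwoSided] [Finite (S ⧸ I)] (hp : (p : S) ∈ I) (he : e ∈ I) (W : Ideal S) (hW : I ≤ W) :
    Module.Projective S W := by
  obtain ⟨J, hJ2, hIJ, hn, hK⟩ := exists_semisimple_quotient I
  have hJ := h.projective_of_natCast_mem (hIJ he) (hIJ hp)
  refine projective_of_pow_le (J := J) ?_ W (hn.imp fun n hn => hn.trans hW)
  intro K hJK
  obtain ⟨L, h1, h2⟩ := hK K hJK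
  exact projective_of_complement h1 h2

/-- If `c = 1 + g + ⋯ + g ^ (p - 1)` with `g ^ p = 1`, then `S c (1 - e)` is a projective
module, which yields a left-`g`-invariant element acting on `c (1 - e)` as the identity. -/
theorem exists_invariant (h : SymmetricMaximal S p e) [IsNoetherianRing S] (I : Ideal S)
    [I.IsTwoSided] [Finite (S ⧸ I)] (hp : (p : S) ∈ I) (he : e ∈ I)
    (hI : ∀ W : Ideal S, (p : S) ∈ W → e ∈ W → I ≤ W) {g : S} (hg : g ^ p = 1) :
    ∃ v : S, g * v = v ∧
      v * ((∑ i ∈ Finset.range p, g ^ i) * (1 - e)) = (∑ i ∈ Finset.range p, g ^ i) * (1 - e) := by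
  set c : S := ∑ i ∈ Finset.range p, g ^ i with hc
  have hcancel {x y : S} (hxy : (p : S) * x = p * y) : x = y := by
    rw [← sub_eq_zero]
    apply h.cancel
    rw [mul_sub, hxy, sub_self]
  have hgc : (g - 1) * c = 0 := by rw [hc, mul_geom_sum, hg, sub_self]
  have hgc' : g * c = c := by rwa [sub_mul, one_mul, sub_eq_zero] at hgc
  have hgi : ∀ i, g ^ i * c = c := by
    intro i
    induction i with
    | zero => simp
    | succ i ih => rw [pow_succ, mul_assoc, hgc', ih]
  have hcc : c * c = p * c := by
    nth_rewrite 1 [hc]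
    rw [Finset.sum_mul, Finset.sum_congr rfl fun i _ => hgi i]
    simp
  have h1e : (1 - e) * (1 - e) = 1 - e := by
    rw [mul_sub, sub_mul, sub_mul, one_mul, mul_one, one_mul, h.idem, sub_self, sub_zero]
  have hcomm (x : S) : x * (1 - e) = (1 - e) * x := by
    rw [mul_sub, sub_mul, h.central, mul_one, one_mul]
  -- `W` contains `p` because `c` is congruent to `p` modulo `S (g - 1)`; hence `W` is projective.
  -- Right multiplication by `c (1 - e) / p` kills `g - 1` and `e`, maps `W` into `S c (1 - e)`, and
  -- is the identity there. So that module is a retract of `W`.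
  let W : Ideal S := Ideal.span {g - 1} ⊔ (Ideal.span {c} ⊔ Ideal.span {e})
  have hgW : g - 1 ∈ W := (le_sup_left : _ ≤ W) (Ideal.mem_span_singleton_self _)
  have hcW : c ∈ W := (le_sup_left.trans le_sup_right : Ideal.span {c} ≤ W)
    (Ideal.mem_span_singleton_self _)
  have heW : e ∈ W := (le_sup_right.trans le_sup_right : Ideal.span {e} ≤ W)
    (Ideal.mem_span_singleton_self _)
  have hpW : (p : S) ∈ W := by
    have h1 : c - p = (∑ i ∈ Finset.range p, (∑ j ∈ Finset.range i, g ^ j)) * (g - 1) := by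
      rw [Finset.sum_mul, Finset.sum_congr rfl fun i _ => geom_sum_mul g i,
        Finset.sum_sub_distrib]
      simp [hc]
    have h2 : c - p ∈ W := by rw [h1]; exact W.mul_mem_left _ hgW
    have := W.sub_mem hcW h2
    rwa [sub_sub_cancel] at this
  have hproj := h.projective I hp he W (hI W hpW heW)
  set c' : S := c * (1 - e) with hc'
  let X : Ideal S := Ideal.span {c'}
  have hXW : X ≤ W := by
    rw [Ideal.span_singleton_le_iff_mem, hc', hcomm]
    exact W.mul_mem_left _ hcW
  have hWX : ∀ w : W, ∃ x : X, (p : S) * x = w * c' := by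
    rintro ⟨w, hw⟩
    obtain ⟨a, ha, y, hy, rfl⟩ := Submodule.mem_sup.mp hw
    obtain ⟨b, hb, d, hd, rfl⟩ := Submodule.mem_sup.mp hy
    obtain ⟨a, rfl⟩ := Ideal.mem_span_singleton'.mp ha
    obtain ⟨b, rfl⟩ := Ideal.mem_span_singleton'.mp hb
    obtain ⟨d, rfl⟩ := Ideal.mem_span_singleton'.mp hd
    refine ⟨⟨b * c', X.mul_mem_left b (Ideal.mem_span_singleton_self _)⟩, ?_⟩
    have h1 : a * (g - 1) * c' = 0 := by
      rw [hc', mul_assoc, ← mul_assoc (g - 1), hgc, zero_mul, mul_zero]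
    have h2 : b * c * c' = p * (b * c') := by
      rw [hc', mul_assoc, ← mul_assoc c, hcc, ← mul_assoc (p : S) b, (Nat.cast_commute p b).eq]
      simp only [mul_assoc]
    have h3 : d * e * c' = 0 := by
      rw [hc', hcomm, mul_assoc, ← mul_assoc e, mul_sub, mul_one, h.idem, sub_self, zero_mul,
        mul_zero]
    change (p : S) * (b * c') = (a * (g - 1) + (b * c + d * e)) * c'
    rw [add_mul, add_mul, h1, h2, h3, zero_add, add_zero]
  choose ρ hρ using hWX
  let ρ' : W →ₗ[S] X :=
    { toFun := ρ
      map_add' := fun a b => Subtype.ext (hcancel (by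
        rw [hρ, Submodule.coe_add, Submodule.coe_add, mul_add, hρ, hρ, add_mul]))
      map_smul' := fun s a => Subtype.ext (hcancel (by
        rw [hρ, RingHom.id_apply, Submodule.coe_smul, Submodule.coe_smul, smul_eq_mul, smul_eq_mul,
          ← mul_assoc (p : S), (Nat.cast_commute p s).eq, mul_assoc s (p : S), hρ, mul_assoc])) }
  have hX : Module.Projective S X := by
    refine Module.Projective.of_split (Submodule.inclusion hXW) ρ' ?_
    ext ⟨x, hx⟩
    obtain ⟨s, rfl⟩ := Ideal.mem_span_singleton'.mp hx
    apply hcancel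
    change (p : S) * (ρ _ : S) = p * (s * c')
    rw [hρ]
    change s * c' * c' = _
    have : c' * c' = p * c' := by
      rw [hc', mul_assoc, ← mul_assoc (1 - e), ← hcomm c, mul_assoc c, h1e, ← mul_assoc, hcc,
        mul_assoc]
    rw [mul_assoc, this, ← mul_assoc, ← (Nat.cast_commute p s).eq, mul_assoc]
  have hcX : c' ∈ X := Ideal.mem_span_singleton_self _
  let π : S →ₗ[S] X := LinearMap.toSpanSingleton S X ⟨c', hcX⟩
  have hπ : Function.Surjective π := by
    rintro ⟨x, hx⟩
    obtain ⟨s, rfl⟩ := Ideal.mem_span_singleton'.mp hx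
    exact ⟨s, rfl⟩
  -- The section evaluated at `c'` is the desired element: `g * c' = c'` and linearity make it
  -- invariant under `g`.
  obtain ⟨σ, hσ⟩ := Module.projective_lifting_property π LinearMap.id hπ
  refine ⟨σ ⟨c', hcX⟩, ?_, congrArg Subtype.val (LinearMap.congr_fun hσ ⟨c', hcX⟩)⟩
  rw [← smul_eq_mul, ← map_smul]
  congr 1
  ext
  change g * c' = c'
  rw [hc', ← mul_assoc, hgc']

end SymmetricMaximal

/-! ### The criterion for group rings of finite groups: necessity -/

section

variable {p : ℕ} [Fact p.Prime] {G : Type*} [Group G]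

theorem toZMod_eq_zero_iff_dvd (x : ℤ_[p]) : PadicInt.toZMod x = 0 ↔ (p : ℤ_[p]) ∣ x := by
  rw [← RingHom.mem_ker, PadicInt.ker_toZMod, PadicInt.maximalIdeal_eq_span_p,
    Ideal.mem_span_singleton]

theorem natCast_dvd_groupRing_iff [Finite G] (x : MonoidAlgebra ℤ_[p] G) :
    (p : MonoidAlgebra ℤ_[p] G) ∣ x ↔ ∀ g, PadicInt.toZMod (x.coeff g) = 0 := by
  constructor
  · rintro ⟨y, rfl⟩ g
    rw [toZMod_eq_zero_iff_dvd]
    refine ⟨y.coeff g, ?_⟩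
    rw [← nsmul_eq_mul, ← nsmul_eq_mul]
    rfl
  · intro h
    choose y hy using fun g => (toZMod_eq_zero_iff_dvd _).mp (h g)
    refine ⟨MonoidAlgebra.ofCoeff (Finsupp.equivFunOnFinite.symm y), ?_⟩
    ext g
    rw [hy, ← nsmul_eq_mul, ← nsmul_eq_mul]
    rfl

theorem groupRing_natCast_mul_cancel (x : MonoidAlgebra ℤ_[p] G)
    (h : (p : MonoidAlgebra ℤ_[p] G) * x = 0) : x = 0 := by
  rw [← nsmul_eq_mul] at h
  ext g
  have h1 : p • x.coeff g = 0 := congrArg (fun z => z.coeff g) h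
  rw [nsmul_eq_mul] at h1
  exact (mul_eq_zero.mp h1).resolve_left (by exact_mod_cast (Fact.out : p.Prime).ne_zero)

theorem finite_groupRing_quotient [Finite G] (I : Ideal (MonoidAlgebra ℤ_[p] G))
    (hI : (p : MonoidAlgebra ℤ_[p] G) ∈ I) : Finite (MonoidAlgebra ℤ_[p] G ⧸ I) := by
  have : NeZero p := ⟨(Fact.out : p.Prime).ne_zero⟩
  refine Finite.of_surjective (α := G → ZMod p) (fun f => Submodule.Quotient.mk
    (MonoidAlgebra.ofCoeff (Finsupp.equivFunOnFinite.symm fun g => ((f g).val : ℤ_[p])))) ?_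
  intro y
  obtain ⟨x, rfl⟩ := Submodule.Quotient.mk_surjective _ y
  refine ⟨fun g => PadicInt.toZMod (x.coeff g), ?_⟩
  rw [Submodule.Quotient.eq]
  have h : (p : MonoidAlgebra ℤ_[p] G) ∣ MonoidAlgebra.ofCoeff (Finsupp.equivFunOnFinite.symm
      fun g => ((PadicInt.toZMod (x.coeff g)).val : ℤ_[p])) - x := by
    rw [natCast_dvd_groupRing_iff]
    intro g
    rw [MonoidAlgebra.coeff_sub, Finsupp.sub_apply, map_sub]
    change PadicInt.toZMod (((PadicInt.toZMod (x.coeff g)).val : ℕ) : ℤ_[p]) - _ = 0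
    rw [map_natCast, ZMod.natCast_zmod_val, sub_self]
  obtain ⟨z, hz⟩ := h
  rw [hz, (Nat.cast_commute p z).eq]
  exact I.mul_mem_left z hI

/-- The group ring of a finite group over a field is a symmetric algebra: proper ideals have
nonzero left annihilators modulo `p`. -/
theorem groupRing_exists_annihilator [Finite G] (T : Ideal (MonoidAlgebra ℤ_[p] G))
    [T.IsTwoSided] (hp : (p : MonoidAlgebra ℤ_[p] G) ∈ T) (h1 : (1 : MonoidAlgebra ℤ_[p] G) ∉ T) :
    ∃ b, ¬ (p : MonoidAlgebra ℤ_[p] G) ∣ b ∧ ∀ t ∈ T, (p : MonoidAlgebra ℤ_[p] G) ∣ b * t := by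
  classical
  have := Fintype.ofFinite G
  have : NeZero p := ⟨(Fact.out : p.Prime).ne_zero⟩
  let red : MonoidAlgebra ℤ_[p] G →+ (G → ZMod p) :=
    { toFun := fun x g => PadicInt.toZMod (x.coeff g)
      map_zero' := by ext g; simp
      map_add' := fun x y => by ext g; simp }
  have hdvd {x : MonoidAlgebra ℤ_[p] G} (h : red x = 0) : (p : MonoidAlgebra ℤ_[p] G) ∣ x :=
    (natCast_dvd_groupRing_iff x).mpr fun g => congrFun h g
  let T' : Submodule (ZMod p) (G → ZMod p) :=
    { T.toAddSubmonoid.map red with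
      smul_mem' := by
        rintro c _ ⟨t, ht, rfl⟩
        refine ⟨(c.val : MonoidAlgebra ℤ_[p] G) * t, T.mul_mem_left _ ht, ?_⟩
        rw [← nsmul_eq_mul, map_nsmul, ← Nat.cast_smul_eq_nsmul (ZMod p), ZMod.natCast_zmod_val] }
  have hT' : T' < ⊤ := by
    rw [lt_top_iff_ne_top]
    intro htop
    have : red 1 ∈ T' := by rw [htop]; trivial
    obtain ⟨t, ht, h⟩ := this
    obtain ⟨z, hz⟩ := hdvd (x := t - 1) (by rw [map_sub, h, sub_self])
    apply h1
    rw [show (1 : MonoidAlgebra ℤ_[p] G) = t - (t - 1) by abel, hz, (Nat.cast_commute p z).eq]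
    exact T.sub_mem ht (T.mul_mem_left z hp)
  obtain ⟨l, hl0, hl⟩ := Submodule.exists_le_ker_of_lt_top T' hT'
  -- `b` represents the linear form `l`, which vanishes on `T` modulo `p`: the coefficient of `b *
  -- t` at `h` is `l` of `t * h⁻¹`, and `T` is stable under right multiplication.
  let b : MonoidAlgebra ℤ_[p] G := MonoidAlgebra.ofCoeff (Finsupp.equivFunOnFinite.symm
    fun g => ((l (Pi.single g⁻¹ 1)).val : ℤ_[p]))
  have hb (g : G) : PadicInt.toZMod (b.coeff g) = l (Pi.single g⁻¹ 1) := by simp [b]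
  have hbt (t : MonoidAlgebra ℤ_[p] G) (h : G) : PadicInt.toZMod ((b * t).coeff h) =
      l (red (t * MonoidAlgebra.of _ _ h⁻¹)) := by
    induction t using MonoidAlgebra.induction_linear with
    | zero => simp
    | add x y hx hy =>
      rw [mul_add, add_mul, MonoidAlgebra.coeff_add, Finsupp.add_apply, map_add, hx, hy, map_add,
        map_add]
    | single k r =>
      have h2 : red (MonoidAlgebra.single k r * MonoidAlgebra.of _ _ h⁻¹) =
          PadicInt.toZMod r • Pi.single (k * h⁻¹) 1 := by
        rw [MonoidAlgebra.of_apply, MonoidAlgebra.single_mul_single, mul_one]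
        ext g
        change PadicInt.toZMod ((MonoidAlgebra.single (k * h⁻¹) r).coeff g) = _
        rw [MonoidAlgebra.coeff_single, Finsupp.single_apply]
        by_cases hg : k * h⁻¹ = g
        · subst hg; simp
        · rw [if_neg hg, map_zero, Pi.smul_apply, Pi.single_eq_of_ne (Ne.symm hg), smul_zero]
      rw [MonoidAlgebra.coeff_mul_single_apply, map_mul, hb, h2, map_smul, smul_eq_mul, mul_comm,
        mul_inv_rev, inv_inv]
  refine ⟨b, fun h => hl0 ?_, fun t ht => ?_⟩
  · rw [natCast_dvd_groupRing_iff] at h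
    refine LinearMap.pi_ext' fun g => LinearMap.ext_ring ?_
    have := h g⁻¹
    rw [hb, inv_inv] at this
    exact this
  · rw [natCast_dvd_groupRing_iff]
    intro h
    rw [hbt]
    exact hl ⟨_, T.mul_mem_right _ ht, rfl⟩


theorem groupRingIdem_coeff [Finite G] (N : Subgroup G) [DecidablePred (· ∈ N)] (g : G) :
    (groupRingIdem p N).coeff g = if g ∈ N then (Nat.card N : ℚ_[p])⁻¹ else 0 := by
  have := Fintype.ofFinite N
  rw [groupRingIdem, finsum_eq_sum_of_fintype, MonoidAlgebra.coeff_smul_apply,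
    MonoidAlgebra.coeff_sum, Finsupp.finsetSum_apply]
  simp only [MonoidAlgebra.of_apply, MonoidAlgebra.coeff_single]
  split_ifs with h
  · rw [Finset.sum_eq_single (⟨g, h⟩ : N)]
    · simp
    · intro n _ hn
      exact Finsupp.single_eq_of_ne fun h' => hn (Subtype.ext h'.symm)
    · simp
  · rw [Finset.sum_eq_zero, smul_zero]
    intro n _
    exact Finsupp.single_eq_of_ne fun h' => h (h' ▸ n.2)

/-- The coefficient of `e_N` at the identity is `1/|N|`, which must therefore be a `p`-adic integer.
-/
theorem IsHybridGroupRing.not_dvd_card {N : Subgroup G} (h : IsHybridGroupRing p N) :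
    ¬ p ∣ Nat.card N := by
  classical
  have := h.finite
  obtain ⟨e, he⟩ := h.idem_mem
  have h1 : ((e.coeff 1 : ℤ_[p]) : ℚ_[p]) = (Nat.card N : ℚ_[p])⁻¹ := by
    rw [← groupRingIncl_apply]
    exact (congrArg (fun z => z.coeff 1) he).trans
      ((groupRingIdem_coeff N 1).trans (if_pos (one_mem N)))
  apply not_dvd_of_isUnit_natCast_padicInt
  refine IsUnit.of_mul_eq_one (e.coeff 1) (Subtype.ext ?_)
  have h0 : (Nat.card N : ℚ_[p]) ≠ 0 := by exact_mod_cast Nat.card_pos.ne'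
  rw [PadicInt.coe_mul, h1, PadicInt.coe_natCast, mul_inv_cancel₀ h0]
  rfl

/-- If `ℤ_p[G]` is `N`-hybrid, then `ℤ_p[G] (1 - e_N)` is a symmetric maximal order. -/
theorem IsHybridGroupRing.symmetricMaximal {N : Subgroup G} (h : IsHybridGroupRing p N)
    {e : MonoidAlgebra ℤ_[p] G} (he : groupRingIncl p G e = groupRingIdem p N) :
    SymmetricMaximal (MonoidAlgebra ℤ_[p] G) p e := by
  classical
  have := h.finite
  have := Fintype.ofFinite N
  have hinj := groupRingIncl_injective p G
  have hu := isUnit_natCast_padicInt p h.not_dvd_card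
  have h0 : (Nat.card N : ℚ_[p]) ≠ 0 := by exact_mod_cast Nat.card_pos.ne'
  have heN : (Nat.card N : ℤ_[p]) • e = ∑ᶠ n : N, (finiteTwistedGroupRing ℤ_[p] G).of n := by
    apply hinj
    rw [map_smul, he, groupRingIdem, finsum_eq_sum_of_fintype, finsum_eq_sum_of_fintype, map_sum,
      ← algebraMap_smul ℚ_[p] (Nat.card N : ℤ_[p]), map_natCast, smul_smul, mul_inv_cancel₀ h0,
      one_smul]
    exact Finset.sum_congr rfl fun n _ => (groupRingIncl_of p (n : G)).symm
  have hidem : e * e = e := TwistedGroupRing.idem_mul_idem hu heN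
  have hcentral : ∀ x, x * e = e * x :=
    TwistedGroupRing.idem_comm h.normal hu heN
  refine ⟨groupRing_natCast_mul_cancel, hidem, hcentral, ?_, fun T _ => groupRing_exists_annihilator T⟩
  intro O hO hpO hOO x hx
  let j := groupRingIncl p G
  let ε := 1 - groupRingIdem p N
  have hε : j (1 - e) = ε := by rw [map_sub, map_one, he]
  have hεε : ε * ε = ε := by
    rw [← hε, ← map_mul, mul_sub, sub_mul, sub_mul, one_mul, mul_one, one_mul, hidem, sub_self,
      sub_zero]
  have hεc (y : MonoidAlgebra ℤ_[p] G) : j y * ε = ε * j y := by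
    rw [← hε, ← map_mul, ← map_mul, mul_sub, sub_mul, hcentral, mul_one, one_mul]
  have hp0 : (p : ℤ_[p]) ≠ 0 := by exact_mod_cast (Fact.out : p.Prime).ne_zero
  have hcancel {a b : MonoidAlgebra ℚ_[p] G} (hab : (p : ℤ_[p]) • a = (p : ℤ_[p]) • b) : a = b := by
    rw [← sub_eq_zero]
    apply groupRing_smul_eq_zero p _ hp0
    rw [smul_sub, hab, sub_self]
  have hjp (y : MonoidAlgebra ℤ_[p] G) : j (p * y) = (p : ℤ_[p]) • j y := by
    rw [← nsmul_eq_mul, map_nsmul, Nat.cast_smul_eq_nsmul]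
  let f : MonoidAlgebra ℤ_[p] G →ₗ[ℤ_[p]] MonoidAlgebra ℚ_[p] G :=
    LinearMap.mulRight ℤ_[p] ε ∘ₗ j.toLinearMap
  -- `M` is `p⁻¹ O (1 - e)`, an order containing `ℤ_p[G] (1 - e)`, hence equal to it.
  let M : Submodule ℤ_[p] (MonoidAlgebra ℚ_[p] G) :=
    ((O.restrictScalars ℤ_[p]).map f).comap (LinearMap.lsmul ℤ_[p] _ (p : ℤ_[p]))
  have hM (a : MonoidAlgebra ℚ_[p] G) : a ∈ M ↔ ∃ y ∈ O, j y * ε = (p : ℤ_[p]) • a := Iff.rfl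
  have hle : groupRingCut p N ≤ M := by
    rintro _ ⟨y, rfl⟩
    refine (hM _).mpr ⟨p * y, O.mul_mem_right y hpO, ?_⟩
    rw [hjp, smul_mul_assoc]
    rfl
  have hMo : IsOrderIn ℤ_[p] ε M := by
    refine ⟨fun a ha => ?_, hle h.maximal.1.idem_mem, fun a ha b hb => ?_, ?_, fun a => ?_⟩
    · obtain ⟨y, -, hy⟩ := (hM _).mp ha
      apply hcancel
      rw [← smul_mul_assoc, ← hy, mul_assoc, hεε]
    · obtain ⟨y, hy, e1⟩ := (hM _).mp ha
      obtain ⟨z, hz, e2⟩ := (hM _).mp hb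
      obtain ⟨w, hw, e3⟩ := hOO y hy z hz
      refine (hM _).mpr ⟨w, hw, hcancel ?_⟩
      rw [← smul_mul_assoc (p : ℤ_[p]) (j w), ← hjp, ← e3, ← smul_mul_assoc,
        ← mul_smul_comm, ← e1, ← e2, map_mul, mul_assoc, mul_assoc, ← mul_assoc ε, ← hεc,
        mul_assoc, hεε]
    · have hN : IsNoetherian ℤ_[p] ((O.restrictScalars ℤ_[p]).map f) :=
        isNoetherian_of_fg_of_noetherian _ ((IsNoetherian.noetherian _).map f)
      have : IsNoetherian ℤ_[p] M := by
        refine isNoetherian_of_injective ((LinearMap.lsmul ℤ_[p] _ (p : ℤ_[p])).restrict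
          (p := M) (q := (O.restrictScalars ℤ_[p]).map f) fun a ha => ha) ?_
        intro a b hab
        exact Subtype.ext (hcancel (congrArg Subtype.val hab))
      exact (Submodule.fg_top M).mp (IsNoetherian.noetherian ⊤)
    · obtain ⟨r, hr, hra⟩ := h.maximal.1.spans a
      exact ⟨r, hr, hle hra⟩
  have hMeq := h.maximal.2 M hMo hle
  let a : MonoidAlgebra ℚ_[p] G := (p : ℚ_[p])⁻¹ • (j x * ε)
  have hpa : (p : ℤ_[p]) • a = j x * ε := by
    rw [← algebraMap_smul ℚ_[p] (p : ℤ_[p]), map_natCast, smul_smul, mul_inv_cancel₀, one_smul]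
    exact_mod_cast (Fact.out : p.Prime).ne_zero
  have haM : a ∈ groupRingCut p N := by
    rw [← hMeq]
    exact (hM _).mpr ⟨x, hx, hpa.symm⟩
  obtain ⟨z, hz⟩ := haM
  have hz : j z * ε = a := hz
  refine ⟨z * (1 - e), hinj ?_⟩
  change j _ = j _
  rw [hjp, map_mul, map_mul, hε, hz, hpa]

/-- Compare coefficients at `n` in `v c (1 - e) = c (1 - e)`, where `c` is the norm element of `g`
and `g v = v`. On the right one finds `-1/|N|`, since the nontrivial powers of `g` have order `p`
and so avoid `N`. On the left, since `g` commutes with `n` and fixes `v`, the `p` summands of `c`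
contribute equally, giving a multiple of `p`. -/
theorem IsHybridGroupRing.noCommuting {N : Subgroup G} (h : IsHybridGroupRing p N) :
    NoCommuting p N := by
  classical
  intro g hg n hn hgn
  by_contra hn1
  have := h.finite
  have hpN := h.not_dvd_card
  have hp : p.Prime := Fact.out
  obtain ⟨e, he⟩ := h.idem_mem
  have he : groupRingIncl p G e = groupRingIdem p N := he
  have hS := h.symmetricMaximal he
  have hcoef (k : G) : ((e.coeff k : ℤ_[p]) : ℚ_[p]) =
      if k ∈ N then (Nat.card N : ℚ_[p])⁻¹ else 0 := by
    rw [← groupRingIncl_apply, he, groupRingIdem_coeff]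
  have : IsNoetherianRing (MonoidAlgebra ℤ_[p] G) := IsNoetherianRing.of_finite ℤ_[p] _
  let I : Ideal (MonoidAlgebra ℤ_[p] G) := Ideal.span {(p : MonoidAlgebra ℤ_[p] G), e}
  have hI2 : I.IsTwoSided := ⟨fun {a} b ha => by
    obtain ⟨x, y, rfl⟩ := Ideal.mem_span_pair.mp ha
    refine Ideal.mem_span_pair.mpr ⟨x * b, y * b, ?_⟩
    rw [add_mul, mul_assoc x, mul_assoc y, mul_assoc x, mul_assoc y, hS.central,
      (Nat.cast_commute p b).eq]⟩
  have hpI : (p : MonoidAlgebra ℤ_[p] G) ∈ I := Ideal.subset_span (by simp)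
  have heI : e ∈ I := Ideal.subset_span (by simp)
  have : Finite (MonoidAlgebra ℤ_[p] G ⧸ I) := finite_groupRing_quotient I hpI
  let γ : MonoidAlgebra ℤ_[p] G := MonoidAlgebra.of _ _ g
  have hγ : γ ^ p = 1 := by rw [← map_pow, orderOf_dvd_iff_pow_eq_one.mp hg.dvd, map_one]
  obtain ⟨v, hv, hvc⟩ := hS.exists_invariant I hpI heI (fun W h1 h2 => by
    rw [Ideal.span_le]; rintro x (rfl | rfl) <;> assumption) hγ
  have hcoprime {k : G} (h1 : k ^ p = 1) (h2 : k ∈ N) : k = 1 := by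
    rw [← orderOf_eq_one_iff]
    have h3 : orderOf k ∣ Nat.card N := by
      rw [← Subgroup.orderOf_mk k h2]
      exact orderOf_dvd_natCard _
    exact Nat.eq_one_of_dvd_coprimes ((Nat.Prime.coprime_iff_not_dvd hp).mpr hpN)
      (orderOf_dvd_of_pow_eq_one h1) h3
  have hgi (i : ℕ) : (g ^ i) ^ p = 1 := by
    rw [← pow_mul, mul_comm, pow_mul, ← hg, pow_orderOf_eq_one, one_pow]
  have hleft : ((∑ i ∈ Finset.range p, γ ^ i) * (1 - e)).coeff n = - e.coeff n := by
    rw [mul_sub, mul_one, Finset.sum_mul, MonoidAlgebra.coeff_sub, Finsupp.sub_apply,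
      MonoidAlgebra.coeff_sum, MonoidAlgebra.coeff_sum, Finsupp.finsetSum_apply,
      Finsupp.finsetSum_apply, Finset.sum_eq_zero, Finset.sum_eq_single 0, zero_sub, pow_zero,
      one_mul]
    · intro i hi hi0
      rw [← map_pow, MonoidAlgebra.of_apply, MonoidAlgebra.coeff_single_mul_apply, one_mul]
      apply Subtype.ext
      rw [hcoef, if_neg]
      · rfl
      intro hmem
      have h1 : g ^ i ∈ N := by
        have := N.mul_mem hn (N.inv_mem hmem)
        rwa [mul_inv_rev, inv_inv, mul_inv_cancel_left] at this
      have h2 := hcoprime (hgi i) h1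
      have h3 := orderOf_dvd_of_pow_eq_one h2
      rw [hg] at h3
      exact absurd (Nat.le_of_dvd (Nat.pos_of_ne_zero hi0) h3) (by simpa using hi)
    · intro h0
      exact absurd (Finset.mem_range.mpr hp.pos) h0
    · intro i _
      rw [← map_pow, MonoidAlgebra.of_apply, MonoidAlgebra.coeff_single, Finsupp.single_eq_of_ne]
      rintro h1
      exact hn1 (hcoprime (h1 ▸ hgi i) hn)
  have hright : (v * ((∑ i ∈ Finset.range p, γ ^ i) * (1 - e))).coeff n =
      p * (v * (1 - e)).coeff n := by
    have hcomm (x : MonoidAlgebra ℤ_[p] G) : x * (1 - e) = (1 - e) * x := by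
      rw [mul_sub, sub_mul, hS.central, mul_one, one_mul]
    have hvi (i : ℕ) : γ ^ i * v = v := by
      induction i with
      | zero => simp
      | succ i ih => rw [pow_succ, mul_assoc, hv, ih]
    rw [hcomm, ← mul_assoc, Finset.mul_sum, MonoidAlgebra.coeff_sum, Finsupp.finsetSum_apply,
      Finset.sum_congr rfl (g := fun _ => (v * (1 - e)).coeff n), Finset.sum_const,
      Finset.card_range, nsmul_eq_mul]
    intro i _
    have hc : Commute g n := hgn
    conv_rhs => rw [← hvi i]
    rw [mul_assoc (γ ^ i), ← map_pow, MonoidAlgebra.of_apply, MonoidAlgebra.coeff_single_mul_apply,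
      MonoidAlgebra.coeff_mul_single_apply, one_mul, mul_one]
    rw [((hc.pow_left i).inv_left).eq]
  rw [hvc, hleft] at hright
  have hunit : (p : ℤ_[p]) ∣ 1 := by
    refine ⟨-((v * (1 - e)).coeff n * Nat.card N), ?_⟩
    have h0 : (Nat.card N : ℚ_[p]) ≠ 0 := by exact_mod_cast Nat.card_pos.ne'
    have h1 : e.coeff n * (Nat.card N : ℤ_[p]) = 1 := by
      apply Subtype.ext
      rw [PadicInt.coe_mul, hcoef, if_pos hn, PadicInt.coe_natCast, inv_mul_cancel₀ h0]
      rfl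
    rw [← h1, ← neg_eq_iff_eq_neg.mpr hright.symm]
    ring
  exact PadicInt.prime_p.not_isUnit (isUnit_of_dvd_one hunit)

end

/-! ### Iwasawa algebras over open central subgroups -/

section

variable {p : ℕ} [Fact p.Prime] {Γ G : Type*} [Group Γ] [TopologicalSpace Γ] [Group G]
  [TopologicalSpace G]

/-- An open embedding of groups with central image. -/
structure IsCentralOpen (φ : Γ →* G) : Prop where
  continuous : Continuous φ
  injective : Function.Injective φ
  isOpenMap : IsOpenMap φ
  central : ∀ x g, g * φ x = φ x * g

theorem comapDomain_mapDomain_mul {R H K : Type*} [CommRing R] [Group H] [Group K] (f : H →* K)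
    (hf : Function.Injective f) (a : MonoidAlgebra R H) (y : MonoidAlgebra R K) :
    MonoidAlgebra.comapDomain f hf (MonoidAlgebra.mapDomainRingHom R f a * y) =
      a * MonoidAlgebra.comapDomain f hf y := by
  induction a using MonoidAlgebra.induction_linear with
  | zero => simp
  | add a b ha hb => rw [map_add, add_mul, add_mul, MonoidAlgebra.comapDomain_add, ha, hb]
  | single h r =>
    ext k
    rw [MonoidAlgebra.mapDomainRingHom_apply, MonoidAlgebra.mapDomain_single,
      MonoidAlgebra.coeff_single_mul_apply, MonoidAlgebra.coeff_comapDomain,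
      MonoidAlgebra.coeff_comapDomain, Finsupp.comapDomain_apply, Finsupp.comapDomain_apply,
      MonoidAlgebra.coeff_single_mul_apply, map_mul f, map_inv f]

namespace IwasawaAlgebra

/-- The component of an element of `Λ(G)` at an open normal subgroup. -/
def component (U : OpenNormalSubgroup G) :
    IwasawaAlgebra p G →+* MonoidAlgebra ℤ_[p] (G ⧸ U.toSubgroup) :=
  (Pi.evalRingHom _ U).comp (iwasawaSubring p G).subtype

theorem ext {x y : IwasawaAlgebra p G} (h : ∀ U, component U x = component U y) : x = y :=
  Subtype.ext (funext h)

/-- The canonical map `G → Λ(G)` as a monoid homomorphism. -/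
def ofHom (p : ℕ) [Fact p.Prime] (G : Type*) [Group G] [TopologicalSpace G] :
    G →* IwasawaAlgebra p G where
  toFun := iwasawaOf p
  map_one' := ext fun U => by
    change MonoidAlgebra.of ℤ_[p] (G ⧸ U.toSubgroup) (QuotientGroup.mk 1) = 1
    rw [QuotientGroup.mk_one, map_one]
  map_mul' g h := ext fun U => by
    change MonoidAlgebra.of ℤ_[p] (G ⧸ U.toSubgroup) (QuotientGroup.mk (g * h)) =
      MonoidAlgebra.of ℤ_[p] _ (QuotientGroup.mk g) * MonoidAlgebra.of ℤ_[p] _ (QuotientGroup.mk h)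
    rw [QuotientGroup.mk_mul, map_mul]

theorem ofHom_component (g : G) (U : OpenNormalSubgroup G) :
    component U (ofHom p G g) = MonoidAlgebra.single (QuotientGroup.mk g) 1 := rfl

theorem transition_component (x : IwasawaAlgebra p G) {U V : OpenNormalSubgroup G} (h : U ≤ V) :
    iwasawaTransition p h (component U x) = component V x := x.2 U V h

/-- The component of `Λ(φ) x` at `U` is determined by the component of `x` at any smaller subgroup. -/
theorem map_component_of_le (φ : Γ →* G) (hφ : Continuous φ) (x : IwasawaAlgebra p Γ)
    {V : OpenNormalSubgroup Γ} {U : OpenNormalSubgroup G}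
    (h : V.toSubgroup ≤ U.toSubgroup.comap φ) :
    component U (iwasawaMap p φ hφ x) =
      MonoidAlgebra.mapDomainRingHom ℤ_[p] (QuotientGroup.map V.toSubgroup U.toSubgroup φ h)
        (component V x) := by
  have h' : V ≤ openNormalComap φ hφ U := h
  change iwasawaMapComponent p φ hφ U (component (openNormalComap φ hφ U) _) = _
  rw [← transition_component x h', iwasawaMapComponent, iwasawaTransition, ← RingHom.comp_apply,
    ← MonoidAlgebra.mapDomainRingHom_comp]
  congr 2
  ext y
  rfl

theorem map_ofHom (φ : Γ →* G) (hφ : Continuous φ) (g : Γ) :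
    iwasawaMap p φ hφ (ofHom p Γ g) = ofHom p G (φ g) := by
  refine ext fun U => ?_
  rw [map_component_of_le φ hφ (V := openNormalComap φ hφ U) _ le_rfl, ofHom_component,
    ofHom_component, MonoidAlgebra.mapDomainRingHom_apply,
    MonoidAlgebra.mapDomain_single]
  rfl

theorem map_comp {H : Type*} [Group H] [TopologicalSpace H] (φ : Γ →* G) (hφ : Continuous φ)
    (ψ : G →* H) (hψ : Continuous ψ) (hc : Continuous (ψ.comp φ)) (x : IwasawaAlgebra p Γ) :
    iwasawaMap p (ψ.comp φ) hc x = iwasawaMap p ψ hψ (iwasawaMap p φ hφ x) := by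
  refine ext fun U => ?_
  rw [map_component_of_le ψ hψ (V := openNormalComap ψ hψ U) _ le_rfl]
  rw [map_component_of_le φ hφ (V := openNormalComap φ hφ (openNormalComap ψ hψ U)) _ le_rfl,
    map_component_of_le (ψ.comp φ) hc (V := openNormalComap φ hφ (openNormalComap ψ hψ U)) _ le_rfl]
  refine Eq.trans ?_ (RingHom.comp_apply _ _ _)
  rw [← MonoidAlgebra.mapDomainRingHom_comp]
  congr 2
  ext y
  rfl

theorem map_id (hc : Continuous (MonoidHom.id G)) (x : IwasawaAlgebra p G) :
    iwasawaMap p (MonoidHom.id G) hc x = x := by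
  refine ext fun U => ?_
  rw [map_component_of_le _ hc (V := U) _ le_rfl]
  have : QuotientGroup.map U.toSubgroup U.toSubgroup (MonoidHom.id G) le_rfl = MonoidHom.id _ := by
    ext y
    rfl
  rw [this, MonoidAlgebra.mapDomainRingHom_id]
  rfl

end IwasawaAlgebra

namespace IsCentralOpen

open IwasawaAlgebra

variable {φ : Γ →* G} (h : IsCentralOpen φ)

/-- The image of an open normal subgroup. -/
def image (V : OpenNormalSubgroup Γ) : OpenNormalSubgroup G where
  toSubgroup := V.toSubgroup.map φ
  isOpen' := h.isOpenMap _ V.toOpenSubgroup.isOpen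
  isNormal' := ⟨by
    rintro _ ⟨x, hx, rfl⟩ g
    rw [h.central, mul_inv_cancel_right]
    exact ⟨x, hx, rfl⟩⟩

/-- The map `Γ / V → G / φ(V)`. -/
def quot (V : OpenNormalSubgroup Γ) : Γ ⧸ V.toSubgroup →* G ⧸ (h.image V).toSubgroup :=
  QuotientGroup.map V.toSubgroup (h.image V).toSubgroup φ fun _ hx => ⟨_, hx, rfl⟩

theorem quot_injective (V : OpenNormalSubgroup Γ) : Function.Injective (h.quot V) := by
  rw [injective_iff_map_eq_one]
  intro x hx
  obtain ⟨x, rfl⟩ := QuotientGroup.mk_surjective x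
  obtain ⟨y, hy, hyx⟩ := (QuotientGroup.eq_one_iff (φ x)).mp hx
  rw [← h.injective hyx]
  exact (QuotientGroup.eq_one_iff y).mpr hy

theorem mem_range_quot {V : OpenNormalSubgroup Γ} {g : G} :
    (QuotientGroup.mk g : G ⧸ (h.image V).toSubgroup) ∈ Set.range (h.quot V) ↔ g ∈ φ.range := by
  constructor
  · rintro ⟨x, hx⟩
    obtain ⟨x, rfl⟩ := QuotientGroup.mk_surjective x
    obtain ⟨y, -, hy⟩ := QuotientGroup.eq.mp (show (QuotientGroup.mk (φ x) : G ⧸ _) = _ from hx)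
    exact ⟨x * y, by rw [map_mul]; rw [hy, mul_inv_cancel_left]⟩
  · rintro ⟨x, rfl⟩
    exact ⟨QuotientGroup.mk x, rfl⟩

theorem image_mono {V W : OpenNormalSubgroup Γ} (hVW : V ≤ W) : h.image V ≤ h.image W :=
  Subgroup.map_mono (f := φ) (show V.toSubgroup ≤ W.toSubgroup from hVW)

variable (p) in
/-- The projection `Λ(G) → Λ(Γ)` which restricts measures on `G` to `Γ`. -/
def proj : IwasawaAlgebra p G →+ IwasawaAlgebra p Γ where
  toFun x := ⟨fun V => MonoidAlgebra.comapDomain (h.quot V) (h.quot_injective V) (component (h.image V) x),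
    fun V W hVW => by
      dsimp only
      rw [← transition_component x (h.image_mono hVW)]
      generalize component (h.image V) x = y
      induction y using MonoidAlgebra.induction_linear with
      | zero => simp
      | add a b ha hb => rw [MonoidAlgebra.comapDomain_add, map_add, map_add,
          MonoidAlgebra.comapDomain_add, ha, hb]
      | single k r =>
        obtain ⟨g, rfl⟩ := QuotientGroup.mk_surjective k
        by_cases hg : g ∈ φ.range
        · obtain ⟨x, rfl⟩ := hg
          have h1 : (QuotientGroup.mk (φ x) : G ⧸ (h.image V).toSubgroup) = h.quot V x := rfl
          have h2 : iwasawaTransition p (h.image_mono hVW) (MonoidAlgebra.single (h.quot V x) r) =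
              MonoidAlgebra.single (h.quot W x) r := by
            rw [iwasawaTransition, MonoidAlgebra.mapDomainRingHom_apply,
              MonoidAlgebra.mapDomain_single]
            rfl
          rw [h1, h2, MonoidAlgebra.comapDomain_single_map, MonoidAlgebra.comapDomain_single_map,
            iwasawaTransition, MonoidAlgebra.mapDomainRingHom_apply,
            MonoidAlgebra.mapDomain_single]
          rfl
        · have h2 : iwasawaTransition p (h.image_mono hVW)
              (MonoidAlgebra.single (QuotientGroup.mk g) r) =
              MonoidAlgebra.single (QuotientGroup.mk g) r := by
            rw [iwasawaTransition, MonoidAlgebra.mapDomainRingHom_apply,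
              MonoidAlgebra.mapDomain_single]
            rfl
          rw [h2, MonoidAlgebra.comapDomain_single_of_not_mem_range,
            MonoidAlgebra.comapDomain_single_of_not_mem_range, map_zero]
          · rwa [h.mem_range_quot]
          · rwa [h.mem_range_quot]⟩
  map_zero' := ext fun V => MonoidAlgebra.comapDomain_zero _ (h.quot_injective V)
  map_add' x y := ext fun V => MonoidAlgebra.comapDomain_add _ (h.quot_injective V) _ _

theorem proj_component (x : IwasawaAlgebra p G) (V : OpenNormalSubgroup Γ) :
    component V (h.proj p x) =
      MonoidAlgebra.comapDomain (h.quot V) (h.quot_injective V) (component (h.image V) x) := rfl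

theorem map_component_image (r : IwasawaAlgebra p Γ) (V : OpenNormalSubgroup Γ) :
    component (h.image V) (iwasawaMap p φ h.continuous r) =
      MonoidAlgebra.mapDomainRingHom ℤ_[p] (h.quot V) (component V r) :=
  map_component_of_le φ h.continuous r _

theorem proj_map_mul (r : IwasawaAlgebra p Γ) (x : IwasawaAlgebra p G) :
    h.proj p (iwasawaMap p φ h.continuous r * x) = r * h.proj p x := by
  refine ext fun V => ?_
  rw [proj_component, map_mul, h.map_component_image, comapDomain_mapDomain_mul, map_mul, proj_component]

theorem proj_ofHom_of_notMem {g : G} (hg : g ∉ φ.range) : h.proj p (ofHom p G g) = 0 := by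
  refine ext fun V => ?_
  rw [proj_component, ofHom_component, MonoidAlgebra.comapDomain_single_of_not_mem_range, map_zero]
  · rwa [h.mem_range_quot]

theorem proj_one : h.proj p 1 = 1 := by
  refine ext fun V => ?_
  rw [proj_component, map_one, map_one, MonoidAlgebra.one_def, MonoidAlgebra.one_def,
    ← map_one (h.quot V), MonoidAlgebra.comapDomain_single_map]

theorem proj_map (r : IwasawaAlgebra p Γ) : h.proj p (iwasawaMap p φ h.continuous r) = r := by
  rw [← mul_one (iwasawaMap p φ h.continuous r), h.proj_map_mul, h.proj_one, mul_one]

theorem map_injective : Function.Injective (iwasawaMap p φ h.continuous) := fun a b hab => by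
  rw [← h.proj_map a, hab, h.proj_map]

/-- Images of open normal subgroups of `Γ` are cofinal in `G`, since `U` contains the image of its
own preimage. -/
theorem ext_image {x y : IwasawaAlgebra p G} (hxy : ∀ V, component (h.image V) x = component (h.image V) y) :
    x = y := by
  refine ext fun U => ?_
  have hle : h.image (openNormalComap φ h.continuous U) ≤ U := by
    rintro _ ⟨x, hx, rfl⟩
    exact hx
  rw [← transition_component x hle, ← transition_component y hle, hxy]

/-- A measure on `G` is the sum of its restrictions to the cosets of the image of `Γ`, each of which
is a translate of a measure on `Γ`. At finite level it suffices to check a single group element. -/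
theorem sum_map_proj_mul_ofHom (x : IwasawaAlgebra p G) [Fintype (G ⧸ φ.range)] :
    x = ∑ q : G ⧸ φ.range, iwasawaMap p φ h.continuous (h.proj p (x * ofHom p G (q.out)⁻¹)) *
      ofHom p G q.out := by
  classical
  refine h.ext_image fun V => ?_
  rw [map_sum]
  simp only [map_mul, h.map_component_image, proj_component, ofHom_component]
  generalize component (h.image V) x = y
  induction y using MonoidAlgebra.induction_linear with
  | zero => simp
  | add a b ha hb =>
    simp only [add_mul, MonoidAlgebra.comapDomain_add, map_add, Finset.sum_add_distrib]
    rw [← ha, ← hb]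
  | single k r =>
    obtain ⟨g, rfl⟩ := QuotientGroup.mk_surjective k
    rw [Finset.sum_eq_single (QuotientGroup.mk g)]
    · set q : G ⧸ φ.range := QuotientGroup.mk g
      obtain ⟨x, hx⟩ : (q.out)⁻¹ * g ∈ φ.range := QuotientGroup.eq.mp q.out_eq
      have h2 : g * (q.out)⁻¹ = φ x := by
        rw [mul_inv_eq_iff_eq_mul, ← h.central, hx, mul_inv_cancel_left]
      have h3 : (QuotientGroup.mk g * QuotientGroup.mk (q.out)⁻¹ : G ⧸ (h.image V).toSubgroup) =
          h.quot V x := by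
        rw [← QuotientGroup.mk_mul, h2]; rfl
      rw [MonoidAlgebra.single_mul_single, h3, MonoidAlgebra.comapDomain_single_map,
        MonoidAlgebra.mapDomainRingHom_apply, MonoidAlgebra.mapDomain_single, ← h3,
        MonoidAlgebra.single_mul_single, mul_assoc, ← QuotientGroup.mk_mul (N := (h.image V).toSubgroup)]
      simp
    · intro q _ hq
      rw [MonoidAlgebra.single_mul_single, ← QuotientGroup.mk_mul,
        MonoidAlgebra.comapDomain_single_of_not_mem_range, map_zero, zero_mul]
      rw [h.mem_range_quot]
      rintro ⟨x, hx⟩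
      apply hq
      rw [← q.out_eq]
      refine QuotientGroup.eq.mpr ⟨x, ?_⟩
      have := h.central x q.out
      rw [hx, inv_mul_cancel_right] at *
      rw [← mul_left_cancel_iff (a := q.out), this]
      group
    · simp

end IsCentralOpen

end

/-! ### The Iwasawa algebra of `ℤ_p` is a power series ring -/

section

open PowerSeries

variable {p : ℕ} [Fact p.Prime]

theorem isDistinguishedAt_one_add_X_pow_sub_one (k : ℕ) :
    ((1 + Polynomial.X) ^ p ^ k - 1 : Polynomial ℤ_[p]).IsDistinguishedAt
      (IsLocalRing.maximalIdeal ℤ_[p]) := by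
  have hp : p.Prime := Fact.out
  have hpk : p ^ k ≠ 0 := pow_ne_zero _ hp.ne_zero
  have hdeg : ((1 + Polynomial.X) ^ p ^ k : Polynomial ℤ_[p]).natDegree = p ^ k := by
    rw [Polynomial.natDegree_pow, add_comm, ← Polynomial.C_1, Polynomial.natDegree_X_add_C, mul_one]
  have hmonic : ((1 + Polynomial.X) ^ p ^ k : Polynomial ℤ_[p]).Monic := by
    rw [add_comm, ← Polynomial.C_1]
    exact (Polynomial.monic_X_add_C 1).pow _
  have hlt : (1 : Polynomial ℤ_[p]).degree < ((1 + Polynomial.X) ^ p ^ k : Polynomial ℤ_[p]).degree := by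
    rw [Polynomial.degree_eq_natDegree hmonic.ne_zero, hdeg, Polynomial.degree_one]
    exact_mod_cast Nat.pos_of_ne_zero hpk
  refine ⟨⟨fun {n} hn => ?_⟩, hmonic.sub_of_left hlt⟩
  rw [Polynomial.natDegree_sub_eq_left_of_natDegree_lt, hdeg] at hn
  · rw [Polynomial.coeff_sub, add_comm, Polynomial.coeff_X_add_one_pow, Polynomial.coeff_one,
      PadicInt.maximalIdeal_eq_span_p, Ideal.mem_span_singleton]
    by_cases h0 : n = 0
    · simp [h0]
    · rw [if_neg h0, sub_zero]
      exact_mod_cast (Nat.cast_dvd_cast (hp.dvd_choose_pow h0 hn.ne))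
  · rw [Polynomial.natDegree_one, hdeg]
    exact Nat.pos_of_ne_zero hpk

/-- Weierstrass division: modulo the distinguished polynomial `(1 + X) ^ p ^ k - 1`, power series
agree with polynomials, and those can be divided with remainder. -/
theorem exists_powerSeries_eq_mul_add (k : ℕ) (f : ℤ_[p]⟦X⟧) :
    ∃ (g : ℤ_[p]⟦X⟧) (r : Polynomial ℤ_[p]), r.degree < p ^ k ∧
      f = ((1 + X) ^ p ^ k - 1) * g + (r : ℤ_[p]⟦X⟧) := by
  have H := isDistinguishedAt_one_add_X_pow_sub_one (p := p) k
  obtain ⟨r, hr⟩ := Ideal.Quotient.mk_surjective (H.algEquivQuotient.symm (Ideal.Quotient.mk _ f))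
  have h1 : H.algEquivQuotient (Ideal.Quotient.mk _ r) = Ideal.Quotient.mk _ f := by
    rw [hr, AlgEquiv.apply_symm_apply]
  set ω : Polynomial ℤ_[p] := (1 + Polynomial.X) ^ p ^ k - 1 with hω
  have hdeg : ω.degree = p ^ k := by
    have h2 : ((1 + Polynomial.X) ^ p ^ k : Polynomial ℤ_[p]).degree = (p ^ k : ℕ) := by
      rw [Polynomial.degree_pow, add_comm, ← Polynomial.C_1, Polynomial.degree_X_add_C]
      simp
    rw [hω, Polynomial.degree_sub_eq_left_of_degree_lt, h2]
    · simp
    · rw [h2, Polynomial.degree_one]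
      exact_mod_cast pow_pos (Fact.out : p.Prime).pos k
  have h2 : H.algEquivQuotient (Ideal.Quotient.mk _ (r %ₘ ω)) = Ideal.Quotient.mk _ f := by
    rw [← h1]
    congr 1
    rw [Ideal.Quotient.mk_eq_mk_iff_sub_mem, Ideal.mem_span_singleton']
    refine ⟨-(r /ₘ ω), ?_⟩
    rw [Polynomial.modByMonic_eq_sub_mul_div]
    ring
  have h3 : Ideal.Quotient.mk (Ideal.span {(ω : ℤ_[p]⟦X⟧)}) ((r %ₘ ω : Polynomial ℤ_[p]) : ℤ_[p]⟦X⟧) =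
      Ideal.Quotient.mk _ f := by
    rw [← h2, Polynomial.IsDistinguishedAt.algEquivQuotient_apply]
    simp
  obtain ⟨g, hg⟩ := Ideal.mem_span_singleton'.mp ((Ideal.Quotient.mk_eq_mk_iff_sub_mem _ _).mp h3)
  refine ⟨-g, r %ₘ ω, hdeg ▸ Polynomial.degree_modByMonic_lt r H.monic, ?_⟩
  have : (ω : ℤ_[p]⟦X⟧) = (1 + X) ^ p ^ k - 1 := by simp [hω]
  rw [← this]
  linear_combination hg

section

variable {B : Type*} [Ring B] [Algebra ℤ_[p] B] {b : B} {k : ℕ}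

theorem powerSeries_algHom_apply (ψ : ℤ_[p]⟦X⟧ →ₐ[ℤ_[p]] B) (hb : (1 + ψ X) ^ p ^ k = 1)
    (g : ℤ_[p]⟦X⟧) (r : Polynomial ℤ_[p]) :
    ψ (((1 + X) ^ p ^ k - 1) * g + (r : ℤ_[p]⟦X⟧)) = Polynomial.aeval (ψ X) r := by
  have h1 : ψ ((1 + X) ^ p ^ k - 1) = 0 := by
    rw [map_sub, map_pow, map_add, map_one, hb, sub_self]
  have h2 : ψ.comp (Polynomial.coeToPowerSeries.algHom ℤ_[p]) = Polynomial.aeval (ψ X) := by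
    ext
    simp
  rw [map_add, map_mul, h1, zero_mul, zero_add, ← h2]
  simp

/-- Continuity is not needed: the condition `hb` makes the map factor through the quotient by `(1 +
X) ^ p ^ k - 1`, in which every class is represented by a polynomial. -/
theorem powerSeries_algHom_ext (ψ ψ' : ℤ_[p]⟦X⟧ →ₐ[ℤ_[p]] B) (hb : (1 + ψ X) ^ p ^ k = 1)
    (h : ψ X = ψ' X) : ψ = ψ' := by
  ext f
  obtain ⟨g, r, -, rfl⟩ := exists_powerSeries_eq_mul_add k f
  rw [powerSeries_algHom_apply ψ hb, powerSeries_algHom_apply ψ' (h ▸ hb), h]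

theorem exists_powerSeries_algHom (hb : (1 + b) ^ p ^ k = 1) :
    ∃ ψ : ℤ_[p]⟦X⟧ →ₐ[ℤ_[p]] B, ψ X = b := by
  have H := isDistinguishedAt_one_add_X_pow_sub_one (p := p) k
  let ψ₀ := Ideal.Quotient.liftₐ (Ideal.span {((1 + Polynomial.X) ^ p ^ k - 1 : Polynomial ℤ_[p])})
    (Polynomial.aeval b) fun a ha => by
      obtain ⟨c, rfl⟩ := Ideal.mem_span_singleton'.mp ha
      rw [map_mul, map_sub, map_pow, map_add, map_one, Polynomial.aeval_X, hb, sub_self, mul_zero]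
  refine ⟨(ψ₀.comp H.algEquivQuotient.symm.toAlgHom).comp (Ideal.Quotient.mkₐ _ _), ?_⟩
  have : H.algEquivQuotient.symm (Ideal.Quotient.mk _ X) = Ideal.Quotient.mk _ Polynomial.X := by
    rw [AlgEquiv.symm_apply_eq, Polynomial.IsDistinguishedAt.algEquivQuotient_apply]
    simp
  change ψ₀ (H.algEquivQuotient.symm (Ideal.Quotient.mk _ X)) = b
  rw [this]
  change Polynomial.aeval b Polynomial.X = b
  rw [Polynomial.aeval_X]

end

/-- Induction through `y ^ p - 1 = (y - 1) (1 + y + ⋯ + y ^ (p - 1))`: for `y` congruent to `1`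
modulo the maximal ideal, the second factor is congruent to `p` and so lies in that ideal. -/
theorem one_add_X_pow_sub_one_mem (k : ℕ) :
    ((1 + X) ^ p ^ k - 1 : ℤ_[p]⟦X⟧) ∈ IsLocalRing.maximalIdeal ℤ_[p]⟦X⟧ ^ (k + 1) := by
  have hX : (X : ℤ_[p]⟦X⟧) ∈ IsLocalRing.maximalIdeal ℤ_[p]⟦X⟧ := by
    rw [IsLocalRing.mem_maximalIdeal, mem_nonunits_iff, PowerSeries.isUnit_iff_constantCoeff]
    simp
  have hp : (p : ℤ_[p]⟦X⟧) ∈ IsLocalRing.maximalIdeal ℤ_[p]⟦X⟧ := by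
    rw [IsLocalRing.mem_maximalIdeal, mem_nonunits_iff, PowerSeries.isUnit_iff_constantCoeff,
      map_natCast]
    exact PadicInt.prime_p.not_isUnit
  induction k with
  | zero => simpa using hX
  | succ k ih =>
    set y : ℤ_[p]⟦X⟧ := (1 + X) ^ p ^ k with hy
    rw [_root_.pow_succ p k, pow_mul, ← hy, ← mul_geom_sum, _root_.pow_succ]
    refine Ideal.mul_mem_mul ih ?_
    have h1 : ∑ i ∈ Finset.range p, y ^ i = (∑ i ∈ Finset.range p, (y ^ i - 1)) + p := by
      simp
    rw [h1]
    refine Ideal.add_mem _ (Ideal.sum_mem _ fun i _ => ?_) hp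
    rw [← mul_geom_sum]
    exact Ideal.mul_mem_right _ _ (Ideal.pow_le_self (by omega) ih)

/-- The divisors lie in ever higher powers of the maximal ideal, so Krull's intersection theorem
applies. -/
theorem powerSeries_eq_zero_of_forall_dvd (f : ℤ_[p]⟦X⟧)
    (h : ∀ n, ∃ k, n ≤ k ∧ ((1 + X) ^ p ^ k - 1 : ℤ_[p]⟦X⟧) ∣ f) : f = 0 := by
  have h1 : f ∈ (⨅ n : ℕ, IsLocalRing.maximalIdeal ℤ_[p]⟦X⟧ ^ n : Ideal ℤ_[p]⟦X⟧) := by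
    rw [Ideal.mem_iInf]
    intro n
    obtain ⟨k, hk, g, rfl⟩ := h n
    exact Ideal.mul_mem_right _ _ (Ideal.pow_le_pow_right (by omega) (one_add_X_pow_sub_one_mem k))
  rwa [Ideal.iInf_pow_eq_bot_of_isLocalRing _ (Ideal.IsPrime.ne_top inferInstance)] at h1

end

section

open PowerSeries

variable {p : ℕ} [Fact p.Prime]

instance (G : Type*) [CommGroup G] [TopologicalSpace G] : CommRing (IwasawaAlgebra p G) where
  mul_comm x y := IwasawaAlgebra.ext fun U => by
    rw [map_mul, map_mul]
    exact mul_comm (G := MonoidAlgebra ℤ_[p] (G ⧸ U.toSubgroup)) _ _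

namespace PadicInt

theorem exists_span_pow_le (U : OpenNormalSubgroup (Multiplicative ℤ_[p])) :
    ∃ n : ℕ, ∀ x ∈ Ideal.span {(p : ℤ_[p]) ^ n}, Multiplicative.ofAdd x ∈ U := by
  have hopen : IsOpen {x : ℤ_[p] | Multiplicative.ofAdd x ∈ U} :=
    U.toOpenSubgroup.isOpen.preimage continuous_ofAdd
  obtain ⟨ε, hε, hball⟩ := Metric.isOpen_iff.mp hopen 0 (one_mem U)
  obtain ⟨n, hn⟩ := PadicInt.exists_pow_neg_lt p hε
  refine ⟨n, fun x hx => ?_⟩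
  have h1 : x ∈ Metric.ball (0 : ℤ_[p]) ε := ?_
  · exact hball h1
  rw [Metric.mem_ball, dist_zero_right]
  exact ((PadicInt.norm_le_pow_iff_mem_span_pow x n).mpr hx).trans_lt hn

/-- The image of the topological generator of `ℤ_p` in a finite quotient. -/
def gen (U : OpenNormalSubgroup (Multiplicative ℤ_[p])) : Multiplicative ℤ_[p] ⧸ U.toSubgroup :=
  QuotientGroup.mk (Multiplicative.ofAdd 1)

theorem gen_pow (U : OpenNormalSubgroup (Multiplicative ℤ_[p])) (n : ℕ) :
    gen U ^ n = QuotientGroup.mk (Multiplicative.ofAdd (n : ℤ_[p])) := by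
  rw [gen, ← QuotientGroup.mk_pow, ← ofAdd_nsmul, nsmul_one]

theorem exists_orderOf_gen (U : OpenNormalSubgroup (Multiplicative ℤ_[p])) :
    ∃ k, orderOf (gen U) = p ^ k := by
  obtain ⟨n, hn⟩ := exists_span_pow_le U
  have : gen U ^ p ^ n = 1 := by
    rw [gen_pow, QuotientGroup.eq_one_iff]
    exact hn _ (by rw [Nat.cast_pow]; exact Ideal.mem_span_singleton_self _)
  obtain ⟨k, -, hk⟩ := (Nat.dvd_prime_pow Fact.out).mp (orderOf_dvd_of_pow_eq_one this)
  exact ⟨k, hk⟩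

theorem exists_gen_pow_eq (U : OpenNormalSubgroup (Multiplicative ℤ_[p]))
    (x : Multiplicative ℤ_[p] ⧸ U.toSubgroup) : ∃ i : ℕ, gen U ^ i = x := by
  obtain ⟨n, hn⟩ := exists_span_pow_le U
  obtain ⟨y, rfl⟩ := QuotientGroup.mk_surjective x
  refine ⟨y.toAdd.appr n, ?_⟩
  rw [gen_pow, QuotientGroup.eq, ← ofAdd_neg]
  have := hn _ (PadicInt.appr_spec n y.toAdd)
  rw [sub_eq_neg_add] at this
  exact this

/-- The subgroup `p ^ n ℤ_p`. -/
def openPow (p : ℕ) [Fact p.Prime] (n : ℕ) : OpenNormalSubgroup (Multiplicative ℤ_[p]) where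
  toSubgroup := AddSubgroup.toSubgroup (Ideal.span {(p : ℤ_[p]) ^ n}).toAddSubgroup
  isOpen' := by
    have : IsOpen {x : ℤ_[p] | x ∈ Ideal.span {(p : ℤ_[p]) ^ n}} := by
      have h : {x : ℤ_[p] | x ∈ Ideal.span {(p : ℤ_[p]) ^ n}} =
          Metric.closedBall 0 ((p : ℝ) ^ (-n : ℤ)) := by
        ext x
        rw [Metric.mem_closedBall, dist_zero_right, PadicInt.norm_le_pow_iff_mem_span_pow]
        rfl
      rw [h]
      refine IsUltrametricDist.isOpen_closedBall _ ?_
      exact (zpow_pos (by exact_mod_cast (Fact.out : p.Prime).pos) _).ne'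
    exact this.preimage continuous_toAdd
  isNormal' := inferInstance

theorem le_of_orderOf_gen_openPow {n k : ℕ} (h : orderOf (gen (openPow p n)) = p ^ k) : n ≤ k := by
  have h1 : gen (openPow p n) ^ p ^ k = 1 := by rw [← h, pow_orderOf_eq_one]
  rw [gen_pow, QuotientGroup.eq_one_iff] at h1
  have h2 : ((p ^ k : ℕ) : ℤ_[p]) ∈ Ideal.span {(p : ℤ_[p]) ^ n} := h1
  rw [Ideal.mem_span_singleton, Nat.cast_pow] at h2
  exact (pow_dvd_pow_iff PadicInt.prime_p.ne_zero PadicInt.prime_p.not_isUnit).mp h2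

end PadicInt

open PadicInt IwasawaAlgebra

variable (U : OpenNormalSubgroup (Multiplicative ℤ_[p]))

theorem one_add_single_gen_pow {k : ℕ} (hk : orderOf (gen U) = p ^ k) :
    (1 + (MonoidAlgebra.single (gen U) (1 : ℤ_[p]) - 1) : MonoidAlgebra ℤ_[p] _) ^ p ^ k = 1 := by
  rw [add_sub_cancel, MonoidAlgebra.single_pow, ← hk, pow_orderOf_eq_one, one_pow]
  rfl

theorem exists_levelHom : ∃ ψ : ℤ_[p]⟦X⟧ →ₐ[ℤ_[p]]
    MonoidAlgebra ℤ_[p] (Multiplicative ℤ_[p] ⧸ U.toSubgroup),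
    ψ X = MonoidAlgebra.single (gen U) 1 - 1 := by
  obtain ⟨k, hk⟩ := exists_orderOf_gen U
  exact exists_powerSeries_algHom (one_add_single_gen_pow U hk)

/-- The homomorphism `ℤ_p⟦X⟧ → ℤ_p[ℤ_p / U]` which maps `1 + X` to the generator of `ℤ_p`. -/
def levelHom : ℤ_[p]⟦X⟧ →ₐ[ℤ_[p]]
    MonoidAlgebra ℤ_[p] (Multiplicative ℤ_[p] ⧸ U.toSubgroup) :=
  (exists_levelHom U).choose

theorem levelHom_X : levelHom U X = MonoidAlgebra.single (gen U) 1 - 1 :=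
  (exists_levelHom U).choose_spec

theorem levelHom_mul_add {k : ℕ} (hk : orderOf (gen U) = p ^ k) (g : ℤ_[p]⟦X⟧)
    (r : Polynomial ℤ_[p]) : levelHom U (((1 + X) ^ p ^ k - 1) * g + (r : ℤ_[p]⟦X⟧)) =
      Polynomial.aeval (MonoidAlgebra.single (gen U) 1) (r.comp (Polynomial.X - 1)) := by
  rw [powerSeries_algHom_apply _ (by rw [levelHom_X]; exact one_add_single_gen_pow U hk),
    levelHom_X, Polynomial.aeval_comp]
  simp

theorem levelHom_compat {U V : OpenNormalSubgroup (Multiplicative ℤ_[p])} (h : U ≤ V)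
    (f : ℤ_[p]⟦X⟧) : iwasawaTransition p h (levelHom U f) = levelHom V f := by
  let T : MonoidAlgebra ℤ_[p] (Multiplicative ℤ_[p] ⧸ U.toSubgroup) →ₐ[ℤ_[p]]
      MonoidAlgebra ℤ_[p] (Multiplicative ℤ_[p] ⧸ V.toSubgroup) :=
    { iwasawaTransition p h with
      commutes' := fun r => by
        change iwasawaTransition p h (MonoidAlgebra.single 1 r) = MonoidAlgebra.single 1 r
        rw [iwasawaTransition, MonoidAlgebra.mapDomainRingHom_apply, MonoidAlgebra.mapDomain_single,
          map_one] }
  obtain ⟨k, hk⟩ := exists_orderOf_gen V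
  have hX : levelHom V X = T.comp (levelHom U) X := by
    change _ = iwasawaTransition p h (levelHom U X)
    rw [levelHom_X, levelHom_X, map_sub, map_one, iwasawaTransition,
      MonoidAlgebra.mapDomainRingHom_apply, MonoidAlgebra.mapDomain_single]
    rfl
  have := powerSeries_algHom_ext (k := k) (levelHom V) (T.comp (levelHom U))
    (by rw [levelHom_X]; exact one_add_single_gen_pow V hk) hX
  rw [this]
  rfl

/-- The remainder has degree less than `p ^ k`. Rewritten in powers of `1 + X`, its coefficients
become those of distinct elements of the quotient group, so they all vanish. -/
theorem dvd_of_levelHom_eq_zero {k : ℕ} (hk : orderOf (gen U) = p ^ k) {f : ℤ_[p]⟦X⟧}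
    (hf : levelHom U f = 0) : ((1 + X) ^ p ^ k - 1 : ℤ_[p]⟦X⟧) ∣ f := by
  obtain ⟨g, r, hr, rfl⟩ := exists_powerSeries_eq_mul_add k f
  suffices r = 0 by simp [this]
  rw [levelHom_mul_add U hk] at hf
  set s := r.comp (Polynomial.X - 1) with hs
  have hrs : r = s.comp (Polynomial.X + 1) := by
    rw [hs, Polynomial.comp_assoc]; simp
  have hdeg : s.natDegree < p ^ k := by
    have h1 : s.natDegree ≤ r.natDegree := by
      rw [hs]
      refine Polynomial.natDegree_comp_le.trans ?_
      rw [← Polynomial.C_1, Polynomial.natDegree_X_sub_C, mul_one]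
    have h2 : r.natDegree < p ^ k :=
by
      by_cases h0 : r = 0
      · rw [h0, Polynomial.natDegree_zero]
        exact pow_pos (Fact.out : p.Prime).pos k
      · exact (Polynomial.natDegree_lt_iff_degree_lt h0).mpr (by exact_mod_cast hr)
    omega
  have hcoeff : ∀ i < p ^ k, s.coeff i = 0 := by
    intro i hi
    have h1 := congrArg (fun z => z.coeff (gen U ^ i)) hf
    rw [Polynomial.aeval_eq_sum_range' hdeg, MonoidAlgebra.coeff_sum, Finsupp.finsetSum_apply,
      Finset.sum_eq_single i] at h1
    · rw [MonoidAlgebra.single_pow, one_pow, MonoidAlgebra.coeff_smul_apply,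
        MonoidAlgebra.coeff_single, Finsupp.single_eq_same, smul_eq_mul, mul_one] at h1
      exact h1
    · intro j hj hji
      rw [MonoidAlgebra.single_pow, one_pow, MonoidAlgebra.coeff_smul_apply,
        MonoidAlgebra.coeff_single, Finsupp.single_eq_of_ne, smul_zero]
      intro h2
      apply hji
      have := pow_injOn_Iio_orderOf (x := gen U) (by simpa [hk] using hi)
        (by simpa [hk] using hj) h2
      exact this.symm
    · intro h2
      exact absurd (Finset.mem_range.mpr hi) h2
  have : s = 0 := by
    ext i
    by_cases hi : i < p ^ k
    · rw [hcoeff i hi, Polynomial.coeff_zero]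
    · rw [Polynomial.coeff_eq_zero_of_natDegree_lt (by omega), Polynomial.coeff_zero]
  rw [hrs, this, Polynomial.zero_comp]

theorem levelHom_surjective : Function.Surjective (levelHom U) := by
  intro x
  obtain ⟨k, hk⟩ := exists_orderOf_gen U
  induction x using MonoidAlgebra.induction_linear with
  | zero => exact ⟨0, map_zero _⟩
  | add x y hx hy =>
    obtain ⟨f, rfl⟩ := hx
    obtain ⟨g, rfl⟩ := hy
    exact ⟨f + g, map_add _ _ _⟩
  | single g r =>
    obtain ⟨i, rfl⟩ := exists_gen_pow_eq U g
    refine ⟨r • (1 + X) ^ i, ?_⟩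
    rw [map_smul, map_pow, map_add, map_one, levelHom_X, add_sub_cancel, MonoidAlgebra.single_pow,
      one_pow, MonoidAlgebra.smul_single, smul_eq_mul, mul_one]

/-- The homomorphism `ℤ_p⟦X⟧ → ℤ_p[[ℤ_p]]` which maps `1 + X` to the generator of `ℤ_p`. -/
def powerSeriesHom (p : ℕ) [Fact p.Prime] :
    ℤ_[p]⟦X⟧ →+* IwasawaAlgebra p (Multiplicative ℤ_[p]) where
  toFun f := ⟨fun U => levelHom U f, fun _ _ h => levelHom_compat h f⟩
  map_one' := ext fun U => map_one (levelHom U)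
  map_mul' f g := ext fun U => map_mul (levelHom U) f g
  map_zero' := ext fun U => map_zero (levelHom U)
  map_add' f g := ext fun U => map_add (levelHom U) f g

theorem component_powerSeriesHom (f : ℤ_[p]⟦X⟧) :
    component U (powerSeriesHom p f) = levelHom U f := rfl

theorem powerSeriesHom_injective : Function.Injective (powerSeriesHom p) := by
  rw [injective_iff_map_eq_zero]
  intro f hf
  refine powerSeries_eq_zero_of_forall_dvd f fun n => ?_
  obtain ⟨k, hk⟩ := exists_orderOf_gen (openPow p n)
  refine ⟨k, le_of_orderOf_gen_openPow hk, dvd_of_levelHom_eq_zero _ hk ?_⟩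
  rw [← component_powerSeriesHom, hf, map_zero]

/-- At each finite level the solutions form a nonempty coset of a principal ideal, which is compact
because `ℤ_p⟦X⟧` is. The system is directed, so the solution sets have a common point. -/
theorem powerSeriesHom_surjective : Function.Surjective (powerSeriesHom p) := by
  intro x
  let _ : TopologicalSpace ℤ_[p]⟦X⟧ := PowerSeries.WithPiTopology.instTopologicalSpace ℤ_[p]
  have : CompactSpace ℤ_[p]⟦X⟧ := inferInstanceAs (CompactSpace ((Unit →₀ ℕ) → ℤ_[p]))
  have : T2Space ℤ_[p]⟦X⟧ := PowerSeries.WithPiTopology.instT2Space ℤ_[p]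
  have : IsTopologicalRing ℤ_[p]⟦X⟧ := PowerSeries.WithPiTopology.instIsTopologicalRing ℤ_[p]
  let F (U : OpenNormalSubgroup (Multiplicative ℤ_[p])) : Set ℤ_[p]⟦X⟧ :=
    {f | levelHom U f = component U x}
  have hclosed (U) : IsCompact (F U) := by
    obtain ⟨k, hk⟩ := exists_orderOf_gen U
    obtain ⟨f, hf⟩ := levelHom_surjective U (component U x)
    have h1 : F U = Set.range fun g => ((1 + X) ^ p ^ k - 1) * g + f := by
      ext h
      constructor
      · intro hh
        obtain ⟨g, hg⟩ := dvd_of_levelHom_eq_zero U hk (f := h - f) (by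
          rw [map_sub, hf, sub_eq_zero]; exact hh)
        exact ⟨g, by dsimp only; rw [← hg, sub_add_cancel]⟩
      · rintro ⟨g, rfl⟩
        change levelHom U _ = _
        have := levelHom_mul_add U hk g 0
        rw [Polynomial.coe_zero, add_zero, Polynomial.zero_comp, map_zero] at this
        rw [map_add, this, zero_add, hf]
    rw [h1]
    exact isCompact_range (by fun_prop)
  have hdir : Directed (· ⊇ ·) F := by
    intro U V
    refine ⟨U ⊓ V, ?_, ?_⟩
    · intro f hf
      change levelHom U f = _
      rw [← levelHom_compat (inf_le_left : U ⊓ V ≤ U), show levelHom (U ⊓ V) f = _ from hf,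
        transition_component]
    · intro f hf
      change levelHom V f = _
      rw [← levelHom_compat (inf_le_right : U ⊓ V ≤ V), show levelHom (U ⊓ V) f = _ from hf,
        transition_component]
  have : Nonempty (OpenNormalSubgroup (Multiplicative ℤ_[p])) := ⟨openPow p 0⟩
  obtain ⟨f, hf⟩ := IsCompact.nonempty_iInter_of_directed_nonempty_isCompact_isClosed F hdir
    (fun U => levelHom_surjective U _) hclosed fun U => (hclosed U).isClosed
  exact ⟨f, ext fun U => Set.mem_iInter.mp hf U⟩

/-- The isomorphism between `ℤ_p⟦X⟧` and the Iwasawa algebra of `ℤ_p`. -/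
def powerSeriesEquiv (p : ℕ) [Fact p.Prime] :
    ℤ_[p]⟦X⟧ ≃+* IwasawaAlgebra p (Multiplicative ℤ_[p]) :=
  RingEquiv.ofBijective (powerSeriesHom p) ⟨powerSeriesHom_injective, powerSeriesHom_surjective⟩

instance : IsDomain (IwasawaAlgebra p (Multiplicative ℤ_[p])) :=
  (powerSeriesEquiv p).symm.toMulEquiv.isDomain _

instance : IsIntegrallyClosed (IwasawaAlgebra p (Multiplicative ℤ_[p])) :=
  IsIntegrallyClosed.of_equiv (powerSeriesEquiv p)

end

/-! ### `Λ(G)` as a twisted group ring over `Λ(Γ₀)` -/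

section

open IwasawaAlgebra

variable {p : ℕ} [Fact p.Prime] {Γ G : Type*} [Group Γ] [TopologicalSpace Γ] [Group G]
  [TopologicalSpace G]

theorem isCentralOpen_subtype {Γ₀ : Subgroup G} (hopen : IsOpen (Γ₀ : Set G))
    (hcen : Γ₀ ≤ Subgroup.center G) : IsCentralOpen Γ₀.subtype where
  continuous := continuous_subtype_val
  injective := Subtype.val_injective
  isOpenMap := hopen.isOpenMap_subtype_val
  central x g := Subgroup.mem_center_iff.mp (hcen x.2) g

/-- Topologically isomorphic groups have isomorphic Iwasawa algebras. -/
def iwasawaCongr (p : ℕ) [Fact p.Prime] (e : Γ ≃ₜ* G) : IwasawaAlgebra p Γ ≃+* IwasawaAlgebra p G :=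
  RingEquiv.ofRingHom (iwasawaMap p (e : Γ →* G) e.continuous)
    (iwasawaMap p (e.symm : G →* Γ) e.symm.continuous)
    (RingHom.ext fun x => by
      have hc : Continuous ((e : Γ →* G).comp (e.symm : G →* Γ)) :=
        e.continuous.comp e.symm.continuous
      refine (map_comp _ _ _ _ hc x).symm.trans ?_
      have h : (e : Γ →* G).comp (e.symm : G →* Γ) = MonoidHom.id G := by ext; simp
      simp only [h]
      exact map_id continuous_id x)
    (RingHom.ext fun x => by
      have hc : Continuous ((e.symm : G →* Γ).comp (e : Γ →* G)) :=
        e.symm.continuous.comp e.continuous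
      refine (map_comp _ _ _ _ hc x).symm.trans ?_
      have h : (e.symm : G →* Γ).comp (e : Γ →* G) = MonoidHom.id Γ := by ext; simp
      simp only [h]
      exact map_id continuous_id x)

namespace IsCentralOpen

variable {φ : Γ →* G} (h : IsCentralOpen φ)

theorem map_mem_center (a : IwasawaAlgebra p Γ) :
    iwasawaMap p φ h.continuous a ∈ Subring.center (IwasawaAlgebra p G) := by
  rw [Subring.mem_center_iff]
  intro x
  refine h.ext_image fun V => ?_
  rw [map_mul, map_mul, h.map_component_image]
  generalize component (h.image V) x = y
  generalize component V a = b
  induction b using MonoidAlgebra.induction_linear with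
  | zero => simp
  | add b b' h1 h2 => rw [map_add, mul_add, add_mul, h1, h2]
  | single k r =>
    induction y using MonoidAlgebra.induction_linear with
    | zero => simp
    | add y y' h1 h2 => rw [mul_add, add_mul, h1, h2]
    | single g s =>
      obtain ⟨k, rfl⟩ := QuotientGroup.mk_surjective k
      obtain ⟨g, rfl⟩ := QuotientGroup.mk_surjective g
      rw [MonoidAlgebra.mapDomainRingHom_apply, MonoidAlgebra.mapDomain_single,
        MonoidAlgebra.single_mul_single, MonoidAlgebra.single_mul_single, mul_comm s]
      congr 1
      exact congrArg QuotientGroup.mk (h.central k g)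

/-- If `θ` is injective and becomes a central open embedding on an open central subgroup, then
`Λ(θ)` is injective. -/
theorem map_injective_of_comp {H : Type*} [Group H] [TopologicalSpace H] {δ : Γ →* G}
    (hδ : IsCentralOpen δ) {θ : G →* H} (hθ : Continuous θ) (hinj : Function.Injective θ)
    (hc : IsCentralOpen (θ.comp δ)) : Function.Injective (iwasawaMap p θ hθ) := by
  rw [injective_iff_map_eq_zero]
  intro x hx
  refine hδ.ext_image fun V => ?_
  have h1 := congrArg (component (hc.image V)) hx
  rw [map_component_of_le θ hθ (V := openNormalComap θ hθ (hc.image V)) x le_rfl, map_zero,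
    MonoidAlgebra.mapDomainRingHom_apply] at h1
  have hq : Function.Injective (QuotientGroup.map (openNormalComap θ hθ (hc.image V)).toSubgroup
      (hc.image V).toSubgroup θ le_rfl) := by
    rw [injective_iff_map_eq_one]
    intro y hy
    obtain ⟨y, rfl⟩ := QuotientGroup.mk_surjective y
    exact (QuotientGroup.eq_one_iff y).mpr ((QuotientGroup.eq_one_iff (θ y)).mp hy)
  have h2 : component (openNormalComap θ hθ (hc.image V)) x = 0 := by
    apply MonoidAlgebra.mapDomain_injective hq
    rw [h1, MonoidAlgebra.mapDomain_zero]
  have hle : openNormalComap θ hθ (hc.image V) ≤ hδ.image V := by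
    rintro y ⟨v, hv, hvy⟩
    exact ⟨v, hv, hinj hvy⟩
  rw [← transition_component x hle, h2, map_zero, map_zero]

end IsCentralOpen

section base

variable {Γ₀ : Subgroup G} (h : IsCentralOpen Γ₀.subtype)

/-- `Λ(Γ₀)` is isomorphic to its image in `Λ(G)`. -/
def baseEquiv (p : ℕ) [Fact p.Prime] : IwasawaAlgebra p Γ₀ ≃+* iwasawaBase p Γ₀ :=
  RingEquiv.ofBijective
    ({ toFun := fun a => ⟨⟨iwasawaMap p Γ₀.subtype continuous_subtype_val a,
          h.map_mem_center a⟩, ⟨a, rfl⟩⟩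
       map_one' := Subtype.ext (Subtype.ext (map_one _))
       map_mul' := fun a b => Subtype.ext (Subtype.ext (map_mul _ a b))
       map_zero' := Subtype.ext (Subtype.ext (map_zero _))
       map_add' := fun a b => Subtype.ext (Subtype.ext (map_add _ a b)) } :
      IwasawaAlgebra p Γ₀ →+* iwasawaBase p Γ₀)
    ⟨fun a b hab => h.map_injective (congrArg (fun z => (z.1 : IwasawaAlgebra p G)) hab),
      fun r => by
        obtain ⟨a, ha⟩ := r.2
        exact ⟨a, Subtype.ext (Subtype.ext ha)⟩⟩

theorem algebraMap_baseEquiv (a : IwasawaAlgebra p Γ₀) :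
    algebraMap (iwasawaBase p Γ₀) (IwasawaAlgebra p G) (baseEquiv h p a) =
      iwasawaMap p Γ₀.subtype continuous_subtype_val a := rfl

theorem map_baseEquiv_symm (r : iwasawaBase p Γ₀) :
    iwasawaMap p Γ₀.subtype continuous_subtype_val ((baseEquiv h p).symm r) =
      algebraMap (iwasawaBase p Γ₀) (IwasawaAlgebra p G) r := by
  rw [← algebraMap_baseEquiv h, RingEquiv.apply_symm_apply]

/-- The Iwasawa algebra as a twisted group ring over the Iwasawa algebra of an open central
subgroup. -/
def iwasawaTwistedGroupRing (p : ℕ) [Fact p.Prime] (hfin : Γ₀.FiniteIndex) :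
    TwistedGroupRing (iwasawaBase p Γ₀) (IwasawaAlgebra p G) G where
  of := ofHom p G
  Z := Γ₀
  le_center x hx := Subgroup.mem_center_iff.mpr fun g => h.central ⟨x, hx⟩ g
  finiteIndex := hfin
  t :=
    { toFun := fun x => baseEquiv h p (h.proj p x)
      map_add' := fun x y => by rw [map_add, map_add]
      map_smul' := fun r x => by
        rw [Algebra.smul_def, ← map_baseEquiv_symm h, h.proj_map_mul, map_mul,
          RingEquiv.apply_symm_apply]
        rfl }
  t_one := by
    change baseEquiv h p (h.proj p 1) = 1
    rw [h.proj_one, map_one]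
  t_of g hg := by
    change baseEquiv h p (h.proj p (ofHom p G g)) = 0
    rw [h.proj_ofHom_of_notMem (by rwa [Subgroup.range_subtype]), map_zero]
  of_mem g hg := ⟨baseEquiv h p (ofHom p Γ₀ ⟨g, hg⟩),
    (map_ofHom Γ₀.subtype continuous_subtype_val (⟨g, hg⟩ : Γ₀)).symm⟩
  span := by
    have : Finite (G ⧸ Γ₀.subtype.range) := by
      rw [Subgroup.range_subtype]
      infer_instance
    have := Fintype.ofFinite (G ⧸ Γ₀.subtype.range)
    rw [eq_top_iff]
    intro x _
    rw [h.sum_map_proj_mul_ofHom x]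
    refine Submodule.sum_mem _ fun q _ => ?_
    rw [← algebraMap_baseEquiv h, ← Algebra.smul_def]
    exact Submodule.smul_mem _ _ (Submodule.subset_span ⟨_, rfl⟩)

/-- An abelian subgroup `P ⊇ Γ₀` gives rise to a commutative subring of `Λ(G)`. -/
theorem exists_commSubring (hfin : Γ₀.FiniteIndex) {P : Subgroup G} (hP : Γ₀ ≤ P)
    {A : Type} [CommGroup A] [TopologicalSpace A] (ψ : A ≃ₜ* P) :
    ∃ (_ : Algebra (iwasawaBase p Γ₀) (IwasawaAlgebra p A))
      (_ : (iwasawaTwistedGroupRing h p hfin).CommSubring (IwasawaAlgebra p A) P),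
      Function.Injective (algebraMap (iwasawaBase p Γ₀) (IwasawaAlgebra p A)) := by
  -- `A` stands for `P`, and `δ`, `θ` are the inclusions of `Γ₀` in `P` and of `P` in `G`.
  let δ : Γ₀ →* A := (ψ.symm : P →* A).comp (Subgroup.inclusion hP)
  let θ : A →* G := P.subtype.comp (ψ : A →* P)
  have hθ : Continuous θ := continuous_subtype_val.comp ψ.continuous
  have hδθ : θ.comp δ = Γ₀.subtype := by
    ext x
    change ((ψ (ψ.symm (Subgroup.inclusion hP x)) : P) : G) = x
    rw [ContinuousMulEquiv.apply_symm_apply]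
    rfl
  have hδ : IsCentralOpen δ :=
    { continuous := ψ.symm.continuous.comp (continuous_inclusion hP)
      injective := ψ.symm.injective.comp (Subgroup.inclusion_injective hP)
      isOpenMap := by
        refine ψ.symm.isOpenMap.comp ?_
        intro U hU
        have : Subgroup.inclusion hP '' U = ((↑) : P → G) ⁻¹' (Γ₀.subtype '' U) := by
          ext x
          constructor
          · rintro ⟨y, hy, rfl⟩
            exact ⟨y, hy, rfl⟩
          · rintro ⟨y, hy, hyx⟩
            exact ⟨y, hy, Subtype.ext hyx⟩
        rw [this]
        exact (h.isOpenMap U hU).preimage continuous_subtype_val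
      central := fun x g => mul_comm _ _ }
  let α : iwasawaBase p Γ₀ →+* IwasawaAlgebra p A :=
    (iwasawaMap p δ hδ.continuous).comp (baseEquiv h p).symm.toRingHom
  let _ : Algebra (iwasawaBase p Γ₀) (IwasawaAlgebra p A) := α.toAlgebra
  have hθδ (a : IwasawaAlgebra p Γ₀) : iwasawaMap p θ hθ (iwasawaMap p δ hδ.continuous a) =
      iwasawaMap p Γ₀.subtype continuous_subtype_val a := by
    have hc : Continuous (θ.comp δ) := hθ.comp hδ.continuous
    rw [← map_comp δ hδ.continuous θ hθ hc]
    simp only [hδθ]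
  let ι : IwasawaAlgebra p A →ₐ[iwasawaBase p Γ₀] IwasawaAlgebra p G :=
    { iwasawaMap p θ hθ with
      commutes' := fun r => (hθδ _).trans (map_baseEquiv_symm h r) }
  refine ⟨inferInstance, ⟨ι, ?_, hP, ?_, ?_⟩, ?_⟩
  · refine hδ.map_injective_of_comp hθ (Subtype.val_injective.comp ψ.injective) ?_
    rw [hδθ]
    exact h
  · intro d
    have : Finite (A ⧸ δ.range) := by
      have h1 : δ.range = (Γ₀.subgroupOf P).comap (ψ : A →* P) := by
        ext a
        constructor
        · rintro ⟨x, rfl⟩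
          change (θ (δ x)) ∈ Γ₀
          rw [← MonoidHom.comp_apply, hδθ]
          exact x.2
        · intro ha
          refine ⟨⟨_, ha⟩, ?_⟩
          change ψ.symm (ψ a) = a
          exact ContinuousMulEquiv.symm_apply_apply ψ a
      rw [h1]
      have : (Γ₀.subgroupOf P).FiniteIndex := inferInstance
      have : ((Γ₀.subgroupOf P).comap (ψ : A →* P)).FiniteIndex := ⟨by
        rw [Subgroup.index_comap_of_surjective _ ψ.surjective]
        exact Subgroup.FiniteIndex.index_ne_zero⟩
      infer_instance
    have := Fintype.ofFinite (A ⧸ δ.range)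
    rw [hδ.sum_map_proj_mul_ofHom d, map_sum]
    refine Submodule.sum_mem _ fun q _ => ?_
    have h2 : ι (iwasawaMap p δ hδ.continuous (hδ.proj p (d * ofHom p A q.out⁻¹)) *
        ofHom p A q.out) = baseEquiv h p (hδ.proj p (d * ofHom p A q.out⁻¹)) •
        ofHom p G (θ q.out) := by
      rw [map_mul, Algebra.smul_def, algebraMap_baseEquiv, ← hθδ]
      congr 1
      exact map_ofHom θ hθ _
    rw [h2]
    exact Submodule.smul_mem _ _ (Submodule.subset_span ⟨_, (ψ q.out).2, rfl⟩)
  · intro g hg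
    refine ⟨ofHom p A (ψ.symm ⟨g, hg⟩), (map_ofHom θ hθ _).trans ?_⟩
    change ofHom p G (ψ (ψ.symm ⟨g, hg⟩) : P) = ofHom p G g
    rw [ContinuousMulEquiv.apply_symm_apply]
  · exact hδ.map_injective.comp (baseEquiv h p).symm.injective

end base

end

/-! ### Denominators in the total ring of fractions -/

section

variable {Λ : Type*} [Ring Λ]

theorem exists_smul_eq_toTotalFractions (a : TotalFractions Λ) :
    ∃ s ∈ centralRegular Λ, ∃ x, s • a = toTotalFractions Λ x := by
  induction a using LocalizedModule.induction_on with
  | h x s =>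
    refine ⟨s, s.2, x, ?_⟩
    change (s : Subring.center Λ) • LocalizedModule.mk (S := centralRegular Λ) x s =
      LocalizedModule.mk x 1
    rw [LocalizedModule.smul'_mk, LocalizedModule.mk_eq]
    exact ⟨1, by simp [Submonoid.smul_def]⟩

theorem toTotalFractions_injective : Function.Injective (toTotalFractions Λ) := by
  intro x y h
  have h : LocalizedModule.mk (S := centralRegular Λ) x 1 = LocalizedModule.mk y 1 := h
  obtain ⟨u, hu⟩ := LocalizedModule.mk_eq.mp h
  rw [one_smul, one_smul] at hu
  have hreg : ((u : Subring.center Λ) : Λ) ∈ nonZeroDivisors Λ := u.2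
  have hu : (u : Λ) * x = u * y := hu
  rw [← sub_eq_zero, ← mul_sub] at hu
  rw [← sub_eq_zero]
  exact hreg.1 _ hu

theorem totalFractions_smul_eq_zero {s : Subring.center Λ} (hs : s ∈ centralRegular Λ)
    {a : TotalFractions Λ} (h : s • a = 0) : a = 0 := by
  induction a using LocalizedModule.induction_on with
  | h x t =>
    have h : s • LocalizedModule.mk (S := centralRegular Λ) x t = LocalizedModule.mk 0 1 :=
      h.trans (LocalizedModule.zero_mk 1).symm
    rw [LocalizedModule.smul'_mk, LocalizedModule.mk_eq] at h
    obtain ⟨u, hu⟩ := h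
    rw [one_smul, smul_zero, smul_zero] at hu
    have hu : (u : Λ) * (s * x) = 0 := hu
    have hx : x = 0 := hs.1 _ (u.2.1 _ hu)
    rw [hx]
    exact LocalizedModule.zero_mk t

variable {G : Type*} [Group G] {R : Subring (Subring.center Λ)}

/-- The canonical map to the total ring of fractions, as an `R`-algebra homomorphism. -/
def fractionsHom (R : Subring (Subring.center Λ)) : Λ →ₐ[R] TotalFractions Λ :=
  (toTotalFractions Λ).restrictScalars R

theorem cut_fractionsHom (e : TotalFractions Λ) :
    TwistedGroupRing.cut (fractionsHom R) e = totalFractionsCut R e := rfl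

namespace TwistedGroupRing

variable [IsDomain R] (S : TwistedGroupRing R Λ G)

include S

theorem mem_centralRegular {r : R} (hr : r ≠ 0) : (r : Subring.center Λ) ∈ centralRegular Λ := by
  have h1 : ∀ x : Λ, ((r : Subring.center Λ) : Λ) * x = 0 → x = 0 := fun x hx =>
    S.smul_eq_zero hr (y := x) (by rw [Algebra.smul_def]; exact hx)
  refine ⟨h1, fun x hx => h1 x ?_⟩
  rw [← hx]
  exact ((Subring.mem_center_iff.mp (r : Subring.center Λ).2) x).symm

theorem totalFractions_smul_eq_zero {r : R} (hr : r ≠ 0) (a : TotalFractions Λ) (h : r • a = 0) :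
    a = 0 :=
  _root_.totalFractions_smul_eq_zero (S.mem_centralRegular hr) h

/-- Denominators can be moved into `R`: as `Λ` is finite over `R`, a regular central element is
integral over `R` and hence divides a nonzero element of `R`. -/
theorem exists_smul_eq_fractionsHom (a : TotalFractions Λ) :
    ∃ r : R, r ≠ 0 ∧ ∃ x, r • a = fractionsHom R x := by
  obtain ⟨s, hs, x, hx⟩ := exists_smul_eq_toTotalFractions a
  have := S.finite
  let v : Subring.center Λ →ₐ[R] Λ :=
    { (Subring.center Λ).subtype with commutes' := fun _ => rfl }
  have hint : IsIntegral R s :=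
    (isIntegral_algHom_iff v Subtype.val_injective).mp (IsIntegral.of_finite R (v s))
  have hs' : s ∈ nonZeroDivisors (Subring.center Λ) := by
    rw [mem_nonZeroDivisors_iff_right]
    intro y hy
    refine Subtype.ext (hs.2 _ ?_)
    exact congrArg Subtype.val hy
  obtain ⟨r, hr, z, hz⟩ := hint.isAlgebraic.exists_nonzero_dvd hs'
  refine ⟨r, hr, z * x, ?_⟩
  have h1 : r • a = (z * s) • a := by
    rw [mul_comm, ← hz]
    rfl
  rw [h1, mul_smul, hx, ← map_smul]
  rfl

end TwistedGroupRing

end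

/-! ### Maximality for Iwasawa algebras -/

section

open IwasawaAlgebra

variable {p : ℕ} [Fact p.Prime] {G : Type*} [Group G] [TopologicalSpace G] {Γ₀ : Subgroup G}

namespace IsCentralZp

variable (h : IsCentralZp p Γ₀)

include h

theorem isCentralOpen : IsCentralOpen Γ₀.subtype := isCentralOpen_subtype h.isOpen h.le_center

theorem exists_baseEquiv :
    Nonempty (PowerSeries ℤ_[p] ≃+* iwasawaBase p Γ₀) := by
  obtain ⟨e⟩ := h.equiv
  exact ⟨((powerSeriesEquiv p).trans (iwasawaCongr p e.symm)).trans (baseEquiv h.isCentralOpen p)⟩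

theorem isDomain : IsDomain (iwasawaBase p Γ₀) := by
  obtain ⟨e⟩ := h.exists_baseEquiv
  exact e.symm.toMulEquiv.isDomain _

theorem isUnit_natCast {n : ℕ} (hn : ¬ p ∣ n) : IsUnit (n : iwasawaBase p Γ₀) := by
  obtain ⟨e⟩ := h.exists_baseEquiv
  have := (isUnit_natCast_padicInt p hn).map (e.toRingHom.comp (PowerSeries.C (R := ℤ_[p])))
  rwa [map_natCast] at this

end IsCentralZp

theorem iwasawa_isHybrid_of_isCommutingCoprime (h : IsCentralZp p Γ₀) (hfin : Γ₀.FiniteIndex)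
    {N : Subgroup G} [Finite N] (hN : N.Normal) (hpN : ¬ p ∣ Nat.card N)
    (hcop : (iwasawaTwistedGroupRing h.isCentralOpen p hfin).IsCommutingCoprime N) :
    iwasawaIdem p N ∈ Set.range (toTotalFractions (IwasawaAlgebra p G)) ∧
    IsMaximalOrderIn (iwasawaBase p Γ₀) (1 - iwasawaIdem p N)
      (totalFractionsCut (iwasawaBase p Γ₀) (1 - iwasawaIdem p N)) := by
  have := h.isDomain
  have := Fintype.ofFinite N
  set S := iwasawaTwistedGroupRing h.isCentralOpen p hfin with hS
  obtain ⟨u, hu⟩ := h.isUnit_natCast hpN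
  let e : IwasawaAlgebra p G := (↑u⁻¹ : iwasawaBase p Γ₀) • ∑ᶠ n : N, S.of n
  have he : (Nat.card N : iwasawaBase p Γ₀) • e = ∑ᶠ n : N, S.of n := by
    rw [smul_smul, ← hu, Units.mul_inv, one_smul]
  have hje : fractionsHom (iwasawaBase p Γ₀) e = iwasawaIdem p N := by
    have h1 : (Nat.card N : TotalFractions (IwasawaAlgebra p G)) * fractionsHom (iwasawaBase p Γ₀) e =
        ∑ᶠ n : N, toTotalFractions (IwasawaAlgebra p G) (iwasawaOf p (n : G)) := by
      rw [← map_natCast (algebraMap (iwasawaBase p Γ₀) (TotalFractions (IwasawaAlgebra p G))),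
        ← Algebra.smul_def, ← map_smul, he, finsum_eq_sum_of_fintype, finsum_eq_sum_of_fintype,
        map_sum]
      rfl
    have h2 : IsUnit (Nat.card N : TotalFractions (IwasawaAlgebra p G)) := by
      have := (h.isUnit_natCast hpN).map
        (algebraMap (iwasawaBase p Γ₀) (TotalFractions (IwasawaAlgebra p G)))
      rwa [map_natCast] at this
    rw [iwasawaIdem, ← h1, Ring.inverse_mul_cancel_left _ _ h2]
  refine ⟨⟨e, hje⟩, ?_⟩
  have := TwistedGroupRing.isMaximalOrderIn_cut (fractionsHom (iwasawaBase p Γ₀))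
    toTotalFractions_injective hcop hN he (fun r hr a => S.totalFractions_smul_eq_zero hr a)
    S.exists_smul_eq_fractionsHom
  rw [hje, cut_fractionsHom] at this
  exact this

end

/-! ### Open subgroups isomorphic to `ℤ_p` in compact groups -/

section

variable {p : ℕ} [Fact p.Prime]

/-- The image of a compact group in `ℤ_p` is stable under multiplication by `ℤ_p`. -/
theorem exists_toAdd_eq_mul {P : Type*} [Group P] [TopologicalSpace P] [CompactSpace P]
    (f : P →* Multiplicative ℤ_[p]) (hf : Continuous f) (a : P) (c : ℤ_[p]) :
    ∃ b, (f b).toAdd = c * (f a).toAdd := by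
  have h1 : IsClosed {c : ℤ_[p] | Multiplicative.ofAdd (c * (f a).toAdd) ∈ Set.range f} :=
    (isCompact_range hf).isClosed.preimage (continuous_ofAdd.comp (by fun_prop))
  have h2 : Multiplicative.ofAdd (c * (f a).toAdd) ∈ Set.range f := by
    refine (PadicInt.denseRange_natCast (p := p)).induction_on
      (p := fun c => Multiplicative.ofAdd (c * (f a).toAdd) ∈ Set.range f) c h1 fun n => ⟨a ^ n, ?_⟩
    rw [map_pow, ← nsmul_eq_mul]
    rfl
  obtain ⟨b, hb⟩ := h2
  exact ⟨b, by rw [hb]; rfl⟩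

/-- A compact group which embeds into `ℤ_p` is trivial or isomorphic to `ℤ_p`. -/
theorem nonempty_continuousMulEquiv_padicInt {P : Type*} [Group P] [TopologicalSpace P]
    [CompactSpace P] [Nontrivial P] (f : P →* Multiplicative ℤ_[p]) (hf : Continuous f)
    (hinj : Function.Injective f) : Nonempty (P ≃ₜ* Multiplicative ℤ_[p]) := by
  -- The image is a nonzero ideal of the principal ideal domain `ℤ_p`; dividing by a generator makes
  -- the embedding onto.
  let I : Ideal ℤ_[p] :=
    { carrier := {x : ℤ_[p] | Multiplicative.ofAdd x ∈ Set.range f}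
      add_mem' := by
        rintro x y ⟨a, ha⟩ ⟨b, hb⟩
        exact ⟨a * b, by rw [map_mul, ha, hb]; rfl⟩
      zero_mem' := ⟨1, map_one f⟩
      smul_mem' := by
        rintro c x ⟨a, ha⟩
        obtain ⟨b, hb⟩ := exists_toAdd_eq_mul f hf a c
        exact ⟨b, by rw [← ofAdd_toAdd (f b), hb, ha]; rfl⟩ }
  have hI (x : P) : (f x).toAdd ∈ I := ⟨x, rfl⟩
  obtain ⟨a, ha⟩ := IsPrincipalIdealRing.principal I
  have ha0 : a ≠ 0 := by
    rintro rfl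
    obtain ⟨x, hx⟩ := exists_ne (1 : P)
    apply hx
    apply hinj
    have := hI x
    rw [ha, Ideal.submodule_span_eq, Ideal.span_singleton_zero, Ideal.mem_bot] at this
    rw [map_one]
    exact this
  have hg (x : P) : ∃ y, a * y = (f x).toAdd := by
    have := hI x
    rw [ha, Ideal.submodule_span_eq, Ideal.mem_span_singleton] at this
    obtain ⟨y, hy⟩ := this
    exact ⟨y, hy.symm⟩
  choose g hg using hg
  have hcont : Continuous g := by
    have h1 : Topology.IsClosedEmbedding fun y : ℤ_[p] => a * y :=
      Continuous.isClosedEmbedding (by fun_prop) (mul_right_injective₀ ha0)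
    rw [h1.continuous_iff]
    have : (fun y : ℤ_[p] => a * y) ∘ g = fun x => (f x).toAdd := funext hg
    rw [this]
    exact continuous_toAdd.comp hf
  let G : P →* Multiplicative ℤ_[p] :=
    { toFun := fun x => Multiplicative.ofAdd (g x)
      map_one' := by
        rw [ofAdd_eq_one]
        apply mul_left_cancel₀ ha0
        rw [hg, map_one, toAdd_one, mul_zero]
      map_mul' := fun x y => by
        rw [← ofAdd_add]
        congr 1
        apply mul_left_cancel₀ ha0
        rw [hg, map_mul, toAdd_mul, mul_add, hg, hg] }
  have hGinj : Function.Injective G := fun x y hxy => hinj <| by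
    apply Multiplicative.toAdd.injective
    rw [← hg, ← hg, show g x = g y from hxy]
  have hGsurj : Function.Surjective G := by
    intro y
    obtain ⟨x, hx⟩ : a * y.toAdd ∈ I := by
      rw [ha, Ideal.submodule_span_eq, Ideal.mem_span_singleton]
      exact dvd_mul_right _ _
    refine ⟨x, ?_⟩
    change Multiplicative.ofAdd (g x) = _
    rw [← ofAdd_toAdd y]
    congr 1
    apply mul_left_cancel₀ ha0
    rw [hg, hx]
    rfl
  let E : P ≃* Multiplicative ℤ_[p] := MulEquiv.ofBijective G ⟨hGinj, hGsurj⟩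
  have hE : Continuous E := continuous_ofAdd.comp hcont
  exact ⟨{ E with
    continuous_toFun := hE
    continuous_invFun := (Continuous.homeoOfEquivCompactToT2 (f := E.toEquiv) hE).symm.continuous }⟩

/-- A torsion-free group whose center has finite index is commutative. -/
theorem commute_of_finiteIndex_center {P : Type*} [Group P] [(Subgroup.center P).FiniteIndex]
    (htf : ∀ x : P, IsOfFinOrder x → x = 1) (x y : P) : x * y = y * x := by
  -- The transfer to the centre is the power map with exponent the index of the centre. It is a
  -- homomorphism to an abelian group, injective for lack of torsion.
  have hinj : Function.Injective (MonoidHom.transferCenterPow P) := by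
    rw [injective_iff_map_eq_one]
    intro x hx
    refine htf x (isOfFinOrder_iff_pow_eq_one.mpr ⟨(Subgroup.center P).index,
      Nat.pos_of_ne_zero Subgroup.FiniteIndex.index_ne_zero, ?_⟩)
    exact congrArg Subtype.val hx
  apply hinj
  rw [map_mul, map_mul]
  exact Subtype.ext (Subgroup.mem_center_iff.mp (MonoidHom.transferCenterPow P y).2 _)

/-- If no element of order `p` commutes with `n`, then the centralizer of `n` contains an open subgroup
isomorphic to `ℤ_p` of index prime to `p`. -/
theorem exists_open_padicInt {G : Type*} [Group G] [TopologicalSpace G] [IsTopologicalGroup G]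
    [CompactSpace G] {Γ₀ : Subgroup G} (h : IsCentralZp p Γ₀) (hfin : Γ₀.FiniteIndex) {n : G}
    (hn : ∀ g : G, orderOf g = p → g * n ≠ n * g) :
    ∃ P : Subgroup G, Γ₀ ≤ P ∧ (∀ g ∈ P, g * n = n * g) ∧
      ¬ p ∣ P.relIndex (Subgroup.centralizer {n}) ∧ Nonempty (Multiplicative ℤ_[p] ≃ₜ* P) := by
  have hp : p.Prime := Fact.out
  have hnormal : Γ₀.Normal := ⟨fun x hx g => by
    rwa [Subgroup.mem_center_iff.mp (h.le_center hx) g, mul_inv_cancel_right]⟩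
  have htf₀ : ∀ x ∈ Γ₀, IsOfFinOrder x → x = 1 := by
    intro x hx hfo
    obtain ⟨e⟩ := h.equiv
    obtain ⟨m, hm, hxm⟩ := isOfFinOrder_iff_pow_eq_one.mp hfo
    have h1 : e ⟨x, hx⟩ ^ m = 1 := by
      rw [← map_pow, ← map_one e]
      exact congrArg e (Subtype.ext hxm)
    have h2 : (m : ℤ_[p]) * (e ⟨x, hx⟩).toAdd = 0 := by
      rw [← nsmul_eq_mul]
      exact h1
    have h3 : e ⟨x, hx⟩ = 1 := (mul_eq_zero.mp h2).resolve_left (by exact_mod_cast hm.ne')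
    have h4 : (⟨x, hx⟩ : Γ₀) = 1 := e.injective (h3.trans (map_one e).symm)
    exact congrArg Subtype.val h4
  let π := QuotientGroup.mk' Γ₀
  have hker : π.ker = Γ₀ := QuotientGroup.ker_mk' Γ₀
  let C : Subgroup G := Subgroup.centralizer {n}
  have hΓC : Γ₀ ≤ C := fun x hx => Subgroup.mem_centralizer_singleton_iff.mpr
    (Subgroup.mem_center_iff.mp (h.le_center hx) n).symm
  -- `P` is the preimage of a Sylow `p`-subgroup of `C / Γ₀`, so its index in `C` is prime to `p`,
  -- and its torsion is `p`-power torsion since `Γ₀` is torsion-free. An element of order `p` in `P`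
  -- would commute with `n`, so `P` is torsion-free, hence abelian by
  -- `commute_of_finiteIndex_center`. A power map then embeds it in `Γ₀`.
  let S : Sylow p (C.map π) := default
  let P : Subgroup G := ((S : Subgroup (C.map π)).map (C.map π).subtype).comap π
  have hΓP : Γ₀ ≤ P := fun x hx => by
    refine ⟨1, one_mem _, ?_⟩
    exact ((QuotientGroup.eq_one_iff x).mpr hx).symm
  have hCC : (C.map π).comap π = C := Subgroup.comap_map_eq_self (by rw [hker]; exact hΓC)
  have hPC : P ≤ C := by
    rw [← hCC]
    exact Subgroup.comap_mono (Subgroup.map_subtype_le _)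
  have hcomm : ∀ g ∈ P, g * n = n * g := fun g hg =>
    Subgroup.mem_centralizer_singleton_iff.mp (hPC hg)
  have hpow : ∀ x ∈ P, ∃ k, x ^ p ^ k ∈ Γ₀ := by
    rintro x ⟨s, hs, hsx⟩
    obtain ⟨k, hk⟩ := S.isPGroup' ⟨s, hs⟩
    refine ⟨k, (QuotientGroup.eq_one_iff _).mp ?_⟩
    change π (x ^ p ^ k) = 1
    rw [map_pow, ← hsx, ← map_pow]
    have : s ^ p ^ k = 1 := congrArg Subtype.val hk
    rw [this, map_one]
  have htf : ∀ x ∈ P, IsOfFinOrder x → x = 1 := by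
    intro x hx hfo
    obtain ⟨k, hk⟩ := hpow x hx
    have h1 : x ^ p ^ k = 1 := htf₀ _ hk hfo.pow
    by_contra hx1
    obtain ⟨j, hj, hjx⟩ := (Nat.dvd_prime_pow hp).mp (orderOf_dvd_of_pow_eq_one h1)
    have hj0 : j ≠ 0 := by
      rintro rfl
      exact hx1 (orderOf_eq_one_iff.mp hjx)
    obtain ⟨i, rfl⟩ := Nat.exists_eq_succ_of_ne_zero hj0
    refine hn (x ^ p ^ i) ?_ (hcomm _ (P.pow_mem hx _))
    rw [orderOf_pow_of_dvd (pow_ne_zero _ hp.ne_zero) (by rw [hjx]; exact pow_dvd_pow p (by omega)), hjx, Nat.succ_eq_add_one,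
      pow_succ, Nat.mul_div_cancel_left _ (pow_pos hp.pos i)]
  have hPfin : (Γ₀.subgroupOf P).FiniteIndex := inferInstance
  have hcenP : Γ₀.subgroupOf P ≤ Subgroup.center P := by
    intro x hx
    exact Subgroup.mem_center_iff.mpr fun y =>
      Subtype.ext (Subgroup.mem_center_iff.mp (h.le_center hx) y)
  have hcenfin : (Subgroup.center P).FiniteIndex := Subgroup.finiteIndex_of_le hcenP
  have hab : ∀ x y : P, x * y = y * x := commute_of_finiteIndex_center fun x hx =>
    Subtype.ext (htf x x.2 (P.subtype.isOfFinOrder hx))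
  have hPopen : IsOpen (P : Set G) := Subgroup.isOpen_mono hΓP h.isOpen
  have : CompactSpace P := isCompact_iff_compactSpace.mp
    (Subgroup.isClosed_of_isOpen P hPopen).isCompact
  have hnorm : (Γ₀.subgroupOf P).Normal := inferInstance
  set m := (Γ₀.subgroupOf P).index with hm
  have hm0 : m ≠ 0 := Subgroup.FiniteIndex.index_ne_zero
  obtain ⟨e⟩ := h.equiv
  have hmem (x : P) : (x : G) ^ m ∈ Γ₀ := Subgroup.pow_index_mem (Γ₀.subgroupOf P) x
  let f₀ : P →* Γ₀ :=
    { toFun := fun x => ⟨(x : G) ^ m, hmem x⟩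
      map_one' := Subtype.ext (one_pow m)
      map_mul' := fun x y => Subtype.ext (Commute.mul_pow (congrArg Subtype.val (hab x y)) m) }
  have hf₀ : Continuous f₀ := Continuous.subtype_mk (by fun_prop) _
  have hinj₀ : Function.Injective f₀ := by
    rw [injective_iff_map_eq_one]
    intro x hx
    refine Subtype.ext (htf x x.2 (isOfFinOrder_iff_pow_eq_one.mpr ⟨m, Nat.pos_of_ne_zero hm0, ?_⟩))
    exact congrArg Subtype.val hx
  have : Nontrivial P := by
    have : Nontrivial Γ₀ := e.toEquiv.nontrivial
    exact (Subgroup.inclusion_injective hΓP).nontrivial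
  obtain ⟨ψ⟩ := nonempty_continuousMulEquiv_padicInt ((e : Γ₀ →* Multiplicative ℤ_[p]).comp f₀)
    (e.continuous.comp hf₀) (e.injective.comp hinj₀)
  refine ⟨P, hΓP, hcomm, ?_, ⟨ψ.symm⟩⟩
  have hidx : P.relIndex C = (S : Subgroup (C.map π)).index := by
    have h1 : P.relIndex ((C.map π).comap π) =
        ((S : Subgroup (C.map π)).map (C.map π).subtype).relIndex (C.map π) := by
      rw [Subgroup.relIndex_comap, Subgroup.map_comap_eq_self_of_surjective]
      exact QuotientGroup.mk'_surjective Γ₀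
    rw [hCC] at h1
    rw [h1, Subgroup.relIndex, Subgroup.subgroupOf, Subgroup.comap_map_eq_self_of_injective]
    exact Subtype.val_injective
  rw [hidx]
  exact S.not_dvd_index
end

/-! ### Hybrid Iwasawa algebras and the existence of `Γ₀` -/

section

variable {p : ℕ} [Fact p.Prime]

theorem isHybridIwasawaAlgebra_of_noCommuting {G : Type*} [Group G] [TopologicalSpace G]
    [IsTopologicalGroup G] [CompactSpace G] (hex : ∃ Γ₀ : Subgroup G, IsCentralZp p Γ₀)
    {N : Subgroup G} [Finite N] (hN : N.Normal) (hpN : ¬ p ∣ Nat.card N) (hcomm : NoCommuting p N) :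
    IsHybridIwasawaAlgebra p N := by
  have key (Γ₀ : Subgroup G) (h : IsCentralZp p Γ₀) :
      iwasawaIdem p N ∈ Set.range (toTotalFractions (IwasawaAlgebra p G)) ∧
      IsMaximalOrderIn (iwasawaBase p Γ₀) (1 - iwasawaIdem p N)
        (totalFractionsCut (iwasawaBase p Γ₀) (1 - iwasawaIdem p N)) := by
    have hfin : Γ₀.FiniteIndex := by
      have : Finite (G ⧸ Γ₀) := Subgroup.quotient_finite_of_isOpen Γ₀ h.isOpen
      exact Subgroup.finiteIndex_of_finite_quotient
    have := h.isDomain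
    refine iwasawa_isHybrid_of_isCommutingCoprime h hfin hN hpN ?_
    refine ⟨h.isUnit_natCast hpN, fun n hn hn1 => ?_⟩
    obtain ⟨P, hP, hPn, hidx, ⟨ψ⟩⟩ := exists_open_padicInt h hfin (n := n)
      fun g hg hgn => hn1 (hcomm g hg n hn hgn)
    obtain ⟨alg, C, hinj⟩ := exists_commSubring (p := p) h.isCentralOpen hfin hP ψ
    exact ⟨P, _, inferInstance, inferInstance, inferInstance, alg, C, hinj, hPn,
      h.isUnit_natCast hidx⟩
  obtain ⟨Γ₀, h₀⟩ := hex
  exact ⟨inferInstance, hN, ⟨Γ₀, h₀⟩, (key Γ₀ h₀).1, fun Γ₀ h => (key Γ₀ h).2⟩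

/-- A compact group with a continuous nontrivial homomorphism to `ℤ_p` with finite kernel has a central
open subgroup isomorphic to `ℤ_p`. -/
theorem exists_isCentralZp {G : Type*} [Group G] [TopologicalSpace G]
    [IsTopologicalGroup G] [CompactSpace G] [T2Space G] (κ : G →* Multiplicative ℤ_[p])
    (hκ : Continuous κ) [Finite κ.ker] (hne : ∃ g, κ g ≠ 1) : ∃ Γ₀ : Subgroup G, IsCentralZp p Γ₀ := by
  have htf {x : Multiplicative ℤ_[p]} {m : ℕ} (hm : m ≠ 0) (hx : x ^ m = 1) : x = 1 := by
    have h2 : (m : ℤ_[p]) * x.toAdd = 0 := by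
      rw [← nsmul_eq_mul]
      exact hx
    exact (mul_eq_zero.mp h2).resolve_left (by exact_mod_cast hm)
  set h := Nat.card κ.ker with hh
  have hh0 : h ≠ 0 := Nat.card_pos.ne'
  have hker : ∀ x ∈ κ.ker, x ^ h = 1 := fun x hx =>
    congrArg Subtype.val (pow_card_eq_one' (x := (⟨x, hx⟩ : κ.ker)))
  let C : Subgroup G := Subgroup.centralizer (κ.ker : Set G)
  have hCn : C.Normal := inferInstance
  have hCfin : C.FiniteIndex := by
    have : Finite (MulAut κ.ker) := inferInstance
    have h1 : (MulAut.conjNormal (H := κ.ker)).ker ≤ C := by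
      intro g hg
      rw [Subgroup.mem_centralizer_iff]
      intro x hx
      have h2 := congrArg (fun f : MulAut κ.ker => (f ⟨x, hx⟩ : G)) (MonoidHom.mem_ker.mp hg)
      rw [MulAut.conjNormal_apply] at h2
      exact (mul_inv_eq_iff_eq_mul.mp h2).symm
    have : (MulAut.conjNormal (H := κ.ker)).ker.FiniteIndex := inferInstance
    exact Subgroup.finiteIndex_of_le h1
  -- A conjugate of `x` is `x` times an element of the kernel, since `κ` has abelian target. That
  -- element commutes with `x` and is killed by `h`.
  have hcen : ∀ x ∈ C, x ^ h ∈ Subgroup.center G := by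
    intro x hx
    rw [Subgroup.mem_center_iff]
    intro g
    have h1 : x⁻¹ * (g * x * g⁻¹) ∈ κ.ker := by
      rw [MonoidHom.mem_ker]
      simp only [map_mul, map_inv]
      rw [mul_comm (κ g), mul_inv_cancel_right, inv_mul_cancel]
    have h2 : Commute x (x⁻¹ * (g * x * g⁻¹)) :=
      ((Subgroup.mem_centralizer_iff.mp hx) _ h1).symm
    have h3 : g * x * g⁻¹ = x * (x⁻¹ * (g * x * g⁻¹)) := by rw [mul_inv_cancel_left]
    have h4 : g * x ^ h * g⁻¹ = x ^ h := by
      rw [← conj_pow, h3, h2.mul_pow, hker _ h1, mul_one]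
    exact mul_inv_eq_iff_eq_mul.mp h4
  -- `Γ₀` consists of the `h`-th powers of central elements. It is compact, and `κ` is injective on
  -- it because `h` kills the kernel of `κ`.
  let f : Subgroup.center G →* G :=
    { toFun := fun z => (z : G) ^ h
      map_one' := one_pow h
      map_mul' := fun x y => Commute.mul_pow (Subgroup.mem_center_iff.mp y.2 x) h }
  have hf : Continuous f := by
    change Continuous fun z : Subgroup.center G => (z : G) ^ h
    fun_prop
  have hZclosed : IsClosed (Subgroup.center G : Set G) := by
    rw [← Subgroup.centralizer_univ]
    exact Set.isClosed_centralizer _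
  have : CompactSpace (Subgroup.center G) := isCompact_iff_compactSpace.mp hZclosed.isCompact
  let Γ₀ : Subgroup G := f.range
  have hΓcomp : IsCompact (Γ₀ : Set G) := isCompact_range hf
  have : CompactSpace Γ₀ := isCompact_iff_compactSpace.mp hΓcomp
  have hinj : Function.Injective (κ.comp Γ₀.subtype) := by
    rw [injective_iff_map_eq_one]
    rintro ⟨_, z, rfl⟩ hz
    have h1 : κ (z : G) ^ h = 1 := by
      rw [← map_pow]
      exact hz
    exact Subtype.ext (hker _ (htf hh0 h1))
  obtain ⟨y, hy⟩ := hne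
  have hyC : y ^ C.index ∈ C := Subgroup.pow_index_mem C y
  -- The exponent `C.index` moves `y` into `C`, one `h`-th power makes it central, and another puts
  -- it into `Γ₀`.
  let w : Γ₀ := ⟨f ⟨_, hcen _ hyC⟩, ⟨_, rfl⟩⟩
  have hw : κ w ≠ 1 := by
    intro h1
    change κ (((y ^ C.index) ^ h) ^ h) = 1 at h1
    rw [map_pow, map_pow, map_pow] at h1
    exact hy (htf Subgroup.FiniteIndex.index_ne_zero (htf hh0 (htf hh0 h1)))
  have : Nontrivial Γ₀ := ⟨⟨w, 1, fun h1 => hw (by rw [h1]; exact map_one κ)⟩⟩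
  obtain ⟨e⟩ := nonempty_continuousMulEquiv_padicInt (κ.comp Γ₀.subtype)
    (hκ.comp continuous_subtype_val) hinj
  refine ⟨Γ₀, ?_, ?_, ⟨e⟩⟩
  · let B : Subgroup (Multiplicative ℤ_[p]) := (κ.comp Γ₀.subtype).range
    have hBopen : IsOpen (B : Set (Multiplicative ℤ_[p])) := by
      obtain ⟨n, hn⟩ := PadicInt.ideal_eq_span_pow_p (p := p) (s := Ideal.span {(κ w).toAdd}) (by
        rwa [Ne, Ideal.span_singleton_eq_bot])
      refine Subgroup.isOpen_mono (H₁ := (PadicInt.openPow p n).toSubgroup) ?_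
        (PadicInt.openPow p n).toOpenSubgroup.isOpen
      intro x hx
      have hx : x.toAdd ∈ Ideal.span {(p : ℤ_[p]) ^ n} := hx
      rw [← hn, Ideal.mem_span_singleton'] at hx
      obtain ⟨c, hc⟩ := hx
      obtain ⟨b, hb⟩ := exists_toAdd_eq_mul (κ.comp Γ₀.subtype)
        (hκ.comp continuous_subtype_val) w c
      exact ⟨b, Multiplicative.toAdd.injective (hb.trans hc)⟩
    have hBfin : B.FiniteIndex := by
      have : Finite (Multiplicative ℤ_[p] ⧸ B) := Subgroup.quotient_finite_of_isOpen B hBopen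
      exact Subgroup.finiteIndex_of_finite_quotient
    have hΓn : Γ₀.Normal := ⟨by
      rintro _ ⟨z, rfl⟩ g
      have : f z ∈ Subgroup.center G := Subgroup.pow_mem _ z.2 h
      rw [Subgroup.mem_center_iff.mp this g, mul_inv_cancel_right]
      exact ⟨z, rfl⟩⟩
    -- `Γ₀ ⊔ κ.ker` has finite index as the preimage of `B`, and `Γ₀` has finite index in it because
    -- the kernel is finite. Being closed, `Γ₀` is then open.
    have hB : B.comap κ = Γ₀ ⊔ κ.ker := by
      rw [← Subgroup.comap_map_eq]
      congr 1
      change (κ.comp Γ₀.subtype).range = _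
      rw [MonoidHom.range_comp, Subgroup.range_subtype]
    have hfin : Γ₀.FiniteIndex := ⟨by
      rw [← Subgroup.relIndex_mul_index (le_sup_left : Γ₀ ≤ Γ₀ ⊔ κ.ker), ← hB,
        Subgroup.index_comap]
      refine mul_ne_zero ?_ ?_
      · rw [hB, Subgroup.relIndex_sup_left]
        exact Subgroup.FiniteIndex.index_ne_zero
      · exact Subgroup.FiniteIndex.index_ne_zero⟩
    exact Subgroup.isOpen_of_isClosed_of_finiteIndex Γ₀ hΓcomp.isClosed
  · rintro _ ⟨z, rfl⟩
    exact Subgroup.pow_mem _ z.2 h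

end

/-! ### The logarithm on `ℤ_pˣ` for odd `p` -/

section

open Filter Topology

variable (p : ℕ) [Fact p.Prime]

theorem PadicInt.tendsto_prime_pow : Tendsto ((p : ℤ_[p]) ^ ·) atTop (𝓝 0) :=
  tendsto_pow_atTop_nhds_zero_iff_norm_lt_one.mpr ((PadicInt.norm_lt_one_iff_dvd _).mpr dvd_rfl)

/-- The homomorphism `s ↦ (1 + p) ^ s`. -/
def onePlusPow : Multiplicative ℤ_[p] →* ℤ_[p] :=
  (PadicInt.addChar_of_value_at_one (p : ℤ_[p])
    (PadicInt.tendsto_prime_pow p)).toMonoidHom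

theorem continuous_onePlusPow : Continuous (onePlusPow p) :=
  PadicInt.continuous_addChar_of_value_at_one (PadicInt.tendsto_prime_pow p)

theorem onePlusPow_natCast (n : ℕ) :
    onePlusPow p (Multiplicative.ofAdd (n : ℤ_[p])) = (1 + p : ℤ_[p]) ^ n := by
  have : Multiplicative.ofAdd (n : ℤ_[p]) = Multiplicative.ofAdd (1 : ℤ_[p]) ^ n := by
    rw [← ofAdd_nsmul, nsmul_one]
  rw [this, map_pow]
  congr 1
  exact PadicInt.addChar_of_value_at_one_def (PadicInt.tendsto_prime_pow p)

theorem isClosed_ker_toZModPow (n : ℕ) :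
    IsClosed ((RingHom.ker (PadicInt.toZModPow (p := p) n) : Ideal ℤ_[p]) : Set ℤ_[p]) := by
  have : ((RingHom.ker (PadicInt.toZModPow (p := p) n) : Ideal ℤ_[p]) : Set ℤ_[p]) =
      {x | ‖x‖ ≤ (p : ℝ) ^ (-n : ℤ)} := by
    ext x
    rw [PadicInt.ker_toZModPow, SetLike.mem_coe, Set.mem_ofPred_eq,
      PadicInt.norm_le_pow_iff_mem_span_pow]
  rw [this]
  exact isClosed_le continuous_norm continuous_const

theorem one_add_prime_pow_eq_one (hp : p ≠ 2) (n : ℕ) :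
    (1 + p : ZMod (p ^ (n + 1))) ^ p ^ n = 1 := by
  conv_lhs => rw [← ZMod.orderOf_one_add_prime Fact.out hp n]
  exact pow_orderOf_eq_one _

theorem toZModPow_onePlusPow (hp : p ≠ 2) (n : ℕ) (t : ℤ_[p]) :
    PadicInt.toZModPow (n + 1) (onePlusPow p (Multiplicative.ofAdd ((p : ℤ_[p]) ^ n * t))) = 1 := by
  have hcl : IsClosed {t : ℤ_[p] | onePlusPow p (Multiplicative.ofAdd ((p : ℤ_[p]) ^ n * t)) - 1 ∈
      (RingHom.ker (PadicInt.toZModPow (p := p) (n + 1)) : Ideal ℤ_[p])} := by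
    refine (isClosed_ker_toZModPow p (n + 1)).preimage ?_
    exact ((continuous_onePlusPow p).comp
      (continuous_ofAdd.comp (continuous_const.mul continuous_id))).sub continuous_const
  have := PadicInt.denseRange_natCast.induction_on (p := fun t : ℤ_[p] =>
    onePlusPow p (Multiplicative.ofAdd ((p : ℤ_[p]) ^ n * t)) - 1 ∈
      (RingHom.ker (PadicInt.toZModPow (p := p) (n + 1)) : Ideal ℤ_[p])) t hcl (fun m => by
        have : (p : ℤ_[p]) ^ n * m = ((p ^ n * m : ℕ) : ℤ_[p]) := by push_cast; rfl
        rw [this, onePlusPow_natCast, RingHom.mem_ker, map_sub, map_pow, map_add, map_one,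
          map_natCast, pow_mul, one_add_prime_pow_eq_one p hp, one_pow, sub_self])
  rwa [RingHom.mem_ker, map_sub, map_one, sub_eq_zero] at this

/-- Modulo `p ^ (n + 1)` the order of `1 + p` is `p ^ n`, so `(1 + p) ^ s = 1` forces `p ^ n ∣ s`
for every `n`. -/
theorem injective_onePlusPow (hp : p ≠ 2) : Function.Injective (onePlusPow p) := by
  rw [injective_iff_map_eq_one]
  intro s hs
  refine Multiplicative.toAdd.injective ?_
  rw [toAdd_one]
  refine PadicInt.ext_of_toZModPow.mp fun n => ?_
  rw [map_zero]
  obtain ⟨t, ht⟩ : ∃ t, s.toAdd - s.toAdd.appr n = (p : ℤ_[p]) ^ n * t :=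
    Ideal.mem_span_singleton.mp (PadicInt.appr_spec n s.toAdd)
  have h1 := toZModPow_onePlusPow p hp n t
  have h2 : s = Multiplicative.ofAdd ((s.toAdd.appr n : ℕ) : ℤ_[p]) *
      Multiplicative.ofAdd ((p : ℤ_[p]) ^ n * t) := by
    rw [← ofAdd_add, ← ht, add_sub_cancel, ofAdd_toAdd]
  rw [h2, map_mul, onePlusPow_natCast] at hs
  have h3 := congrArg (PadicInt.toZModPow (p := p) (n + 1)) hs
  rw [map_mul, h1, mul_one, map_pow, map_add, map_one, map_natCast] at h3
  have h4 := orderOf_dvd_of_pow_eq_one h3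
  rw [ZMod.orderOf_one_add_prime Fact.out hp n] at h4
  have h5 : s.toAdd = (s.toAdd.appr n : ℤ_[p]) + (p : ℤ_[p]) ^ n * t := by
    rw [← ht, add_sub_cancel]
  rw [h5, map_add, map_mul, map_pow, map_natCast, map_natCast, ← Nat.cast_pow,
    ZMod.natCast_self, zero_mul, add_zero]
  exact (ZMod.natCast_eq_zero_iff _ _).mpr h4

/-- For odd `p` the unit group is cyclic, so it has at most `p ^ n` elements killed by `p ^ n`. The
powers of `1 + p` already give that many. -/
theorem exists_one_add_prime_pow_eq (hp : p ≠ 2) (n : ℕ) (u : (ZMod (p ^ (n + 1)))ˣ)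
    (hu : u ^ p ^ n = 1) : ∃ k : ℕ, (u : ZMod (p ^ (n + 1))) = (1 + p) ^ k := by
  have hpp : p.Prime := Fact.out
  have := ZMod.isCyclic_units_of_prime_pow p hpp hp (n + 1)
  have ha : IsUnit (1 + p : ZMod (p ^ (n + 1))) :=
    IsUnit.of_pow_eq_one (one_add_prime_pow_eq_one p hp n) (pow_ne_zero _ hpp.ne_zero)
  have ho : orderOf ha.unit = p ^ n := by
    rw [← orderOf_injective _ Units.coeHom_injective ha.unit, Units.coeHom_apply,
      IsUnit.unit_spec, ZMod.orderOf_one_add_prime hpp hp]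
  have hmem : u ∈ Subgroup.zpowers ha.unit := by
    have hsub : (Subgroup.zpowers ha.unit : Set (ZMod (p ^ (n + 1)))ˣ) ⊆
        {x | x ^ p ^ n = 1} := by
      rintro _ ⟨k, rfl⟩
      change (ha.unit ^ k) ^ p ^ n = 1
      rw [← zpow_natCast, zpow_comm, zpow_natCast, ← ho, pow_orderOf_eq_one, one_zpow]
    have hcard : Set.ncard {x : (ZMod (p ^ (n + 1)))ˣ | x ^ p ^ n = 1} ≤
        (Subgroup.zpowers ha.unit : Set (ZMod (p ^ (n + 1)))ˣ).ncard := by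
      classical
      have h1 : (Subgroup.zpowers ha.unit : Set (ZMod (p ^ (n + 1)))ˣ).ncard = p ^ n := by
        rw [← Nat.card_coe_set_eq]
        exact (Nat.card_zpowers _).trans ho
      rw [h1, Set.ncard_eq_toFinset_card', Set.toFinset_ofPred]
      exact IsCyclic.card_pow_eq_one_le (pow_pos hpp.pos _)
    have h := Set.eq_of_subset_of_ncard_le hsub hcard (Set.toFinite _)
    rw [← SetLike.mem_coe, h]
    exact hu
  obtain ⟨k, hk⟩ := mem_powers_iff_mem_zpowers.mpr hmem
  refine ⟨k, ?_⟩
  rw [← hk]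
  simp

/-- The image is compact, hence closed, so it is enough to approximate `u`. Modulo `p ^ (n + 1)` the
unit `u` is killed by `p ^ n`, hence is a power of `1 + p`. -/
theorem exists_onePlusPow_eq (hp : p ≠ 2) {u : ℤ_[p]} (hu : (p : ℤ_[p]) ∣ u - 1) :
    ∃ s, onePlusPow p s = u := by
  have hcl : IsClosed (Set.range (onePlusPow p)) :=
    (isCompact_range (continuous_onePlusPow p)).isClosed
  change u ∈ Set.range (onePlusPow p)
  rw [← hcl.closure_eq, Metric.mem_closure_iff]
  intro ε hε
  obtain ⟨n, hn⟩ := PadicInt.exists_pow_neg_lt p hε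
  have h1 := dvd_sub_pow_of_dvd_sub hu n
  rw [one_pow] at h1
  have h2 : (PadicInt.toZModPow (p := p) (n + 1) u) ^ p ^ n = 1 := by
    rw [← map_pow, ← sub_eq_zero, ← map_one (PadicInt.toZModPow (p := p) (n + 1)), ← map_sub,
      ← RingHom.mem_ker, PadicInt.ker_toZModPow]
    exact Ideal.mem_span_singleton.mpr h1
  have h3 : IsUnit (PadicInt.toZModPow (p := p) (n + 1) u) :=
    IsUnit.of_pow_eq_one h2 (pow_ne_zero _ (Fact.out : p.Prime).ne_zero)
  obtain ⟨k, hk⟩ := exists_one_add_prime_pow_eq p hp n h3.unit (by ext; simpa using h2)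
  refine ⟨_, ⟨Multiplicative.ofAdd (k : ℤ_[p]), rfl⟩, ?_⟩
  rw [onePlusPow_natCast, dist_eq_norm]
  refine lt_of_le_of_lt ?_ hn
  rw [PadicInt.norm_le_pow_iff_mem_span_pow]
  refine Ideal.span_singleton_le_span_singleton.mpr (pow_dvd_pow _ n.le_succ) ?_
  rw [← PadicInt.ker_toZModPow, RingHom.mem_ker, map_sub, sub_eq_zero, map_pow, map_add, map_one,
    map_natCast]
  simpa using hk

theorem PadicInt.prime_dvd_unit_pow_sub_one (u : ℤ_[p]ˣ) :
    (p : ℤ_[p]) ∣ (u : ℤ_[p]) ^ (p - 1) - 1 := by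
  rw [← Ideal.mem_span_singleton, ← PadicInt.maximalIdeal_eq_span_p, ← PadicInt.ker_toZMod,
    RingHom.mem_ker, map_sub, map_pow, map_one, sub_eq_zero]
  exact ZMod.pow_card_sub_one_eq_one (u.isUnit.map PadicInt.toZMod).ne_zero

/-- For odd `p` there is a continuous homomorphism `ℤ_pˣ → ℤ_p` whose kernel consists of the
`(p - 1)`-st roots of unity. -/
theorem exists_unitsHom (hp : p ≠ 2) : ∃ θ : ℤ_[p]ˣ →* Multiplicative ℤ_[p],
    Continuous θ ∧ ∀ u, θ u = 1 ↔ u ^ (p - 1) = 1 := by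
  -- `f u` is the exponent `s` with `(1 + p) ^ s = u ^ (p - 1)`.
  choose f hf using fun u : ℤ_[p]ˣ =>
    exists_onePlusPow_eq p hp (PadicInt.prime_dvd_unit_pow_sub_one p u)
  have hinj := injective_onePlusPow p hp
  let θ : ℤ_[p]ˣ →* Multiplicative ℤ_[p] := MonoidHom.mk' f fun a b => hinj (by
    rw [map_mul, hf, hf, hf, Units.val_mul, mul_pow])
  have hemb : Topology.IsClosedEmbedding (onePlusPow p) :=
    (continuous_onePlusPow p).isClosedEmbedding hinj
  refine ⟨θ, ?_, fun u => ?_⟩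
  · rw [hemb.isInducing.continuous_iff]
    have : onePlusPow p ∘ θ = fun u : ℤ_[p]ˣ => (u : ℤ_[p]) ^ (p - 1) := funext hf
    rw [this]
    exact Units.continuous_val.pow _
  · rw [← hinj.eq_iff, map_one, Units.ext_iff, Units.val_pow_eq_pow_val, Units.val_one]
    exact Eq.congr_left (hf u)

end

/-! ### The field `ℚ(μ_{p^∞})` and its cyclotomic character -/

section

open Polynomial IntermediateField

theorem Normal.of_mem_adjoin {F E Ω : Type*} [Field F] [Field E] [Field Ω] [Algebra F E]
    [Algebra F Ω] [Algebra E Ω] [IsScalarTower F E Ω] {S : Set Ω}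
    (hS : ∀ s ∈ S, IsIntegral F s ∧ ((minpoly F s).map (algebraMap F E)).Splits)
    (hE : ∀ x : E, algebraMap E Ω x ∈ adjoin F S) : Normal F E := by
  refine normal_iff.mpr fun x => ⟨?_, ?_⟩
  · have := isAlgebraic_adjoin (K := F) (S := S) fun s hs => (hS s hs).1
    have h := (Algebra.IsAlgebraic.isAlgebraic (R := F) (⟨_, hE x⟩ : adjoin F S)).isIntegral
    have h' : IsIntegral F (algebraMap E Ω x) := h.map (adjoin F S).val
    exact (isIntegral_algHom_iff (IsScalarTower.toAlgHom F E Ω)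
      (algebraMap E Ω).injective).mp h'
  · rw [← minpoly.algebraMap_eq (algebraMap E Ω).injective x]
    exact splits_of_mem_adjoin F Ω hS (hE x)

/-- A basic neighbourhood fixes a finite extension, hence only finitely many generators matter, and
the stabilizers of their images are open. -/
theorem continuous_of_commutes {k A k' B : Type*} [Field k] [Field A] [Algebra k A]
    [Algebra.IsIntegral k A] [Field k'] [Field B] [Algebra k' B] (j : B →+* A)
    (φ : Gal(A/k) →* Gal(B/k')) (h : ∀ σ b, j (φ σ b) = σ (j b)) : Continuous φ := by
  refine continuous_of_continuousAt_one φ (continuousAt_def.mpr fun U hU => ?_)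
  rw [map_one, krullTopology_mem_nhds_one_iff] at hU
  obtain ⟨E, _, hE⟩ := hU
  obtain ⟨s, hs⟩ := Module.Finite.fg_top (R := k') (M := E)
  have hV : IsOpen (⋂ x ∈ s, (MulAction.stabilizer Gal(A/k) (j x) : Set Gal(A/k))) :=
    isOpen_biInter_finset fun x _ => stabilizer_isOpen_of_isIntegral (j x)
  refine Filter.mem_of_superset (hV.mem_nhds ?_) fun σ hσ => hE ?_
  · exact Set.mem_iInter₂.mpr fun x _ => one_mem _
  · rw [SetLike.mem_coe, IntermediateField.mem_fixingSubgroup_iff]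
    have hle : (φ σ).toLinearMap ∘ₗ E.val.toLinearMap = E.val.toLinearMap := by
      refine LinearMap.ext_on_range (v := ((↑) : s → E)) ?_ fun x => ?_
      · rw [Subtype.range_coe]
        exact hs
      · refine j.injective ((h σ _).trans ?_)
        exact Set.mem_iInter₂.mp hσ _ x.2
    intro x hx
    exact LinearMap.congr_fun hle ⟨x, hx⟩

variable (p : ℕ) (Ω : Type*) [Field Ω] [CharZero Ω]

theorem mem_rationalMuInfty {ζ : Ω} {n : ℕ} (h : ζ ^ p ^ n = 1) : ζ ∈ rationalMuInfty p Ω :=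
  subset_adjoin _ _ ⟨n, h⟩

variable [Fact p.Prime]

theorem rationalMuInfty_exists_isPrimitiveRoot [IsAlgClosed Ω] (n : ℕ) :
    ∃ ζ : rationalMuInfty p Ω, IsPrimitiveRoot ζ (p ^ n) := by
  have : NeZero ((p ^ n : ℕ) : Ω) :=
    ⟨Nat.cast_ne_zero.mpr (pow_ne_zero _ (Fact.out : p.Prime).ne_zero)⟩
  obtain ⟨ζ, hζ⟩ := HasEnoughRootsOfUnity.exists_primitiveRoot Ω (p ^ n)
  exact ⟨⟨ζ, mem_rationalMuInfty p Ω hζ.pow_eq_one⟩,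
    IsPrimitiveRoot.of_map_of_injective (f := (rationalMuInfty p Ω).val) hζ
      (rationalMuInfty p Ω).val.injective⟩

instance rationalMuInfty_hasEnoughRootsOfUnity [IsAlgClosed Ω] (n : ℕ) :
    HasEnoughRootsOfUnity (rationalMuInfty p Ω) (p ^ n) :=
  ⟨rationalMuInfty_exists_isPrimitiveRoot p Ω n, rootsOfUnity.isCyclic _ _⟩

instance rationalMuInfty_isGalois [IsAlgClosed Ω] : IsGalois ℚ (rationalMuInfty p Ω) := by
  have : Normal ℚ (rationalMuInfty p Ω) := by
    refine Normal.of_mem_adjoin (Ω := Ω) (S := {ζ : Ω | ∃ n : ℕ, ζ ^ p ^ n = 1}) ?_ fun x => x.2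
    rintro s ⟨n, hs⟩
    have hpos : 0 < p ^ n := pow_pos (Fact.out : p.Prime).pos n
    have hint : IsIntegral ℚ s := ⟨X ^ p ^ n - 1, monic_X_pow_sub_C 1 hpos.ne', by simp [hs]⟩
    obtain ⟨ζ, hζ⟩ := rationalMuInfty_exists_isPrimitiveRoot p Ω n
    refine ⟨hint, Splits.of_dvd (X_pow_sub_one_splits hζ) (X_pow_sub_C_ne_zero hpos 1) ?_⟩
    have := Polynomial.map_dvd (algebraMap ℚ (rationalMuInfty p Ω))
      (minpoly.dvd ℚ s (p := X ^ p ^ n - 1) (by simp [hs]))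
    simpa using this
  exact ⟨⟩

/-- The `p`-adic cyclotomic character of `Gal(ℚ(μ_{p^∞})/ℚ)`. -/
def rationalCyclotomicCharacter : Gal(rationalMuInfty p Ω/ℚ) →* ℤ_[p]ˣ :=
  (cyclotomicCharacter (rationalMuInfty p Ω) p).comp
    (MulSemiringAction.toRingAut Gal(rationalMuInfty p Ω/ℚ) (rationalMuInfty p Ω))

theorem continuous_rationalCyclotomicCharacter :
    Continuous (rationalCyclotomicCharacter p Ω) :=
  cyclotomicCharacter.continuous p ℚ _

theorem rationalCyclotomicCharacter_spec [IsAlgClosed Ω] (σ : Gal(rationalMuInfty p Ω/ℚ)) {n : ℕ}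
    {t : rationalMuInfty p Ω} (ht : t ^ p ^ n = 1) :
    σ t = t ^ (PadicInt.toZModPow n (rationalCyclotomicCharacter p Ω σ : ℤ_[p])).val :=
  cyclotomicCharacter.spec p (MulSemiringAction.toRingAut _ (rationalMuInfty p Ω) σ) t ht

theorem injective_rationalCyclotomicCharacter [IsAlgClosed Ω] :
    Function.Injective (rationalCyclotomicCharacter p Ω) := by
  intro σ τ h
  have key : ∀ x (hx : x ∈ rationalMuInfty p Ω), σ ⟨x, hx⟩ = τ ⟨x, hx⟩ := by
    intro x hx
    induction hx using adjoin_induction with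
    | mem x hx =>
      obtain ⟨n, hn⟩ := hx
      rw [rationalCyclotomicCharacter_spec p Ω σ (n := n) (Subtype.ext hn),
        rationalCyclotomicCharacter_spec p Ω τ (n := n) (Subtype.ext hn), h]
    | algebraMap x => exact (σ.commutes x).trans (τ.commutes x).symm
    | add x y hx hy h1 h2 =>
      have : (⟨x + y, add_mem hx hy⟩ : rationalMuInfty p Ω) = ⟨x, hx⟩ + ⟨y, hy⟩ := rfl
      rw [this, map_add, map_add, h1, h2]
    | inv x hx h1 =>
      have : (⟨x⁻¹, inv_mem hx⟩ : rationalMuInfty p Ω) = (⟨x, hx⟩)⁻¹ := rfl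
      rw [this, map_inv₀, map_inv₀, h1]
    | mul x y hx hy h1 h2 =>
      have : (⟨x * y, mul_mem hx hy⟩ : rationalMuInfty p Ω) = ⟨x, hx⟩ * ⟨y, hy⟩ := rfl
      rw [this, map_mul, map_mul, h1, h2]
  exact AlgEquiv.ext fun x => key x.1 x.2

/-- Conjugacy of primitive `p ^ 2`-th roots of unity over `ℚ` gives `σ` with `σ ζ = ζ ^ (1 + p)`.
Modulo `p ^ 2` the element `1 + p` has order `p`, which does not divide `p - 1`. -/
theorem exists_pow_sub_one_ne_one [IsAlgClosed Ω] (hp : p ≠ 2) :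
    ∃ σ : Gal(rationalMuInfty p Ω/ℚ), σ ^ (p - 1) ≠ 1 := by
  have hpp : p.Prime := Fact.out
  obtain ⟨ζ, hζ⟩ := rationalMuInfty_exists_isPrimitiveRoot p Ω 2
  have hpos : 0 < p ^ 2 := pow_pos hpp.pos 2
  have hcop : (1 + p).Coprime (p ^ 2) := by
    apply Nat.Coprime.pow_right
    simp
  have hconj : IsConjRoot ℚ ζ (ζ ^ (1 + p)) := by
    rw [IsConjRoot, ← cyclotomic_eq_minpoly_rat hζ hpos,
      ← cyclotomic_eq_minpoly_rat (hζ.pow_of_coprime _ hcop) hpos]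
  obtain ⟨σ, hσ⟩ := (isConjRoot_iff_exists_algEquiv).mp hconj.symm
  refine ⟨σ, fun h1 => ?_⟩
  have h2 (k : ℕ) : (σ ^ k) ζ = ζ ^ (1 + p) ^ k := by
    induction k with
    | zero => simp
    | succ k ih => rw [pow_succ, AlgEquiv.mul_apply, hσ, map_pow, ih, ← pow_mul, pow_succ]
  have h3 := h2 (p - 1)
  rw [h1, AlgEquiv.one_apply] at h3
  have h4 : ζ ^ (1 + p) ^ (p - 1) = ζ ^ 1 := by rw [pow_one]; exact h3.symm
  have hfin : IsOfFinOrder ζ := isOfFinOrder_iff_pow_eq_one.mpr ⟨_, hpos, hζ.pow_eq_one⟩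
  rw [hfin.pow_eq_pow_iff_modEq, ← hζ.eq_orderOf, ← ZMod.natCast_eq_natCast_iff] at h4
  push_cast at h4
  have h5 := orderOf_dvd_of_pow_eq_one h4
  rw [ZMod.orderOf_one_add_prime hpp hp 1, pow_one] at h5
  exact absurd (Nat.le_of_dvd (Nat.sub_pos_of_lt hpp.one_lt) h5)
    (not_le.mpr (Nat.sub_lt hpp.pos one_pos))

end

/-! ### Characters and the fixed fields of their kernels -/

section

open IntermediateField

variable {k M P : Type*} [Field k] [Field M] [Algebra k M] [IsGalois k M] [Group P]
  [TopologicalSpace P] [T1Space P]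

theorem fixingSubgroup_fixedField_ker (f : Gal(M/k) →* P) (hf : Continuous f) :
    (fixedField f.ker).fixingSubgroup = f.ker :=
  InfiniteGalois.fixingSubgroup_fixedField ⟨f.ker, isClosed_singleton.preimage hf⟩

theorem isGalois_fixedField_ker (f : Gal(M/k) →* P) (hf : Continuous f) :
    IsGalois k (fixedField f.ker) := by
  rw [← InfiniteGalois.normal_iff_isGalois, fixingSubgroup_fixedField_ker f hf]
  infer_instance

/-- A continuous character of `Gal(M/k)` gives rise to characters of the Galois groups of all
extensions which contain the fixed field of its kernel. -/
theorem exists_hom_of_fixedField_ker (f : Gal(M/k) →* P) (hf : Continuous f) {K A : Type*}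
    [Field K] [Field A] [Algebra K A] [Algebra k K] [Algebra k A] [IsScalarTower k K A]
    [Algebra.IsIntegral K A] (j : fixedField f.ker →+* A)
    (hj : j.comp (algebraMap k (fixedField f.ker)) = algebraMap k A) :
    ∃ κ : Gal(A/K) →* P, Continuous κ ∧ ∀ σ, κ σ = 1 ↔ ∀ b, σ (j b) = j b := by
  have := isGalois_fixedField_ker f hf
  let E := fixedField f.ker
  let r : Gal(M/k) →* Gal(E/k) := AlgEquiv.restrictNormalHom E
  have hr : Function.Surjective r := AlgEquiv.restrictNormalHom_surjective _
  have hrc : Continuous r := InfiniteGalois.restrictNormalHom_continuous _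
  have hker : r.ker = f.ker :=
    (IntermediateField.restrictNormalHom_ker _).trans (fixingSubgroup_fixedField_ker f hf)
  let κ := r.liftOfSurjective hr ⟨_, hker.le⟩
  have hκ (σ) : κ (r σ) = f σ := r.liftOfRightInverse_comp_apply _ _ _ σ
  have hκc : Continuous κ := by
    rw [(Topology.IsQuotientMap.of_surjective_continuous hr hrc).continuous_iff]
    exact hf.congr fun σ => (hκ σ).symm
  have hκ1 (g) : κ g = 1 ↔ g = 1 := by
    refine ⟨fun hg => ?_, fun hg => by rw [hg, map_one]⟩
    obtain ⟨σ, rfl⟩ := hr g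
    rw [hκ] at hg
    exact hker.ge hg
  let : Algebra E A := j.toAlgebra
  have : IsScalarTower k E A := IsScalarTower.of_algebraMap_eq' hj.symm
  let φ : Gal(A/K) →* Gal(E/k) :=
    (AlgEquiv.restrictNormalHom E).comp (AlgEquiv.restrictScalarsHom k)
  have hφ (σ : Gal(A/K)) (b : E) : j (φ σ b) = σ (j b) :=
    AlgEquiv.restrictNormal_commutes (σ.restrictScalars k) E b
  refine ⟨κ.comp φ, hκc.comp (continuous_of_commutes j φ hφ), fun σ => ?_⟩
  rw [MonoidHom.comp_apply, hκ1, AlgEquiv.ext_iff]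
  refine forall_congr' fun b => ?_
  rw [← hφ, j.injective.eq_iff, AlgEquiv.one_apply]

/-- Finite degree would make the kernel open, hence of finite index. The torsion-free target would
then force `f` to be trivial. -/
theorem not_finiteDimensional_fixedField_ker [IsMulTorsionFree P] (f : Gal(M/k) →* P)
    (hf : Continuous f) (hne : ∃ σ, f σ ≠ 1) : ¬ FiniteDimensional k (fixedField f.ker) := by
  intro hfin
  have hop : IsOpen (f.ker : Set Gal(M/k)) := by
    rw [← fixingSubgroup_fixedField_ker f hf]
    exact fixingSubgroup_isOpen _
  have : Finite (Gal(M/k) ⧸ f.ker) := Subgroup.quotient_finite_of_isOpen _ hop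
  have : f.ker.FiniteIndex := Subgroup.finiteIndex_of_finite_quotient
  obtain ⟨σ, hσ⟩ := hne
  have h : σ ^ f.ker.index ∈ f.ker := Subgroup.pow_index_mem _ σ
  rw [MonoidHom.mem_ker, map_pow, pow_eq_one_iff_left Subgroup.FiniteIndex.index_ne_zero] at h
  exact hσ h

end

/-! ### The character cutting out `ℚ_∞` -/

section

open IntermediateField

variable (p : ℕ) [Fact p.Prime] (Ω : Type*) [Field Ω] [CharZero Ω] [IsAlgClosed Ω]

/-- Torsion dies in the torsion-free `ℤ_p`. Conversely, an element of the kernel is killed by `p -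
1`, as the cyclotomic character is injective. -/
theorem closure_torsion_eq_ker {θ : ℤ_[p]ˣ →* Multiplicative ℤ_[p]}
    (hθ : ∀ u, θ u = 1 ↔ u ^ (p - 1) = 1) :
    Subgroup.closure {σ : Gal(rationalMuInfty p Ω/ℚ) | IsOfFinOrder σ} =
      (θ.comp (rationalCyclotomicCharacter p Ω)).ker := by
  refine le_antisymm ((Subgroup.closure_le _).mpr fun σ hσ => ?_)
    fun σ hσ => Subgroup.subset_closure ?_
  · have h1 := (θ.comp (rationalCyclotomicCharacter p Ω)).isOfFinOrder hσ
    exact h1.eq_one'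
  · refine isOfFinOrder_iff_pow_eq_one.mpr ⟨p - 1, Nat.sub_pos_of_lt (Fact.out : p.Prime).one_lt,
      injective_rationalCyclotomicCharacter p Ω ?_⟩
    rw [map_pow, map_one]
    exact (hθ _).mp hσ

/-- There is a continuous character of `Gal(ℚ(μ_{p^∞})/ℚ)` with values in `ℤ_p` which cuts out
the field `ℚ_∞`. -/
theorem exists_rationalZpHom (hp : p ≠ 2) :
    ∃ f : Gal(rationalMuInfty p Ω/ℚ) →* Multiplicative ℤ_[p],
      Continuous f ∧ (∃ σ, f σ ≠ 1) ∧ rationalZpExtension p Ω = lift (fixedField f.ker) := by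
  obtain ⟨θ, hθc, hθ⟩ := exists_unitsHom p hp
  refine ⟨θ.comp (rationalCyclotomicCharacter p Ω),
    hθc.comp (continuous_rationalCyclotomicCharacter p Ω), ?_, ?_⟩
  · obtain ⟨σ, hσ⟩ := exists_pow_sub_one_ne_one p Ω hp
    refine ⟨σ, fun h => hσ (injective_rationalCyclotomicCharacter p Ω ?_)⟩
    rw [map_pow, map_one]
    exact (hθ _).mp h
  · rw [← closure_torsion_eq_ker p Ω hθ]
    rfl

end

/-! ### Transfer from a finite quotient to a compact group -/

section

open Filter Topology

variable {p : ℕ} [Fact p.Prime] {G X : Type*} [Group G] [TopologicalSpace G]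
  [CompactSpace G] [Group X] [TopologicalSpace X] [T1Space X] [Finite X]

/-- Let `t` lift `n`, and choose `m` with `p ^ m` congruent to `1` modulo the order of `n`. Then all
`t ^ (p ^ m) ^ k` lift `n`, while their images under `κ` tend to `1`. The fibre over `n` is compact,
so its image under `κ` contains `1`. -/
theorem exists_mem_ker_map_eq (κ : G →* Multiplicative ℤ_[p]) (hκ : Continuous κ) (f : G →* X)
    (hf : Continuous f) (hs : Function.Surjective f) {n : X} (hn : ¬ p ∣ orderOf n) :
    ∃ g, κ g = 1 ∧ f g = n := by
  have hpp : p.Prime := Fact.out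
  obtain ⟨t, rfl⟩ := hs n
  set m := (orderOf (f t)).totient with hm
  have hpm : p ^ m ≡ 1 [MOD orderOf (f t)] :=
    Nat.ModEq.pow_totient ((Nat.Prime.coprime_iff_not_dvd hpp).mpr hn)
  have hm0 : 0 < m := Nat.totient_pos.mpr (orderOf_pos _)
  have hcomp : IsCompact (κ '' (f ⁻¹' {f t})) :=
    ((isClosed_singleton.preimage hf).isCompact).image hκ
  have hlim : Tendsto (fun k : ℕ => κ (t ^ (p ^ m) ^ k)) atTop (𝓝 1) := by
    have h1 : Tendsto (fun k : ℕ => ((p : ℤ_[p]) ^ m) ^ k * (κ t).toAdd) atTop (𝓝 0) := by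
      rw [← zero_mul (κ t).toAdd]
      refine Tendsto.mul_const _ (tendsto_pow_atTop_nhds_zero_iff_norm_lt_one.mpr ?_)
      rw [norm_pow]
      exact pow_lt_one₀ (norm_nonneg _) ((PadicInt.norm_lt_one_iff_dvd _).mpr dvd_rfl) hm0.ne'
    refine ((continuous_ofAdd.tendsto _).comp h1).congr fun k => ?_
    refine Multiplicative.toAdd.injective ?_
    rw [map_pow, toAdd_pow, nsmul_eq_mul]
    push_cast
    rfl
  have hmem : (1 : Multiplicative ℤ_[p]) ∈ κ '' (f ⁻¹' {f t}) := by
    refine hcomp.isClosed.mem_of_tendsto hlim (Eventually.of_forall fun k => ⟨_, ?_, rfl⟩)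
    have : (p ^ m) ^ k ≡ 1 [MOD orderOf (f t)] := by simpa using hpm.pow k
    rw [Set.mem_preimage, map_pow, Set.mem_singleton_iff]
    conv_rhs => rw [← pow_one (f t)]
    exact pow_eq_pow_iff_modEq.mpr this
  obtain ⟨g, hg, hg1⟩ := hmem
  exact ⟨g, hg1, hg⟩

/-- Let `G` be a compact group with a nontrivial character `κ : G → ℤ_p` and a surjection onto a
finite group `X` which is injective on the kernel of `κ`.  If `ℤ_p[X]` is `N`-hybrid, then
`N` lifts to `κ.ker`, and both `ℤ_p[κ.ker]` and `Λ(G)` are hybrid with respect to the lift. -/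
theorem hybrid_of_isHybridGroupRing [IsTopologicalGroup G] [T2Space G]
    (κ : G →* Multiplicative ℤ_[p]) (hκ : Continuous κ)
    (hne : ∃ g, κ g ≠ 1) (f : G →* X) (hf : Continuous f) (hs : Function.Surjective f)
    (hinj : ∀ g, κ g = 1 → f g = 1 → g = 1) {N : Subgroup X} (hN : IsHybridGroupRing p N)
    (H N' : Subgroup G) (hH : ∀ g, g ∈ H ↔ κ g = 1) (hN' : ∀ g, g ∈ N' ↔ κ g = 1 ∧ f g ∈ N) :
    Set.BijOn f N' N ∧ N'.Normal ∧ N' ≤ H ∧ (N'.subgroupOf H).Normal ∧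
      IsHybridGroupRing p (N'.subgroupOf H) ∧ IsHybridIwasawaAlgebra p N' := by
  have hHk : H = κ.ker := Subgroup.ext hH
  have hpN := hN.not_dvd_card
  have hNn : N.Normal := hN.normal
  have hNeq : N' = κ.ker ⊓ N.comap f := Subgroup.ext hN'
  have hN'n : N'.Normal := by
    rw [hNeq]
    infer_instance
  have hle : N' ≤ H := fun g hg => (hH g).mpr ((hN' g).mp hg).1
  have hinjOn : Set.InjOn f H := by
    intro a ha b hb hab
    have ha := (hH a).mp ha
    have hb := (hH b).mp hb
    refine inv_mul_eq_one.mp (hinj (a⁻¹ * b) ?_ ?_)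
    · rw [map_mul, map_inv, ha, hb, inv_one, one_mul]
    · rw [map_mul, map_inv, hab, inv_mul_cancel]
  have hbij : Set.BijOn f N' N := by
    refine ⟨fun g hg => ((hN' g).mp hg).2, hinjOn.mono hle, fun n hn => ?_⟩
    obtain ⟨g, hg, rfl⟩ := exists_mem_ker_map_eq κ hκ f hf hs (n := n)
      fun h => hpN (h.trans (Subgroup.orderOf_dvd_natCard N hn))
    exact ⟨g, (hN' g).mpr ⟨hg, hn⟩, rfl⟩
  have hfinH : Finite H := Finite.of_injective (fun g : H => f g) hinjOn.injective
  have hfinN : Finite N' := Finite.of_injective _ (Subgroup.inclusion_injective hle)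
  have hcard : Nat.card N' = Nat.card N := Nat.card_congr (Set.BijOn.equiv f hbij)
  -- An element of order `p` lies in the kernel of `κ`, where `f` is injective, so its image again
  -- has order `p` and `NoCommuting` for `N` applies.
  have hcomm : NoCommuting p N' := by
    intro g hg n hn hgn
    have hpp : p.Prime := Fact.out
    have hfin : IsOfFinOrder g := orderOf_pos_iff.mp (hg ▸ hpp.pos)
    have hκg : κ g = 1 := (κ.isOfFinOrder hfin).eq_one'
    have hfg : orderOf (f g) = p := by
      refine orderOf_eq_prime (by rw [← map_pow, ← hg, pow_orderOf_eq_one, map_one]) fun h => ?_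
      rw [hinj g hκg h, orderOf_one] at hg
      exact hpp.ne_one hg.symm
    obtain ⟨hκn, hfn⟩ := (hN' n).mp hn
    exact hinj n hκn (hN.noCommuting (f g) hfg (f n) hfn (by rw [← map_mul, hgn, map_mul]))
  have hcommH : NoCommuting p (N'.subgroupOf H) := by
    intro g hg n hn hgn
    rw [← Subgroup.orderOf_coe] at hg
    exact Subtype.ext (hcomm g hg n hn (congrArg Subtype.val hgn))
  have hnorm : (N'.subgroupOf H).Normal := inferInstance
  have : Finite κ.ker := hHk ▸ hfinH
  refine ⟨hbij, hN'n, hle, hnorm, isHybridGroupRing_of_noCommuting p hnorm ?_ hcommH,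
    isHybridIwasawaAlgebra_of_noCommuting (exists_isCentralZp κ hκ hne) hN'n (hcard ▸ hpN) hcomm⟩
  rwa [Nat.card_congr (Subgroup.subgroupOfEquivOfLe hle).toEquiv, hcard]

end

/-! ### The extension `L_∞/K` and its character -/

section

theorem RingHom.nonempty_of_range_le {E K A : Type*} [Field E] [Field K] [Field A] (g : K →+* A)
    (j : E →+* A) (h : ∀ b, ∃ a, g a = j b) : Nonempty (E →+* K) := by
  choose i hi using h
  exact ⟨{
    toFun := i
    map_one' := g.injective (by rw [hi, map_one, map_one])
    map_mul' := fun x y => g.injective (by rw [hi, map_mul, map_mul, hi, hi])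
    map_zero' := g.injective (by rw [hi, map_zero, map_zero])
    map_add' := fun x y => g.injective (by rw [hi, map_add, map_add, hi, hi]) }⟩

theorem Normal.isIntegral_and_splits_map {k E K A Ω : Type*} [Field k] [Field E] [Field K]
    [Field A] [Field Ω] [Algebra k E] [Algebra k K] [Algebra K A] [Algebra K Ω]
    [Algebra A Ω] [IsScalarTower K A Ω] (hE : Normal k E) (j : E →+* A)
    (hj : j.comp (algebraMap k E) = (algebraMap K A).comp (algebraMap k K)) {b : E} {s : Ω}
    (hs : algebraMap A Ω (j b) = s) :
    IsIntegral K s ∧ ((minpoly K s).map (algebraMap K A)).Splits := by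
  subst hs
  have hmonic : ((minpoly k b).map (algebraMap k K)).Monic :=
    (minpoly.monic (hE.isIntegral b)).map _
  have hroot : Polynomial.aeval (j b) ((minpoly k b).map (algebraMap k K)) = 0 := by
    rw [Polynomial.aeval_def, Polynomial.eval₂_map, ← hj, ← Polynomial.hom_eval₂,
      ← Polynomial.aeval_def, minpoly.aeval, map_zero]
  have hint : IsIntegral K (j b) := ⟨_, hmonic, hroot⟩
  refine ⟨hint.algebraMap, ?_⟩
  rw [minpoly.algebraMap_eq (algebraMap A Ω).injective]
  refine Polynomial.Splits.of_dvd ?_ (hmonic.map (algebraMap K A)).ne_zero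
    (Polynomial.map_dvd _ (minpoly.dvd K _ hroot))
  rw [Polynomial.map_map, ← hj, ← Polynomial.map_map]
  exact (hE.splits b).map j

end

section

open IntermediateField

variable (p : ℕ) (Ω : Type*) [Field Ω] [CharZero Ω]

theorem rationalZpExtension_mem_cyclotomicZpExtension (L : Type*) [Field L] [Algebra L Ω] {x : Ω}
    (hx : x ∈ rationalZpExtension p Ω) : x ∈ cyclotomicZpExtension p Ω L :=
  subset_adjoin L _ hx

variable (L : Type*) [Field L] [Algebra L Ω]

/-- If `ℚ_∞` is the lift of the subfield `E` of `ℚ(μ_{p^∞})`, the inclusion of `E` into `L_∞`. -/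
def rationalZpInclusion {E : IntermediateField ℚ (rationalMuInfty p Ω)}
    (hE : rationalZpExtension p Ω = lift E) : E →+* cyclotomicZpExtension p Ω L :=
  (((rationalMuInfty p Ω).val.toRingHom.comp E.val.toRingHom).codRestrict
    (cyclotomicZpExtension p Ω L).toSubfield fun x =>
      rationalZpExtension_mem_cyclotomicZpExtension p Ω L
        (hE ▸ (mem_lift (x : rationalMuInfty p Ω)).mpr x.2))

theorem exists_rationalZpInclusion_eq {E : IntermediateField ℚ (rationalMuInfty p Ω)}
    (hE : rationalZpExtension p Ω = lift E) {x : cyclotomicZpExtension p Ω L}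
    (hx : (x : Ω) ∈ rationalZpExtension p Ω) : ∃ b, rationalZpInclusion p Ω L hE b = x := by
  rw [hE] at hx
  refine ⟨⟨⟨x, lift_le E hx⟩, (mem_lift (⟨x, lift_le E hx⟩ : rationalMuInfty p Ω)).mp hx⟩, ?_⟩
  exact Subtype.ext rfl

variable (K : Type*) [Field K] [Algebra K Ω]

theorem mem_adjoin_of_mem_cyclotomicZpExtension {x : Ω} (hx : x ∈ cyclotomicZpExtension p Ω L) :
    x ∈ adjoin K (Set.range (algebraMap L Ω) ∪ rationalZpExtension p Ω) := by
  induction hx using adjoin_induction with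
  | mem x hx => exact subset_adjoin K _ (Or.inr hx)
  | algebraMap x => exact subset_adjoin K _ (Or.inl ⟨x, rfl⟩)
  | add x y _ _ h1 h2 => exact add_mem h1 h2
  | inv x _ h1 => exact inv_mem h1
  | mul x y _ _ h1 h2 => exact mul_mem h1 h2

instance cyclotomicZpExtension_isScalarTower [Algebra K L] [IsScalarTower K L Ω] :
    IsScalarTower K (cyclotomicZpExtension p Ω L) Ω :=
  IsScalarTower.of_algebraMap_eq fun _ => rfl

variable [Fact p.Prime] [IsAlgClosed Ω] [NumberField K] [Algebra K L]
  [IsGalois K L] [IsScalarTower K L Ω]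

/-- `L_∞` is generated over `K` by `L` and `ℚ_∞`, which are normal over `K` and `ℚ`. So the minimal
polynomials of the generators split in `L_∞`. -/
theorem cyclotomicZpExtension_isGalois (hp : p ≠ 2) :
    IsGalois K (cyclotomicZpExtension p Ω L) := by
  have : Normal K (cyclotomicZpExtension p Ω L) := by
    refine Normal.of_mem_adjoin (Ω := Ω) ?_
      fun x => mem_adjoin_of_mem_cyclotomicZpExtension p Ω L K x.2
    rintro s (⟨l, rfl⟩ | hs)
    · have hl : IsIntegral K l := Algebra.IsIntegral.isIntegral l
      refine ⟨hl.algebraMap, ?_⟩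
      rw [minpoly.algebraMap_eq (algebraMap L Ω).injective,
        IsScalarTower.algebraMap_eq K L (cyclotomicZpExtension p Ω L), ← Polynomial.map_map]
      exact (Normal.splits inferInstance l).map _
    · obtain ⟨f, hf, -, hE⟩ := exists_rationalZpHom p Ω hp
      have hgal := isGalois_fixedField_ker f hf
      obtain ⟨b, hb⟩ := exists_rationalZpInclusion_eq p Ω L hE (x := ⟨s,
        rationalZpExtension_mem_cyclotomicZpExtension p Ω L hs⟩) hs
      exact Normal.isIntegral_and_splits_map hgal.to_normal (rationalZpInclusion p Ω L hE)
        (Subsingleton.elim _ _) (congrArg Subtype.val hb)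
  exact ⟨⟩

/-- If `κ` were trivial, `ℚ_∞` would be fixed by `Gal(L_∞/K)` and hence embed into the number field
`K`, although it has infinite degree over `ℚ`. -/
theorem exists_cyclotomicHom (hp : p ≠ 2) :
    ∃ κ : iwasawaGaloisGroup p Ω K L →* Multiplicative ℤ_[p], Continuous κ ∧ (∃ σ, κ σ ≠ 1) ∧
      ∀ σ, κ σ = 1 ↔
        ∀ x : cyclotomicZpExtension p Ω L, (x : Ω) ∈ rationalZpExtension p Ω → σ x = x := by
  have := cyclotomicZpExtension_isGalois p Ω L K hp
  obtain ⟨f, hf, hne, hE⟩ := exists_rationalZpHom p Ω hp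
  let j := rationalZpInclusion p Ω L hE
  obtain ⟨κ, hκ, hκ1⟩ := exists_hom_of_fixedField_ker f hf
    (K := K) (A := cyclotomicZpExtension p Ω L) j (Subsingleton.elim _ _)
  refine ⟨κ, hκ, ?_, fun σ => ?_⟩
  · by_contra! hall
    refine not_finiteDimensional_fixedField_ker f hf hne ?_
    have hrange (b) : ∃ a : K, algebraMap K (cyclotomicZpExtension p Ω L) a = j b :=
      (InfiniteGalois.mem_range_algebraMap_iff_fixed _).mpr fun σ => (hκ1 σ).mp (hall σ) b
    obtain ⟨i⟩ := RingHom.nonempty_of_range_le _ j hrange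
    exact FiniteDimensional.of_injective i.toRatAlgHom.toLinearMap i.injective
  · rw [hκ1]
    refine ⟨fun h x hx => ?_, fun h b => h _ ?_⟩
    · obtain ⟨b, rfl⟩ := exists_rationalZpInclusion_eq p Ω L hE hx
      exact h b
    · rw [hE]
      exact (mem_lift (b : rationalMuInfty p Ω)).mpr b.2

end

/-! ### The subgroups `Gal(L_∞/F_∞)` in terms of generators -/

section

open IntermediateField

variable (p : ℕ) (Ω : Type*) [Field Ω] [CharZero Ω] (K L : Type*) [Field K] [Field L]
  [Algebra K L] [Algebra K Ω] [Algebra L Ω] [IsScalarTower K L Ω]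

theorem iwasawaRestrict_commutes [Normal K L] (σ : iwasawaGaloisGroup p Ω K L) (x : L) :
    algebraMap L (cyclotomicZpExtension p Ω L) (iwasawaRestrict p Ω K L σ x) =
      σ (algebraMap L (cyclotomicZpExtension p Ω L) x) :=
  AlgEquiv.restrictNormal_commutes σ L x

/-- As `F_∞` is generated over `F` by `ℚ_∞`, fixing it splits into a condition on `κ` and a
condition on the restriction to `L`. -/
theorem mem_iwasawaGaloisSubgroup_iff {F : Type*} [Field F] [Algebra F Ω] [Algebra F L]
    [IsScalarTower F L Ω] (σ : iwasawaGaloisGroup p Ω K L) :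
    σ ∈ iwasawaGaloisSubgroup p Ω K L F ↔
      (∀ x : cyclotomicZpExtension p Ω L, (x : Ω) ∈ rationalZpExtension p Ω → σ x = x) ∧
        ∀ y : F, σ (algebraMap L (cyclotomicZpExtension p Ω L) (algebraMap F L y)) =
          algebraMap L (cyclotomicZpExtension p Ω L) (algebraMap F L y) := by
  rw [iwasawaGaloisSubgroup, mem_fixingSubgroup_iff]
  refine ⟨fun h => ⟨fun x hx => h x (subset_adjoin F _ hx), fun y => h _ ?_⟩, fun ⟨h1, h2⟩ => ?_⟩
  · have : (algebraMap L (cyclotomicZpExtension p Ω L) (algebraMap F L y) : Ω) =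
        algebraMap F Ω y := (IsScalarTower.algebraMap_apply F L Ω y).symm
    rw [Set.mem_ofPred_eq, this]
    exact (cyclotomicZpExtension p Ω F).algebraMap_mem y
  · have key (z : Ω) (hz : z ∈ cyclotomicZpExtension p Ω F) :
        ∃ x : cyclotomicZpExtension p Ω L, (x : Ω) = z ∧ σ x = x := by
      induction hz using adjoin_induction with
      | mem z hz =>
        have hx := rationalZpExtension_mem_cyclotomicZpExtension p Ω L hz
        exact ⟨⟨z, hx⟩, rfl, h1 _ hz⟩
      | algebraMap y => exact ⟨_, (IsScalarTower.algebraMap_apply F L Ω y).symm, h2 y⟩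
      | add _ _ _ _ hx hy =>
        obtain ⟨x, rfl, hx⟩ := hx
        obtain ⟨y, rfl, hy⟩ := hy
        exact ⟨x + y, rfl, by rw [map_add, hx, hy]⟩
      | inv _ _ hx =>
        obtain ⟨x, rfl, hx⟩ := hx
        exact ⟨x⁻¹, rfl, by rw [map_inv₀, hx]⟩
      | mul _ _ _ _ hx hy =>
        obtain ⟨x, rfl, hx⟩ := hx
        obtain ⟨y, rfl, hy⟩ := hy
        exact ⟨x * y, rfl, by rw [map_mul, hx, hy]⟩
    intro x hx
    obtain ⟨x', hx', hσ⟩ := key x hx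
    obtain rfl := Subtype.ext hx'
    exact hσ

end

end

/-! ### The main theorem -/

theorem proposition3p15 (p : ℕ) [Fact p.Prime] (hp : p ≠ 2)
    (K L Ω : Type*) [Field K] [NumberField K] [Field L] [NumberField L] [Algebra K L]
    [IsGalois K L]
    [Field Ω] [CharZero Ω] [IsAlgClosed Ω] [Algebra K Ω] [Algebra L Ω] [IsScalarTower K L Ω]
    (N : Subgroup Gal(L/K)) (hN : N.Normal) (hybrid : IsHybridGroupRing p N) :
    let H : Subgroup (iwasawaGaloisGroup p Ω K L) := iwasawaGaloisSubgroup p Ω K L K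
    let N' : Subgroup (iwasawaGaloisGroup p Ω K L) :=
      iwasawaGaloisSubgroup p Ω K L (IntermediateField.fixedField N)
    Set.BijOn (iwasawaRestrict p Ω K L) N' N ∧
      N'.Normal ∧ N' ≤ H ∧ (N'.subgroupOf H).Normal ∧
      IsHybridGroupRing p (N'.subgroupOf H) ∧
      IsHybridIwasawaAlgebra p N' := by
  intro H N'
  have : FiniteDimensional K L := Module.Finite.of_restrictScalars_finite ℚ K L
  have := cyclotomicZpExtension_isGalois p Ω L K hp
  obtain ⟨κ, hκ, hne, hκ1⟩ := exists_cyclotomicHom p Ω L K hp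
  have hinj := (algebraMap L (cyclotomicZpExtension p Ω L)).injective
  have hfix (σ : iwasawaGaloisGroup p Ω K L) (F : IntermediateField K L) :
      σ ∈ iwasawaGaloisSubgroup p Ω K L F ↔
        κ σ = 1 ∧ iwasawaRestrict p Ω K L σ ∈ F.fixingSubgroup := by
    rw [mem_iwasawaGaloisSubgroup_iff, hκ1, IntermediateField.mem_fixingSubgroup_iff]
    refine and_congr_right fun _ => ⟨fun h x hx => hinj ?_, fun h y => ?_⟩
    · rw [iwasawaRestrict_commutes]
      exact h ⟨x, hx⟩
    · rw [← iwasawaRestrict_commutes]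
      exact congrArg _ (h y y.2)
  refine hybrid_of_isHybridGroupRing κ hκ hne (iwasawaRestrict p Ω K L)
    (continuous_of_commutes (algebraMap L (cyclotomicZpExtension p Ω L)) _
      (iwasawaRestrict_commutes p Ω K L)) (AlgEquiv.restrictNormalHom_surjective _) ?_ hybrid H N'
    (fun σ => ?_) fun σ => ?_
  -- The description of `Gal(L_∞/F_∞)` is used with `F = L`: an automorphism trivial on `ℚ_∞` and on
  -- `L` is trivial on `L_∞`.
  · intro σ h1 h2
    have hσ : σ ∈ iwasawaGaloisSubgroup p Ω K L L := by
      rw [mem_iwasawaGaloisSubgroup_iff, ← hκ1]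
      refine ⟨h1, fun y => ?_⟩
      rw [Algebra.algebraMap_self_apply, ← iwasawaRestrict_commutes, h2, AlgEquiv.one_apply]
    exact AlgEquiv.ext fun x => (mem_fixingSubgroup_iff _).mp hσ x x.2
  · rw [mem_iwasawaGaloisSubgroup_iff, hκ1, and_iff_left_iff_imp]
    intro _ y
    rw [← IsScalarTower.algebraMap_apply K L, σ.commutes]
  · rw [hfix, IntermediateField.fixingSubgroup_fixedField]
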